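/- Let $M$ be a smooth paracompact (Hausdorff) manifold of dimension $n\ge 3$, let $\tau\colon T^\circ M\to M$ be its tangent bundle with the zero section removed, and let $\Delta$ be the Liouville (radial) vector field. A spray is a smooth vector field $\Gamma$ on $T^\circ M$ with $\tau_*\Gamma_{(x,y)}=y$ and $[\Delta,\Gamma]=\Gamma$; its geodesics are the projections to $M$ of its integral curves. Two sprays are projectively equivalent if they have the same geodesics up to orientation-preserving reparametrization. Fix a projective class of sprays, and let $\mathcal D$ be the two-dimensional distribution on $T^\circ M$ spanned by $\Delta$ and any spray of the class. Assume that there is a smooth $(2n-2)$-dimensional manifold $P_{\mathcal D}$ (path space) and a smooth surjective submersion $\pi\colon T^\circ M\to P_{\mathcal D}$ whose fibres are exactly the leaves of the foliation defined by $\mathcal D$. For $x\in M$ let $\hat x=\pi(T^\circ_xM)$, an immersed submanifold of $P_{\mathcal D}$ (all paths through $x$). For open $U\subseteq M$, a pseudo-Finsler function on $T^\circ U$ is a smooth function $F$ on $T^\circ U$, positively homogeneous of degree $1$ on the fibres, such that $\frac{\partial^2F}{\partial y^i\partial y^j}(x,y)\,v^j=0$ if and only if $v$ is a scalar multiple of $y$.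 Its geodesic class consists of the sprays on $T^\circ U$ whose geodesics are solutions of the Euler–Lagrange equations of $F$, and its Hilbert 2-form is $d\theta$ with $\theta=\frac{\partial F}{\partial y^i}dx^i$. Consider the condition (L) there is a symplectic form $\Omega$ on $P_{\mathcal D}$ for which $\hat x$ is Lagrangian for every $x\in M$. Then: 1. If the projective class is the geodesic class of a pseudo-Finsler function on $T^\circ M$, then (L) holds. 2. If $H^2_{\mathrm{dR}}(M)=0$, then the projective class is the geodesic class of a pseudo-Finsler function on $T^\circ M$ if and only if (L) holds. 3. With no condition on $H^2_{\mathrm{dR}}(M)$, (L) holds if and only if the projective class is the geodesic class of locally defined pseudo-Finsler functions with a common Hilbert 2-form; that is, every $x\in M$ has an open neighbourhood $U_x$ and a pseudo-Finsler function $F_x$ on $T^\circ U_x$ whose geodesic class is the restriction of the projective class to $T^\circ U_x$, such that for all $x,x'$ the Hilbert 2-forms of $F_x$ and $F_{x'}$ agree on $T^\circ(U_x\cap U_{x'})$. -/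

import Mathlib

open Set
open scoped Manifold ContDiff

namespace PathGeometry

section Forms

/-! Differential forms on a boundaryless manifold `N`, through their coordinate expressions. -/

variable {E : Type*} [NormedAddCommGroup E] [NormedSpace ℝ E]
  {H : Type*} [TopologicalSpace H] (I : ModelWithCorners ℝ E H)
  {N : Type*} [TopologicalSpace N] [ChartedSpace H N]

/-- A (not necessarily continuous) differential `k`-form on `N`. -/
abbrev DForm (N : Type*) [TopologicalSpace N] [ChartedSpace H N] (k : ℕ) : Type _ :=
  ∀ q : N, TangentSpace I q [⋀^Fin k]→L[ℝ] ℝ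

/-- The coordinate expression of a form in the preferred chart at `p`: its pullback under the
inverse of the chart. Only its values on the target of the chart are meaningful. -/
noncomputable def formInChart {k : ℕ} (σ : DForm I N k) (p : N) : E → E [⋀^Fin k]→L[ℝ] ℝ :=
  fun z ↦ (σ ((extChartAt I p).symm z)).compContinuousLinearMap
    (mfderiv 𝓘(ℝ, E) I (extChartAt I p).symm z)

/-- `C^∞` forms. -/
def IsSmoothForm {k : ℕ} (σ : DForm I N k) : Prop :=
  ∀ p : N, ContDiffOn ℝ ∞ (formInChart I σ p) (extChartAt I p).target

/-- `dα = β`. -/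
def IsExtDeriv {k : ℕ} (α : DForm I N k) (β : DForm I N (k + 1)) : Prop :=
  ∀ p : N, ∀ z ∈ (extChartAt I p).target, extDeriv (formInChart I α p) z = formInChart I β p z

/-- `dσ = 0`. -/
def IsClosedForm {k : ℕ} (σ : DForm I N k) : Prop :=
  IsExtDeriv I σ (0 : DForm I N (k + 1))

/-- Symplectic 2-forms: smooth, closed and nondegenerate. -/
structure IsSymplectic (Ω : DForm I N 2) : Prop where
  smooth : IsSmoothForm I Ω
  closed : IsClosedForm I Ω
  nondegenerate : ∀ (p : N) (ξ : TangentSpace I p), (∀ η, Ω p ![ξ, η] = 0) → ξ = 0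

/-- A subspace `L` of the tangent space at `p` is Lagrangian for `Ω` if it is equal to its own
`Ω`-orthogonal. -/
def IsLagrangianAt (Ω : DForm I N 2) (p : N) (L : Submodule ℝ (TangentSpace I p)) : Prop :=
  ∀ ξ, ξ ∈ L ↔ ∀ η ∈ L, Ω p ![ξ, η] = 0

/-- The second de Rham cohomology of `N` vanishes: each smooth closed 2-form is the exterior
derivative of a smooth 1-form. -/
def SecondDeRhamVanishes (N : Type*) [TopologicalSpace N] [ChartedSpace H N] : Prop :=
  ∀ β : DForm I N 2, IsSmoothForm I β → IsClosedForm I β →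
    ∃ α : DForm I N 1, IsSmoothForm I α ∧ IsExtDeriv I α β

end Forms

section Sprays

variable {n : ℕ} {M : Type*} [TopologicalSpace M] [ChartedSpace (EuclideanSpace ℝ (Fin n)) M]
  [IsManifold (𝓡 n) ∞ M]

/-- The slit tangent bundle `T°U` over `U ⊆ M`, as a subset of `TM`. -/
def slit (U : Set M) : Set (TangentBundle (𝓡 n) M) :=
  {v | v.1 ∈ U ∧ v.2 ≠ 0}

/-- A vector field on the manifold `TM`. All the conditions below concern only its restriction to
a slit tangent bundle. -/
abbrev VField (n : ℕ) (M : Type*) [TopologicalSpace M] [ChartedSpace (EuclideanSpace ℝ (Fin n)) M]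
    [IsManifold (𝓡 n) ∞ M] : Type _ :=
  ∀ v : TangentBundle (𝓡 n) M, TangentSpace (𝓡 n).tangent v

/-- The differential at `v` of the projection `τ : TM → M`. -/
noncomputable def dproj (v : TangentBundle (𝓡 n) M) :
    TangentSpace (𝓡 n).tangent v →L[ℝ] TangentSpace (𝓡 n) v.1 :=
  mfderiv (𝓡 n).tangent (𝓡 n) (fun w : TangentBundle (𝓡 n) M ↦ w.1) v

/-- The Liouville field `Δ`: its value at `(x, y)` is the velocity at `s = 0` of the curve
`s ↦ (x, y + s y)`. -/
noncomputable def liouville : VField n M := fun v ↦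
  mfderiv 𝓘(ℝ, ℝ) (𝓡 n).tangent
    (fun s : ℝ ↦ (⟨v.1, (1 + s) • v.2⟩ : TangentBundle (𝓡 n) M)) 0 (1 : ℝ)

/-- Sprays on `T°U`: smooth vector fields with `τ_* Γ_(x,y) = y` and `[Δ, Γ] = Γ`. -/
structure IsSpray (U : Set M) (Γ : VField n M) : Prop where
  smooth : ContMDiffOn (𝓡 n).tangent (𝓡 n).tangent.tangent ∞
    (fun v ↦ (⟨v, Γ v⟩ : TangentBundle (𝓡 n).tangent (TangentBundle (𝓡 n) M))) (slit U)
  secondOrder : ∀ v ∈ slit (n := n) U, dproj v (Γ v) = v.2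
  homogeneous : ∀ v ∈ slit (n := n) U,
    VectorField.mlieBracket (𝓡 n).tangent liouville Γ v = Γ v

/-- `c` is, on the open interval `J`, a geodesic of the spray `Γ` on `T°U`: the projection of an
integral curve of `Γ` in `T°U`. -/
def IsGeodesicOn (U : Set M) (Γ : VField n M) (c : ℝ → M) (J : Set ℝ) : Prop :=
  IsOpen J ∧ J.OrdConnected ∧ ∃ γ : ℝ → TangentBundle (𝓡 n) M,
    IsMIntegralCurveOn γ Γ J ∧ ∀ t ∈ J, γ t ∈ slit U ∧ (γ t).1 = c t

/-- Every geodesic of `Γ₁` becomes a geodesic of `Γ₂` after an orientation-preserving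
reparametrization `φ : J' → J`. -/
def GeodesicsReparametrize (U : Set M) (Γ₁ Γ₂ : VField n M) : Prop :=
  ∀ (c : ℝ → M) (J : Set ℝ), IsGeodesicOn U Γ₁ c J →
    ∃ (φ : ℝ → ℝ) (J' : Set ℝ), IsOpen J' ∧ J'.OrdConnected ∧ ContDiffOn ℝ ∞ φ J' ∧
      (∀ s ∈ J', 0 < deriv φ s) ∧ φ '' J' = J ∧ IsGeodesicOn U Γ₂ (c ∘ φ) J'

/-- Projective equivalence of sprays on `T°U`. -/
def ProjectivelyEquivalent (U : Set M) (Γ₁ Γ₂ : VField n M) : Prop :=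
  GeodesicsReparametrize U Γ₁ Γ₂ ∧ GeodesicsReparametrize U Γ₂ Γ₁

/-- The projective class on `T°U` of the spray `Γ`. -/
def projectiveClass (U : Set M) (Γ : VField n M) : Set (VField n M) :=
  {Γ' | IsSpray U Γ' ∧ ProjectivelyEquivalent U Γ Γ'}

/-! Pseudo-Finsler functions -/

/-- The Hessian at `v = (x, y)` of `F` with respect to the fibre coordinates. -/
noncomputable def fibreHessian (F : TangentBundle (𝓡 n) M → ℝ) (v : TangentBundle (𝓡 n) M) :
    EuclideanSpace ℝ (Fin n) →L[ℝ] EuclideanSpace ℝ (Fin n) →L[ℝ] ℝ :=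
  fderiv ℝ (fderiv ℝ (fun y : EuclideanSpace ℝ (Fin n) ↦ F ⟨v.1, y⟩)) v.2

/-- Pseudo-Finsler functions on `T°U`: smooth, positively homogeneous (of degree 1), with
quasi-regular fibre Hessian. -/
structure IsPseudoFinsler (U : Set M) (F : TangentBundle (𝓡 n) M → ℝ) : Prop where
  smooth : ContMDiffOn (𝓡 n).tangent 𝓘(ℝ, ℝ) ∞ F (slit U)
  homogeneous : ∀ v ∈ slit (n := n) U, ∀ s : ℝ, 0 < s → F ⟨v.1, s • v.2⟩ = s * F v
  quasiRegular : ∀ v ∈ slit (n := n) U, ∀ w : EuclideanSpace ℝ (Fin n),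
    (∀ w', fibreHessian F v w w' = 0) ↔ ∃ k : ℝ, w = k • v.2

/-- The velocity of a curve in `M`, as a curve in `TM`. -/
noncomputable def velocity (c : ℝ → M) (t : ℝ) : TangentBundle (𝓡 n) M :=
  ⟨c t, mfderiv 𝓘(ℝ, ℝ) (𝓡 n) c t (1 : ℝ)⟩

/-- The Euler-Lagrange equations `d/dt (∂F/∂y^i) = ∂F/∂x^i` along `c` at time `t`, in all the
charts `(x, y)` of `TM` induced by charts `x` of `M`. -/
def EulerLagrangeAt (F : TangentBundle (𝓡 n) M → ℝ) (c : ℝ → M) (t : ℝ) : Prop :=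
  ∀ p : TangentBundle (𝓡 n) M, velocity c t ∈ (extChartAt (𝓡 n).tangent p).source →
    ∀ e : EuclideanSpace ℝ (Fin n),
      HasDerivAt
        (fun s ↦ fderiv ℝ (F ∘ (extChartAt (𝓡 n).tangent p).symm)
          (extChartAt (𝓡 n).tangent p (velocity c s)) (0, e))
        (fderiv ℝ (F ∘ (extChartAt (𝓡 n).tangent p).symm)
          (extChartAt (𝓡 n).tangent p (velocity c t)) (e, 0)) t

/-- The geodesic sprays on `T°U` of `F`: the sprays whose geodesics are solutions of the
Euler-Lagrange equations of `F`. -/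
def geodesicSprays (U : Set M) (F : TangentBundle (𝓡 n) M → ℝ) : Set (VField n M) :=
  {Γ | IsSpray U Γ ∧ ∀ (c : ℝ → M) (J : Set ℝ), IsGeodesicOn U Γ c J →
    ∀ t ∈ J, EulerLagrangeAt F c t}

/-- `F` is a pseudo-Finsler function on `T°U`, and the projective class of `Γ` over `U` is the
geodesic class of `F`. -/
def IsMetrizedBy (U : Set M) (Γ : VField n M) (F : TangentBundle (𝓡 n) M → ℝ) : Prop :=
  IsPseudoFinsler U F ∧ projectiveClass U Γ = geodesicSprays U F

/-- The Hilbert 1-form `θ = (∂F/∂y^i) dx^i` of `F`. -/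
noncomputable def hilbertOneForm (F : TangentBundle (𝓡 n) M → ℝ) :
    DForm (𝓡 n).tangent (TangentBundle (𝓡 n) M) 1 := fun v ↦
  ContinuousAlternatingMap.ofSubsingleton ℝ (TangentSpace (𝓡 n).tangent v) ℝ (0 : Fin 1)
    ((fderiv ℝ (fun y : EuclideanSpace ℝ (Fin n) ↦ F ⟨v.1, y⟩) v.2 :
      TangentSpace (𝓡 n) v.1 →L[ℝ] ℝ).comp (dproj v))

/-- The Hilbert 2-forms `dθ` of `F₁` and `F₂` agree on `T°U`. -/
def SameHilbertTwoForm (U : Set M) (F₁ F₂ : TangentBundle (𝓡 n) M → ℝ) : Prop :=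
  ∀ p : TangentBundle (𝓡 n) M, ∀ z ∈ (extChartAt (𝓡 n).tangent p).target,
    (extChartAt (𝓡 n).tangent p).symm z ∈ slit U →
      extDeriv (formInChart (𝓡 n).tangent (hilbertOneForm F₁) p) z =
        extDeriv (formInChart (𝓡 n).tangent (hilbertOneForm F₂) p) z

/-! Path space -/

/-- The distribution `𝒟` spanned by the Liouville field and `Γ`. -/
noncomputable def pathDistribution (Γ : VField n M) (v : TangentBundle (𝓡 n) M) :
    Submodule ℝ (TangentSpace (𝓡 n).tangent v) :=
  Submodule.span ℝ {liouville v, Γ v}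

/-- `v` and `w` lie on the same leaf of the foliation of `T°M` defined by `𝒟`: they are joined by
a smooth curve in `T°M` tangent to `𝒟`. -/
def SameLeaf (Γ : VField n M) (v w : TangentBundle (𝓡 n) M) : Prop :=
  ∃ γ : ℝ → TangentBundle (𝓡 n) M, ContMDiff 𝓘(ℝ, ℝ) (𝓡 n).tangent ∞ γ ∧
    γ 0 = v ∧ γ 1 = w ∧ ∀ t : ℝ, γ t ∈ slit univ ∧
      mfderiv 𝓘(ℝ, ℝ) (𝓡 n).tangent γ t (1 : ℝ) ∈ pathDistribution Γ (γ t)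

variable {P : Type*} [TopologicalSpace P] [ChartedSpace (EuclideanSpace ℝ (Fin (2 * n - 2))) P]

/-- The `(2n-2)`-dimensional manifold `P`, with `π : T°M → P`, is the path space: `π` is a smooth
surjective submersion whose fibres are the leaves of `𝒟`. Values of `π` outside `T°M` are
irrelevant. -/
structure IsPathSpace (Γ : VField n M) (π : TangentBundle (𝓡 n) M → P) : Prop where
  smooth : ContMDiffOn (𝓡 n).tangent (𝓡 (2 * n - 2)) ∞ π (slit univ)
  surjective : π '' slit univ = univ
  submersion : ∀ v ∈ slit (n := n) (M := M) univ,
    Function.Surjective (mfderiv (𝓡 n).tangent (𝓡 (2 * n - 2)) π v)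
  fibres : ∀ v ∈ slit (n := n) (M := M) univ, ∀ w ∈ slit (n := n) (M := M) univ,
    π v = π w ↔ SameLeaf Γ v w

/-- The tangent space at `π v` to the (immersed) submanifold `x̂ = π (T°_x M)` of `P`, where
`v ∈ T°_x M`, or more precisely to the branch of `x̂` through `π v` given by `v`: the image under
`π_*` of the tangent space at `v` to `T°_x M`, which is the space of vertical vectors. -/
noncomputable def hatTangent (π : TangentBundle (𝓡 n) M → P) (v : TangentBundle (𝓡 n) M) :
    Submodule ℝ (TangentSpace (𝓡 (2 * n - 2)) (π v)) :=
  (LinearMap.ker (dproj v).toLinearMap).map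
    (mfderiv (𝓡 n).tangent (𝓡 (2 * n - 2)) π v).toLinearMap

/-- For the point `x` of `M`, the submanifold `x̂ = π (T°_x M)` of `P` is Lagrangian for `Ω`. -/
def HatIsLagrangian (π : TangentBundle (𝓡 n) M → P) (Ω : DForm (𝓡 (2 * n - 2)) P 2) (x : M) :
    Prop :=
  ∀ v ∈ slit (n := n) {x}, IsLagrangianAt (𝓡 (2 * n - 2)) Ω (π v) (hatTangent π v)

/-- `P` carries a symplectic form for which all the submanifolds `x̂` are Lagrangian. -/
def HasLagrangianSymplecticForm (π : TangentBundle (𝓡 n) M → P) : Prop :=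
  ∃ Ω : DForm (𝓡 (2 * n - 2)) P 2,
    IsSymplectic (𝓡 (2 * n - 2)) Ω ∧ ∀ x : M, HatIsLagrangian π Ω x

end Sprays

end PathGeometry

/-!
# Projective metrizability and symplectic forms on the path space

The theorem is proved by passing through closed 2-forms on the slit tangent bundle. Let `𝒟` be the
distribution spanned by the Liouville field and a spray `Γ` of the class. A form `τ` on `T°M` is
called a path form for `Γ` (`IsPathForm`) if it is closed, vanishes on pairs of vertical vectors and
has the kernel `𝒟`. Path forms are compared with pseudo-Finsler functions on one side, and with
symplectic forms on the path space on the other.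

*Pseudo-Finsler functions.* In coordinates, the contraction of the Hilbert 2-form `dθ` of a
homogeneous function `F` with a spray is the Euler-Lagrange expression of `F`, so that the geodesic
sprays of `F` are the sprays that annihilate `dθ` (`mem_geodesicSprays_iff`). Two sprays are
projectively equivalent if and only if they differ by a multiple of the Liouville field
(`projectivelyEquivalent_iff`), and quasi-regularity of the fibre Hessian of `F` means that a spray
annihilating `dθ` spans, with the Liouville field, its whole kernel
(`IsPseudoFinsler.mem_kernel_iff`, `isPseudoFinsler_of_kernel`). Hence the class of `Γ` is the
geodesic class of `F` exactly if `F` is pseudo-Finsler and `Γ` annihilates `dθ`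
(`isMetrizedBy_iff`), and local pseudo-Finsler functions for the class with a common Hilbert 2-form
give a path form (`isPathForm_of_sameHilbertTwoForm`).

*The path space.* The kernel of `dπ` is `𝒟`, by a count of dimensions
(`IsPathSpace.dpath_eq_zero_iff`). The pullback by `π` of a symplectic form for which all `x̂` are
Lagrangian is therefore a path form (`IsPathSpace.isPathForm_pullback`). Conversely, a closed form
annihilated by the kernels of the differentials of a submersion with connected fibres is the
pullback of a closed form: it is constant along curves in the fibres (`exists_pullback_eq`). The
leaves of `𝒟` are connected, so that a path form descends to a symplectic form for which all `x̂`
are isotropic; for Hilbert 2-forms, quasi-regularity makes them Lagrangian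
(`IsPathSpace.hasLagrangianSymplecticForm`).

*Potentials.* It remains to show that each path form `τ` is locally a Hilbert 2-form
(`IsPathForm.exists_local_potential`). Over a ball `B` in a chart of `M`, the mixed part of `τ` is,
for each `x ∈ B`, a closed 1-form on the slit tangent space with values in covectors. As `n ≥ 3`,
such a form has a primitive (`exists_primitive_punctured`): the punctured space is the union of two
star-shaped regions, the complements of two opposite rays, whose intersection, the complement of a
line, is connected. The primitive is corrected by a 1-form on `B`, obtained from the Poincaré lemma
on `B`, to covectors `θ` for which `dθ = τ`; then `F = θ(y)` is homogeneous, and `θ = ∂F/∂y` because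
`Γ` annihilates `τ` (`exists_hilbert_potential`). This gives the local statement.

If `H²(M) = 0`, the local functions are glued with a partition of unity to a homogeneous function
`F'` with the right fibre Hessian. The difference between its Hilbert 2-form and `τ` then kills the
vertical vectors and descends to a closed 2-form `β = dα` on `M`, by the same descent lemma, since
the slit tangent spaces are connected. The function `F'(x, y) - α_x(y)` has the Hilbert 2-form `τ`
(`IsPathForm.exists_isMetrizedBy`).

Forms are handled through their expressions in the preferred charts. The chart of `TM` at `v` is
normalized so that its differential at `v` is the identity of the model space; a form or a field at
`v` is thus equal to its own coordinate expression (`formInChart_self`, `fieldInChart_self`).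
-/

set_option linter.unusedSectionVars false

namespace PathGeometry

/-! ### Calculus of alternating forms on vector spaces -/

section FormCalculus

variable {E F G : Type*} [NormedAddCommGroup E] [NormedSpace ℝ E]
  [NormedAddCommGroup F] [NormedSpace ℝ F] [NormedAddCommGroup G] [NormedSpace ℝ G]

theorem extDeriv_apply_pair {α : E → E [⋀^Fin 1]→L[ℝ] ℝ} {z : E}
    (u v : E) :
    extDeriv α z ![u, v] = fderiv ℝ α z u ![v] - fderiv ℝ α z v ![u] := by
  simp only [extDeriv, ContinuousAlternatingMap.alternatizeUncurryFin_apply, Fin.sum_univ_succ]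
  have h1 : Fin.removeNth (α := fun _ => E) 0 ![u, v] = ![v] := by
    ext i; fin_cases i; rfl
  have h2 : Fin.removeNth (α := fun _ => E) 1 ![u, v] = ![u] := by
    ext i; fin_cases i; rfl
  simp [h1, h2, sub_eq_add_neg]

theorem extDeriv_apply_triple {η : E → E [⋀^Fin 2]→L[ℝ] ℝ} {z : E} (u v w : E) :
    extDeriv η z ![u, v, w] =
      fderiv ℝ η z u ![v, w] - fderiv ℝ η z v ![u, w] + fderiv ℝ η z w ![u, v] := by
  simp only [extDeriv, ContinuousAlternatingMap.alternatizeUncurryFin_apply, Fin.sum_univ_succ]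
  have h1 : Fin.removeNth (α := fun _ => E) 0 ![u, v, w] = ![v, w] := by
    ext i; fin_cases i <;> rfl
  have h2 : Fin.removeNth (α := fun _ => E) 1 ![u, v, w] = ![u, w] := by
    ext i; fin_cases i <;> rfl
  have h3 : Fin.removeNth (α := fun _ => E) 2 ![u, v, w] = ![u, v] := by
    ext i; fin_cases i <;> rfl
  simp [h1, h2, h3, sub_eq_add_neg, add_assoc]

theorem alternating_two_ext {η η' : E [⋀^Fin 2]→L[ℝ] ℝ}
    (h : ∀ u v, η ![u, v] = η' ![u, v]) : η = η' := by
  ext m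
  have : m = ![m 0, m 1] := by ext i; fin_cases i <;> rfl
  rw [this]; exact h _ _

theorem alternating_one_ext {η η' : E [⋀^Fin 1]→L[ℝ] ℝ} (h : ∀ u, η ![u] = η' ![u]) :
    η = η' := by
  ext m
  have : m = ![m 0] := by ext i; fin_cases i; rfl
  rw [this]; exact h _

theorem alternating_three_ext {η η' : E [⋀^Fin 3]→L[ℝ] ℝ}
    (h : ∀ u v w, η ![u, v, w] = η' ![u, v, w]) : η = η' := by
  ext m
  have : m = ![m 0, m 1, m 2] := by ext i; fin_cases i <;> rfl
  rw [this]; exact h _ _ _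

theorem alternating_swap (η : E [⋀^Fin 2]→L[ℝ] ℝ) (u v : E) : η ![u, v] = -η ![v, u] := by
  have h := η.toAlternatingMap.map_swap ![u, v] (i := 0) (j := 1) (by decide)
  have e : ![u, v] ∘ Equiv.swap (0 : Fin 2) 1 = ![v, u] := by
    ext i; fin_cases i <;> simp
  rw [e] at h
  simp only [ContinuousAlternatingMap.coe_toAlternatingMap] at h
  linarith

theorem alternating_add_left (η : E [⋀^Fin 2]→L[ℝ] ℝ) (u u' v : E) :
    η ![u + u', v] = η ![u, v] + η ![u', v] := by
  simpa using η.toMultilinearMap.cons_add ![v] u u'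

theorem alternating_smul_left (η : E [⋀^Fin 2]→L[ℝ] ℝ) (c : ℝ) (u v : E) :
    η ![c • u, v] = c * η ![u, v] := by
  simpa using η.toMultilinearMap.cons_smul ![v] c u

theorem alternating_add_right (η : E [⋀^Fin 2]→L[ℝ] ℝ) (u v v' : E) :
    η ![u, v + v'] = η ![u, v] + η ![u, v'] := by
  rw [alternating_swap, alternating_add_left, alternating_swap η u v, alternating_swap η u v']
  ring

theorem alternating_smul_right (η : E [⋀^Fin 2]→L[ℝ] ℝ) (c : ℝ) (u v : E) :
    η ![u, c • v] = c * η ![u, v] := by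
  rw [alternating_swap, alternating_smul_left, alternating_swap η u v]; ring

theorem compContinuousLinearMap_pair (η : F [⋀^Fin 2]→L[ℝ] ℝ) (A : E →L[ℝ] F) (u v : E) :
    η.compContinuousLinearMap A ![u, v] = η ![A u, A v] := by
  rw [ContinuousAlternatingMap.compContinuousLinearMap_apply]
  congr 1; ext i; fin_cases i <;> rfl

theorem compContinuousLinearMap_single (η : F [⋀^Fin 1]→L[ℝ] ℝ) (A : E →L[ℝ] F) (u : E) :
    η.compContinuousLinearMap A ![u] = η ![A u] := by
  rw [ContinuousAlternatingMap.compContinuousLinearMap_apply]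
  congr 1; ext i; fin_cases i; rfl

/-- Over a finite-dimensional space, a form is as smooth as its values on constant vectors. -/
theorem contDiffOn_alternating_of_apply [FiniteDimensional ℝ F] {k : ℕ} {m : ℕ∞ω}
    {η : E → F [⋀^Fin k]→L[ℝ] ℝ} {s : Set E}
    (h : ∀ v : Fin k → F, ContDiffOn ℝ m (fun z ↦ η z v) s) : ContDiffOn ℝ m η s := by
  let b := Module.finBasis ℝ F
  let ι := Fin k → Fin (Module.finrank ℝ F)
  let T : (F [⋀^Fin k]→L[ℝ] ℝ) →ₗ[ℝ] (ι → ℝ) :=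
    { toFun := fun η r ↦ η fun i ↦ b (r i)
      map_add' := fun _ _ ↦ rfl
      map_smul' := fun _ _ ↦ rfl }
  have hT : LinearMap.ker T = ⊥ := by
    rw [LinearMap.ker_eq_bot']
    intro η hη
    apply ContinuousAlternatingMap.toAlternatingMap_injective
    apply AlternatingMap.coe_multilinearMap_injective
    refine Module.Basis.ext_multilinear (fun _ ↦ b) fun r ↦ ?_
    exact congrFun hη r
  obtain ⟨L, hL⟩ := T.exists_leftInverse_of_injective hT
  have e : η = fun z ↦ L.toContinuousLinearMap (T (η z)) := by
    funext z
    exact (LinearMap.congr_fun hL (η z)).symm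
  rw [e]
  refine L.toContinuousLinearMap.contDiff.comp_contDiffOn ?_
  exact contDiffOn_pi.2 fun r ↦ h _

/-- Joint smoothness of the evaluation of forms on vectors. -/
theorem contDiff_alternating_apply [FiniteDimensional ℝ F] {k : ℕ} {m : ℕ∞ω} :
    ContDiff ℝ m fun p : (F [⋀^Fin k]→L[ℝ] ℝ) × (Fin k → F) ↦ p.1 p.2 := by
  let b := Module.finBasis ℝ F
  have e : (fun p : (F [⋀^Fin k]→L[ℝ] ℝ) × (Fin k → F) ↦ p.1 p.2) = fun p ↦
      ∑ r : Fin k → Fin (Module.finrank ℝ F),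
        (∏ i, b.coord (r i) (p.2 i)) • p.1 fun i ↦ b (r i) := by
    funext p
    conv_lhs => rw [show p.2 = fun i ↦ ∑ j, b.coord j (p.2 i) • b j from
      funext fun i ↦ (b.sum_repr (p.2 i)).symm]
    have h1 := p.1.toMultilinearMap.map_sum fun i j ↦ b.coord j (p.2 i) • b j
    refine h1.trans (Finset.sum_congr rfl fun r _ ↦ ?_)
    exact p.1.toMultilinearMap.map_smul_univ _ _
  rw [e]
  refine ContDiff.sum fun r _ ↦ ContDiff.fun_smul ?_ ?_
  · refine contDiff_prod fun i _ ↦ ?_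
    have : ContDiff ℝ m (b.coord (r i)).toContinuousLinearMap :=
      ContinuousLinearMap.contDiff _
    exact this.comp ((ContinuousLinearMap.proj (R := ℝ) (φ := fun _ : Fin k ↦ F) i).contDiff.comp
      contDiff_snd)
  · exact ((ContinuousAlternatingMap.apply ℝ F ℝ fun i ↦ b (r i)).contDiff.comp contDiff_fst)

theorem ContDiffOn.alternating_apply [FiniteDimensional ℝ F] {k : ℕ} {m : ℕ∞ω}
    {η : E → F [⋀^Fin k]→L[ℝ] ℝ} {X : E → Fin k → F} {s : Set E} (hη : ContDiffOn ℝ m η s)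
    (hX : ContDiffOn ℝ m X s) : ContDiffOn ℝ m (fun z ↦ η z (X z)) s :=
  contDiff_alternating_apply.comp_contDiffOn (hη.prodMk hX)

theorem ContDiffOn.alternating_comp [FiniteDimensional ℝ F] [FiniteDimensional ℝ G] {k : ℕ}
    {m : ℕ∞ω} {η : E → F [⋀^Fin k]→L[ℝ] ℝ} {A : E → G →L[ℝ] F} {s : Set E}
    (hη : ContDiffOn ℝ m η s) (hA : ContDiffOn ℝ m A s) :
    ContDiffOn ℝ m (fun z ↦ (η z).compContinuousLinearMap (A z)) s := by
  refine contDiffOn_alternating_of_apply fun v ↦ ?_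
  refine ContDiffOn.alternating_apply (X := fun z i ↦ A z (v i)) hη ?_
  exact contDiffOn_pi.2 fun i ↦ hA.clm_apply contDiffOn_const

theorem ContDiffAt.alternating_comp [FiniteDimensional ℝ F] [FiniteDimensional ℝ G] {k : ℕ}
    {m : ℕ∞ω} {η : E → F [⋀^Fin k]→L[ℝ] ℝ} {A : E → G →L[ℝ] F} {z : E}
    (hη : ContDiffAt ℝ m η z) (hA : ContDiffAt ℝ m A z) :
    ContDiffAt ℝ m (fun z ↦ (η z).compContinuousLinearMap (A z)) z := by
  have e : (fun z ↦ (η z).compContinuousLinearMap (A z)) =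
      (fun q : (F [⋀^Fin k]→L[ℝ] ℝ) × (G →L[ℝ] F) ↦ q.1.compContinuousLinearMap q.2) ∘
        fun z ↦ (η z, A z) := rfl
  rw [e]
  refine ContDiff.contDiffAt ?_ |>.comp z (hη.prodMk hA)
  exact contDiffOn_univ.1 (ContDiffOn.alternating_comp contDiff_fst.contDiffOn
    contDiff_snd.contDiffOn)

/-- The pullback of forms commutes with the exterior derivative, for forms given near a point. -/
theorem extDeriv_of_eventuallyEq_pullback {k : ℕ} {η : F → F [⋀^Fin k]→L[ℝ] ℝ} {f : E → F} {z : E}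
    {σ : E → E [⋀^Fin k]→L[ℝ] ℝ}
    (hσ : ∀ᶠ w in nhds z, σ w = (η (f w)).compContinuousLinearMap (fderiv ℝ f w))
    (hη : DifferentiableAt ℝ η (f z)) (hf : ContDiffAt ℝ ∞ f z) :
    extDeriv σ z = (extDeriv η (f z)).compContinuousLinearMap (fderiv ℝ f z) := by
  have h1 : σ =ᶠ[nhds z] fun w ↦ (η (f w)).compContinuousLinearMap (fderiv ℝ f w) := hσ
  rw [h1.extDeriv_eq]
  refine extDeriv_pullback hη hf ?_
  rw [minSmoothness_of_isRCLikeNormedField]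
  exact WithTop.coe_le_coe.2 le_top

end FormCalculus

/-! ### Local sections of submersions and smoothness of solutions -/

section Sections

variable {E F : Type*} [NormedAddCommGroup E] [NormedSpace ℝ E]
  [NormedAddCommGroup F] [NormedSpace ℝ F]

/-- A surjective linear map between finite-dimensional spaces has a right inverse. -/
theorem exists_clm_rightInverse [FiniteDimensional ℝ F] (A : E →L[ℝ] F)
    (hA : Function.Surjective A) :
    ∃ S : F →L[ℝ] E, A ∘L S = ContinuousLinearMap.id ℝ F := by
  obtain ⟨S, hS⟩ := A.toLinearMap.exists_rightInverse_of_surjective (LinearMap.range_eq_top.2 hA)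
  refine ⟨S.toContinuousLinearMap, ?_⟩
  ext x
  exact LinearMap.congr_fun hS x

/-- A submersion has a smooth local section through each point. -/
theorem exists_section_of_surjective_fderiv [FiniteDimensional ℝ E] [FiniteDimensional ℝ F]
    {f : E → F} {z : E} (hf : ContDiffAt ℝ ∞ f z)
    (hs : Function.Surjective (fderiv ℝ f z)) :
    ∃ s : F → E, ContDiffAt ℝ ∞ s (f z) ∧ s (f z) = z ∧ ∀ᶠ w in nhds (f z), f (s w) = w := by
  obtain ⟨S, hS⟩ := exists_clm_rightInverse _ hs
  -- the local section is the local inverse of `f` restricted to a complement of the kernel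
  let j : F → E := fun a ↦ z + S a
  have hj : ContDiff ℝ ∞ j := contDiff_const.add S.contDiff
  have hj0 : j 0 = z := by simp [j]
  have hjd : HasFDerivAt j S 0 := S.hasFDerivAt.const_add z
  let g : F → F := f ∘ j
  have hg : ContDiffAt ℝ ∞ g 0 := ContDiffAt.comp 0 (by rw [hj0]; exact hf) hj.contDiffAt
  have hgd : HasFDerivAt g ((ContinuousLinearEquiv.refl ℝ F : F ≃L[ℝ] F) : F →L[ℝ] F) 0 := by
    have h1 : HasFDerivAt f (fderiv ℝ f z) (j 0) := by
      rw [hj0]; exact (hf.differentiableAt (by simp)).hasFDerivAt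
    have h2 := h1.comp 0 hjd
    rw [hS] at h2
    exact h2
  have hg0 : g 0 = f z := by simp [g, hj0]
  refine ⟨fun w ↦ j ((hg.toOpenPartialHomeomorph g hgd (by simp)).symm w), ?_, ?_, ?_⟩
  · rw [← hg0]
    exact hj.contDiffAt.comp _ (hg.to_localInverse hgd (by simp))
  · have : hg.localInverse hgd (by simp) (g 0) = 0 := hg.localInverse_apply_image hgd (by simp)
    have h2 : (hg.toOpenPartialHomeomorph g hgd (by simp)).symm (f z) = 0 := by
      rw [← hg0]; exact this
    simp only [h2, hj0]
  · have hm : f z ∈ (hg.toOpenPartialHomeomorph g hgd (by simp)).target := by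
      rw [← hg0]; exact hg.image_mem_toOpenPartialHomeomorph_target hgd (by simp)
    filter_upwards [(hg.toOpenPartialHomeomorph g hgd (by simp)).open_target.mem_nhds hm] with w hw
    exact (hg.toOpenPartialHomeomorph g hgd (by simp)).right_inv hw

/-- Solutions of a smooth autonomous differential equation are smooth. -/
theorem contDiffOn_of_hasDerivAt_comp {J : Set ℝ} (hJ : IsOpen J) {O : Set E}
    {X : E → E} (hX : ContDiffOn ℝ ∞ X O) {u : ℝ → E} (hu : ∀ t ∈ J, u t ∈ O)
    (hd : ∀ t ∈ J, HasDerivAt u (X (u t)) t) : ContDiffOn ℝ ∞ u J := by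
  rw [contDiffOn_infty]
  intro k
  induction k with
  | zero =>
    exact contDiffOn_zero.2 fun t ht ↦ (hd t ht).continuousAt.continuousWithinAt
  | succ k ih =>
    rw [show ((k + 1 : ℕ) : ℕ∞ω) = (k : ℕ∞ω) + 1 from by push_cast; rfl]
    rw [contDiffOn_succ_iff_deriv_of_isOpen hJ]
    refine ⟨fun t ht ↦ (hd t ht).differentiableAt.differentiableWithinAt, by simp, ?_⟩
    refine ((hX.of_le (mod_cast le_top)).comp ih hu).congr fun t ht ↦ (hd t ht).deriv

end Sections

/-! ### Integrals depending on parameters -/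

section ParametricIntegrals

universe u

theorem intervalIntegrable_slice {Z V : Type*} [TopologicalSpace Z] [NormedAddCommGroup V]
    {H : Z × ℝ → V} {D : Set (Z × ℝ)} (hH : ContinuousOn H D) {z : Z}
    (hz : ∀ t ∈ Icc (0 : ℝ) 1, (z, t) ∈ D) :
    IntervalIntegrable (fun t ↦ H (z, t)) MeasureTheory.volume 0 1 := by
  refine ContinuousOn.intervalIntegrable ?_
  rw [uIcc_of_le zero_le_one]
  exact hH.comp (by fun_prop) hz

-- `Z` and `V` lie in one universe: the induction on the order of differentiability replaces `V` by
-- `Z →L[ℝ] V`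
variable {Z V : Type u} [NormedAddCommGroup Z] [NormedSpace ℝ Z]
  [NormedAddCommGroup V] [NormedSpace ℝ V]

/-- Differentiation under the integral sign over the unit interval. -/
theorem hasFDerivAt_integral_unitInterval {H : Z × ℝ → V} {D : Set (Z × ℝ)}
    (hD : IsOpen D) (hH : ContDiffOn ℝ 1 H D) {z : Z} (hz : ∀ t ∈ Icc (0 : ℝ) 1, (z, t) ∈ D) :
    HasFDerivAt (fun w ↦ ∫ t in (0 : ℝ)..1, H (w, t))
      (∫ t in (0 : ℝ)..1, fderiv ℝ H (z, t) ∘L ContinuousLinearMap.inl ℝ Z ℝ) z := by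
  have hd : ContinuousOn (fderiv ℝ H) D := hH.continuousOn_fderiv_of_isOpen hD le_rfl
  have hd' : ContinuousOn (fun p ↦ fderiv ℝ H p ∘L ContinuousLinearMap.inl ℝ Z ℝ) D :=
    hd.clm_comp continuousOn_const
  have hK : IsCompact ((fun t : ℝ ↦ (z, t)) '' Icc (0 : ℝ) 1) :=
    isCompact_Icc.image (by fun_prop)
  have hKD : (fun t : ℝ ↦ (z, t)) '' Icc (0 : ℝ) 1 ⊆ D := by
    rintro _ ⟨t, ht, rfl⟩; exact hz t ht
  obtain ⟨C, hC⟩ := hK.exists_bound_of_continuousOn (hd'.mono hKD)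
  have hO :
      IsOpen (D ∩ (fun p ↦ ‖fderiv ℝ H p ∘L ContinuousLinearMap.inl ℝ Z ℝ‖) ⁻¹' Iio (C + 1)) :=
    hd'.norm.isOpen_inter_preimage hD isOpen_Iio
  obtain ⟨a, b, ha, -, hza, hb, hab⟩ := generalized_tube_lemma (isCompact_singleton (x := z))
    (isCompact_Icc (a := (0 : ℝ)) (b := 1)) hO (by
      rintro ⟨w, t⟩ ⟨hw, ht⟩
      obtain rfl : w = z := hw
      refine ⟨hz t ht, ?_⟩
      have := hC _ ⟨t, ht, rfl⟩
      simp only [mem_preimage, mem_Iio]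
      linarith)
  have hza : z ∈ a := hza rfl
  have hmem : ∀ w ∈ a, ∀ t ∈ Icc (0 : ℝ) 1, (w, t) ∈ D := fun w hw t ht ↦ (hab ⟨hw, hb ht⟩).1
  have hsub : uIoc (0 : ℝ) 1 ⊆ Icc 0 1 := by
    rw [uIoc_of_le zero_le_one]; exact Ioc_subset_Icc_self
  refine intervalIntegral.hasFDerivAt_integral_of_dominated_of_fderiv_le
    (F' := fun w t ↦ fderiv ℝ H (w, t) ∘L ContinuousLinearMap.inl ℝ Z ℝ)
    (bound := fun _ ↦ C + 1) (ha.mem_nhds hza) ?_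
    (intervalIntegrable_slice hH.continuousOn hz) ?_ ?_
    intervalIntegrable_const ?_
  · filter_upwards [ha.mem_nhds hza] with w hw
    exact (intervalIntegrable_slice hH.continuousOn (hmem w hw)).def'.aestronglyMeasurable
  · exact (intervalIntegrable_slice (H := fun p ↦ fderiv ℝ H p ∘L ContinuousLinearMap.inl ℝ Z ℝ)
      hd' hz).def'.aestronglyMeasurable
  · refine Filter.Eventually.of_forall fun t ht w hw ↦ ?_
    exact le_of_lt (hab ⟨hw, hb (hsub ht)⟩).2
  · refine Filter.Eventually.of_forall fun t ht w hw ↦ ?_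
    have h1 : HasFDerivAt H (fderiv ℝ H (w, t)) (w, t) :=
      ((hH.differentiableOn one_ne_zero).differentiableAt
        (hD.mem_nhds (hmem w hw t (hsub ht)))).hasFDerivAt
    exact h1.comp w (hasFDerivAt_prodMk_left w t)

/-- Differentiation under the integral sign in a given direction `w`. -/
theorem fderiv_integral_unitInterval_apply [CompleteSpace V] {H : Z × ℝ → V} {D : Set (Z × ℝ)}
    (hD : IsOpen D) (hH : ContDiffOn ℝ 1 H D) {z : Z} (hz : ∀ t ∈ Icc (0 : ℝ) 1, (z, t) ∈ D)
    {w : Z} {K : ℝ → V}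
    (hK : ∀ t ∈ Icc (0 : ℝ) 1, HasDerivAt (fun s : ℝ ↦ H (z + s • w, t)) (K t) 0) :
    IntervalIntegrable K MeasureTheory.volume 0 1 ∧
      fderiv ℝ (fun w ↦ ∫ t in (0 : ℝ)..1, H (w, t)) z w = ∫ t in (0 : ℝ)..1, K t := by
  have hd : ContinuousOn (fun p ↦ fderiv ℝ H p ∘L ContinuousLinearMap.inl ℝ Z ℝ) D :=
    (hH.continuousOn_fderiv_of_isOpen hD le_rfl).clm_comp continuousOn_const
  have hKeq : ∀ t ∈ Icc (0 : ℝ) 1,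
      K t = (fderiv ℝ H (z, t) ∘L ContinuousLinearMap.inl ℝ Z ℝ) w := by
    intro t ht
    have h1 : HasFDerivAt H (fderiv ℝ H (z, t)) (z, t) :=
      ((hH.differentiableOn one_ne_zero).differentiableAt (hD.mem_nhds (hz t ht))).hasFDerivAt
    have hl : HasDerivAt (fun s : ℝ ↦ (z + s • w, t)) (w, (0 : ℝ)) 0 := by
      refine HasDerivAt.prodMk ?_ (hasDerivAt_const _ _)
      simpa using ((hasDerivAt_id (0 : ℝ)).smul_const w).const_add z
    exact (hK t ht).unique (h1.comp_hasDerivAt_of_eq (0 : ℝ) hl (by simp))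
  have hint := intervalIntegrable_slice
    (H := fun p ↦ (fderiv ℝ H p ∘L ContinuousLinearMap.inl ℝ Z ℝ) w)
    (hd.clm_apply continuousOn_const) hz
  have hsub : uIoc (0 : ℝ) 1 ⊆ Icc 0 1 := by
    rw [uIoc_of_le zero_le_one]; exact Ioc_subset_Icc_self
  refine ⟨hint.congr fun t ht ↦ (hKeq t (hsub ht)).symm, ?_⟩
  rw [(hasFDerivAt_integral_unitInterval hD hH hz).fderiv,
    ContinuousLinearMap.intervalIntegral_apply (intervalIntegrable_slice
      (H := fun p ↦ fderiv ℝ H p ∘L ContinuousLinearMap.inl ℝ Z ℝ) hd hz)]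
  refine intervalIntegral.integral_congr fun t ht ↦ (hKeq t ?_).symm
  rwa [uIcc_of_le zero_le_one] at ht

/-- An integral over the unit interval depends smoothly on parameters. -/
theorem contDiffOn_integral_unitInterval {H : Z × ℝ → V} {D : Set (Z × ℝ)} (hD : IsOpen D)
    (hH : ContDiffOn ℝ ∞ H D) {W : Set Z} (hW : IsOpen W)
    (hz : ∀ z ∈ W, ∀ t ∈ Icc (0 : ℝ) 1, (z, t) ∈ D) :
    ContDiffOn ℝ ∞ (fun w ↦ ∫ t in (0 : ℝ)..1, H (w, t)) W := by
  rw [contDiffOn_infty]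
  intro k
  induction k generalizing V with
  | zero =>
    exact contDiffOn_zero.2 fun z hzW ↦ (hasFDerivAt_integral_unitInterval hD
      (hH.of_le (by simp)) (hz z hzW)).continuousAt.continuousWithinAt
  | succ k ih =>
    have hder : ∀ z ∈ W, HasFDerivAt (fun w ↦ ∫ t in (0 : ℝ)..1, H (w, t))
        (∫ t in (0 : ℝ)..1, fderiv ℝ H (z, t) ∘L ContinuousLinearMap.inl ℝ Z ℝ) z :=
      fun z hzW ↦ hasFDerivAt_integral_unitInterval hD (hH.of_le (by simp)) (hz z hzW)
    rw [show ((k + 1 : ℕ) : ℕ∞ω) = (k : ℕ∞ω) + 1 from by push_cast; rfl,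
      contDiffOn_succ_iff_fderiv_of_isOpen hW]
    refine ⟨fun z hzW ↦ (hder z hzW).differentiableAt.differentiableWithinAt, by simp, ?_⟩
    refine (ih (V := Z →L[ℝ] V)
      (H := fun p ↦ fderiv ℝ H p ∘L ContinuousLinearMap.inl ℝ Z ℝ) ?_).congr
      fun z hzW ↦ (hder z hzW).fderiv
    exact (hH.fderiv_of_isOpen hD (by simp)).clm_comp contDiffOn_const

end ParametricIntegrals

/-! ### Poincaré lemmas on star-shaped sets -/

section Poincare

variable {E V : Type} [NormedAddCommGroup E] [NormedSpace ℝ E]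
  [NormedAddCommGroup V] [NormedSpace ℝ V]

/-- Points of the segments from the centre of a star-shaped set. -/
theorem add_smul_sub_mem_of_starConvex {A : Set E} {e y : E} (hA : StarConvex ℝ e A) (hy : y ∈ A)
    {t : ℝ} (ht : t ∈ Icc (0 : ℝ) 1) : e + t • (y - e) ∈ A := by
  have := hA hy (a := 1 - t) (b := t) (by linarith [ht.2]) ht.1 (by ring)
  convert this using 1
  module

theorem hasDerivAt_segment (e y v : E) (t : ℝ) :
    HasDerivAt (fun s : ℝ ↦ e + t • (y + s • v - e)) (t • v) 0 := by
  have := (((((hasDerivAt_id (0 : ℝ)).smul_const v).const_add y).sub_const e).const_smul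
    t).const_add e
  simpa using this

/-- The Poincaré lemma for 1-forms on a star-shaped open set, with smooth dependence on parameters:
`η (x, ·)` is a closed 1-form on `A` for each `x`, and its primitive vanishing at the centre `e`
is smooth in all variables. -/
theorem exists_primitive_of_starConvex [CompleteSpace V] {B A : Set E} (hB : IsOpen B)
    (hA : IsOpen A) {e : E} (hAe : StarConvex ℝ e A)
    {η : E × E → E →L[ℝ] V} (hη : ContDiffOn ℝ ∞ η (B ×ˢ A))
    (hcl : ∀ z ∈ B ×ˢ A, ∀ u v : E, fderiv ℝ η z (0, u) v = fderiv ℝ η z (0, v) u) :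
    ∃ f : E × E → V, ContDiffOn ℝ ∞ f (B ×ˢ A) ∧ (∀ x, f (x, e) = 0) ∧
      ∀ z ∈ B ×ˢ A, ∀ v, fderiv ℝ f z (0, v) = η z v := by
  have hc : ContDiff ℝ ∞ fun p : (E × E) × ℝ ↦ (p.1.1, e + p.2 • (p.1.2 - e)) := by fun_prop
  have hBA : IsOpen (B ×ˢ A) := hB.prod hA
  have hD := hBA.preimage hc.continuous
  set D := (fun p : (E × E) × ℝ ↦ (p.1.1, e + p.2 • (p.1.2 - e))) ⁻¹' (B ×ˢ A)
  have hH : ContDiffOn ℝ ∞ (fun p : (E × E) × ℝ ↦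
      η (p.1.1, e + p.2 • (p.1.2 - e)) (p.1.2 - e)) D := by
    refine ContDiffOn.clm_apply (hη.comp hc.contDiffOn fun p hp ↦ hp) ?_
    exact ContDiff.contDiffOn (by fun_prop)
  have hmem : ∀ z ∈ B ×ˢ A, ∀ t ∈ Icc (0 : ℝ) 1, (z, t) ∈ D :=
    fun z hz t ht ↦ ⟨hz.1, add_smul_sub_mem_of_starConvex hAe hz.2 ht⟩
  refine ⟨fun z ↦ ∫ t in (0 : ℝ)..1, η (z.1, e + t • (z.2 - e)) (z.2 - e),
    contDiffOn_integral_unitInterval hD hH hBA hmem, fun x ↦ by simp, fun z hz v ↦ ?_⟩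
  have hηd : ∀ t ∈ Icc (0 : ℝ) 1, HasFDerivAt η (fderiv ℝ η (z.1, e + t • (z.2 - e)))
      (z.1, e + t • (z.2 - e)) :=
    fun t ht ↦ ((hη.differentiableOn (by simp)).differentiableAt
      (hBA.mem_nhds (hmem z hz t ht))).hasFDerivAt
  obtain ⟨hi, he⟩ := fderiv_integral_unitInterval_apply (w := ((0 : E), v)) (z := z)
    (K := fun t ↦ t • fderiv ℝ η (z.1, e + t • (z.2 - e)) (0, z.2 - e) v +
      η (z.1, e + t • (z.2 - e)) v) hD (hH.of_le (by simp)) (hmem z hz) (by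
    intro t ht
    have h1 : HasDerivAt (fun s : ℝ ↦ η (z.1, e + t • (z.2 + s • v - e)))
        (fderiv ℝ η (z.1, e + t • (z.2 - e)) (0, t • v)) 0 :=
      (hηd t ht).comp_hasDerivAt_of_eq (0 : ℝ)
        (HasDerivAt.prodMk (hasDerivAt_const _ z.1) (hasDerivAt_segment e z.2 v t)) (by simp)
    have h2 := h1.clm_apply (hasDerivAt_const (0 : ℝ) (z.2 - e))
    have h3 := (hasDerivAt_id (0 : ℝ)).fun_smul (h1.clm_apply (hasDerivAt_const (0 : ℝ) v))
    have h4 := h2.add h3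
    refine (h4.congr_of_eventuallyEq (Filter.Eventually.of_forall fun s ↦ ?_)).congr_deriv ?_
    · simp only [Prod.fst_add, Prod.snd_add, Prod.smul_fst, Prod.smul_snd, smul_zero, add_zero,
        id_eq, Pi.add_apply, ← map_smul, ← map_add]
      congr 1
      module
    · simp only [map_zero, add_zero, id_eq, zero_smul, one_smul, zero_add]
      rw [show ((0 : E), t • v) = t • ((0 : E), v) by simp, map_smul,
        smul_apply, hcl _ (hmem z hz t ht) v (z.2 - e)])
  have hderiv : ∀ t ∈ Icc (0 : ℝ) 1, HasDerivAt (fun s : ℝ ↦ s • η (z.1, e + s • (z.2 - e)) v)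
      (t • fderiv ℝ η (z.1, e + t • (z.2 - e)) (0, z.2 - e) v +
        η (z.1, e + t • (z.2 - e)) v) t := by
    intro t ht
    have hcz : HasDerivAt (fun s : ℝ ↦ (z.1, e + s • (z.2 - e))) (0, z.2 - e) t := by
      refine HasDerivAt.prodMk (hasDerivAt_const t z.1) ?_
      simpa using ((hasDerivAt_id t).smul_const (z.2 - e)).const_add e
    have h4 : HasDerivAt (fun s : ℝ ↦ η (z.1, e + s • (z.2 - e)))
        (fderiv ℝ η (z.1, e + t • (z.2 - e)) (0, z.2 - e)) t :=
      (hηd t ht).comp_hasDerivAt t hcz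
    have h5 : HasDerivAt (fun s : ℝ ↦ η (z.1, e + s • (z.2 - e)) v)
        (fderiv ℝ η (z.1, e + t • (z.2 - e)) (0, z.2 - e) v) t := by
      simpa using h4.clm_apply (hasDerivAt_const t v)
    have h6 := (hasDerivAt_id t).fun_smul h5
    simpa only [id_eq, one_smul] using h6
  -- by closedness, the integrand of the derivative is the derivative of
  -- `s ↦ s • η (x, e + s (y - e)) v`
  refine he.trans ?_
  rw [intervalIntegral.integral_eq_sub_of_hasDerivAt
    (fun t ht ↦ hderiv t (by rwa [uIcc_of_le zero_le_one] at ht)) hi]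
  simp

/-- The Poincaré lemma for 2-forms on a star-shaped open set. -/
theorem exists_extDeriv_eq_of_starConvex [FiniteDimensional ℝ E] {B : Set E} (hB : IsOpen B) {e : E}
    (hBe : StarConvex ℝ e B) {β : E → E [⋀^Fin 2]→L[ℝ] ℝ} (hβ : ContDiffOn ℝ ∞ β B)
    (hcl : ∀ x ∈ B, extDeriv β x = 0) :
    ∃ α : E → E [⋀^Fin 1]→L[ℝ] ℝ, ContDiffOn ℝ ∞ α B ∧ ∀ x ∈ B, extDeriv α x = β x := by
  have hc : ContDiff ℝ ∞ fun p : E × ℝ ↦ e + p.2 • (p.1 - e) := by fun_prop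
  have hD := hB.preimage hc.continuous
  set D := (fun p : E × ℝ ↦ e + p.2 • (p.1 - e)) ⁻¹' B
  have hβc : ContDiffOn ℝ ∞ (fun p : E × ℝ ↦ β (e + p.2 • (p.1 - e))) D :=
    hβ.comp hc.contDiffOn fun p hp ↦ hp
  have hH : ContDiffOn ℝ ∞
      (fun p : E × ℝ ↦ p.2 • (β (e + p.2 • (p.1 - e))).curryLeft (p.1 - e)) D := by
    refine contDiffOn_alternating_of_apply fun v ↦ ?_
    refine ContDiffOn.mul contDiffOn_snd ?_
    refine ContDiffOn.alternating_apply
      (X := fun p : E × ℝ ↦ (Matrix.vecCons (p.1 - e) v : Fin 2 → E)) hβc ?_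
    refine contDiffOn_pi.2 fun i ↦ ?_
    refine Fin.cases ?_ (fun j ↦ ?_) i
    · exact contDiffOn_fst.sub contDiffOn_const
    · exact contDiffOn_const
  have hmem : ∀ z ∈ B, ∀ t ∈ Icc (0 : ℝ) 1, (z, t) ∈ D :=
    fun z hz t ht ↦ add_smul_sub_mem_of_starConvex hBe hz ht
  have hα := contDiffOn_integral_unitInterval hD hH hB hmem
  refine ⟨_, hα, fun x hx ↦ ?_⟩
  have hHv : ∀ v : E, ContDiffOn ℝ 1
      (fun p : E × ℝ ↦ p.2 * β (e + p.2 • (p.1 - e)) ![p.1 - e, v]) D := fun v ↦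
    ((ContinuousAlternatingMap.apply ℝ E ℝ ![v]).contDiff.comp_contDiffOn hH).of_le (by simp)
  have hβd : ∀ t ∈ Icc (0 : ℝ) 1, HasFDerivAt β (fderiv ℝ β (e + t • (x - e))) (e + t • (x - e)) :=
    fun t ht ↦ ((hβ.differentiableOn (by simp)).differentiableAt
      (hB.mem_nhds (hmem x hx t ht))).hasFDerivAt
  have hHd := fun u v : E ↦ fderiv_integral_unitInterval_apply (w := u) (z := x)
    (K := fun t ↦ t * (t * fderiv ℝ β (e + t • (x - e)) u ![x - e, v] +
      β (e + t • (x - e)) ![u, v])) hD (hHv v) (hmem x hx) (by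
    intro t ht
    have h1 : HasDerivAt (fun s : ℝ ↦ β (e + t • (x + s • u - e)))
        (fderiv ℝ β (e + t • (x - e)) (t • u)) 0 :=
      (hβd t ht).comp_hasDerivAt_of_eq (0 : ℝ) (hasDerivAt_segment e x u t) (by simp)
    have h2 : ∀ m : Fin 2 → E, HasDerivAt (fun s : ℝ ↦ β (e + t • (x + s • u - e)) m)
        (fderiv ℝ β (e + t • (x - e)) (t • u) m) 0 := fun m ↦
      (ContinuousAlternatingMap.apply ℝ E ℝ m).hasFDerivAt.comp_hasDerivAt (0 : ℝ) h1
    have h3 := ((h2 ![x - e, v]).add ((hasDerivAt_id (0 : ℝ)).mul (h2 ![u, v]))).const_mul t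
    refine (h3.congr_of_eventuallyEq (Filter.Eventually.of_forall fun s ↦ ?_)).congr_deriv ?_
    · simp only [Pi.add_apply, Pi.mul_apply, id_eq]
      rw [show x + s • u - e = (x - e) + s • u by module, alternating_add_left,
        alternating_smul_left]
    · rw [map_smul]
      simp only [id_eq, zero_mul, add_zero, one_mul, zero_smul]
      rfl)
  have hαv : ∀ u v : E,
      fderiv ℝ (fun x ↦ ∫ t in (0 : ℝ)..1, t • (β (e + t • (x - e))).curryLeft (x - e)) x u ![v] =
      ∫ t in (0 : ℝ)..1, t * (t * fderiv ℝ β (e + t • (x - e)) u ![x - e, v] +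
        β (e + t • (x - e)) ![u, v]) := by
    intro u v
    rw [← (hHd u v).2, ← fderiv_continuousAlternatingMap_apply_const_apply
      ((hα.differentiableOn (by simp)).differentiableAt (hB.mem_nhds hx))]
    refine congrArg (fun L : E →L[ℝ] ℝ ↦ L u) (Filter.EventuallyEq.fderiv_eq ?_)
    filter_upwards [hB.mem_nhds hx] with y hy
    exact ((ContinuousAlternatingMap.apply ℝ E ℝ ![v]).intervalIntegral_comp_comm
      (intervalIntegrable_slice hH.continuousOn (hmem y hy))).symm
  refine alternating_two_ext fun u v ↦ ?_
  -- by closedness, the integrand of `dα (u, v)` is the derivative of `s ↦ s² β (u, v)`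
  rw [extDeriv_apply_pair, hαv, hαv, ← intervalIntegral.integral_sub (hHd u v).1 (hHd v u).1]
  rw [intervalIntegral.integral_eq_sub_of_hasDerivAt
    (f := fun s : ℝ ↦ s ^ 2 * β (e + s • (x - e)) ![u, v]) ?_ ((hHd u v).1.sub (hHd v u).1)]
  · simp
  intro t ht
  rw [uIcc_of_le zero_le_one] at ht
  have hcz : HasDerivAt (fun s : ℝ ↦ e + s • (x - e)) (x - e) t := by
    simpa using ((hasDerivAt_id t).smul_const (x - e)).const_add e
  have h5 : HasDerivAt (fun s : ℝ ↦ β (e + s • (x - e)) ![u, v])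
      (fderiv ℝ β (e + t • (x - e)) (x - e) ![u, v]) t :=
    (ContinuousAlternatingMap.apply ℝ E ℝ ![u, v]).hasFDerivAt.comp_hasDerivAt t
      ((hβd t ht).comp_hasDerivAt t hcz)
  have h6 := (hasDerivAt_pow 2 t).mul h5
  refine h6.congr_deriv ?_
  rw [alternating_swap (β (e + t • (x - e))) v u]
  have h7 : extDeriv β (e + t • (x - e)) ![x - e, u, v] = 0 := by
    rw [hcl _ (hmem x hx t ht)]; rfl
  rw [extDeriv_apply_triple] at h7
  rw [show ((2 : ℕ) : ℝ) * t ^ (2 - 1) = 2 * t by norm_num]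
  linear_combination (t ^ 2) * h7

end Poincare

/-! ### Closed 1-forms on the punctured space -/

section PuncturedSpace

variable {E V : Type} [NormedAddCommGroup E] [NormedSpace ℝ E]
  [NormedAddCommGroup V] [NormedSpace ℝ V]

/-- The complement of the closed ray opposite to `e`. -/
def raySlit (e : E) : Set E := ((fun s : ℝ ↦ s • (-e)) '' Ici 0)ᶜ

theorem mem_raySlit {e y : E} : y ∈ raySlit e ↔ ∀ s : ℝ, 0 ≤ s → s • (-e) ≠ y := by
  simp [raySlit]

theorem isOpen_raySlit {e : E} (he : e ≠ 0) : IsOpen (raySlit e) := by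
  refine isOpen_compl_iff.2 ?_
  exact (isClosedEmbedding_smul_left (neg_ne_zero.2 he)).isClosedMap _ isClosed_Ici

theorem starConvex_raySlit {e : E} (he : e ≠ 0) : StarConvex ℝ e (raySlit e) := by
  intro y hy a b ha hb hab
  rw [mem_raySlit] at hy ⊢
  intro s hs h
  rcases hb.eq_or_lt with rfl | hb
  · have h1 : (s + a) • e = 0 := by
      rw [add_smul, ← neg_eq_zero, neg_add, ← smul_neg, h]; simp
    rcases smul_eq_zero.1 h1 with h2 | h2
    · linarith
    · exact he h2
  · refine hy ((s + a) / b) (by positivity) ?_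
    have h1 : b • y = (s + a) • (-e) := by
      rw [add_smul, h]; simp
    rw [div_eq_inv_mul, mul_smul, ← h1, smul_smul, inv_mul_cancel₀ hb.ne', one_smul]

theorem raySlit_union {e y : E} (hy : y ≠ 0) : y ∈ raySlit e ∨ y ∈ raySlit (-e) := by
  by_contra! h
  obtain ⟨h1, h2⟩ := h
  simp only [mem_raySlit, not_forall, not_not, neg_neg] at h1 h2
  obtain ⟨s, hs, rfl⟩ := h1
  obtain ⟨t, ht, h⟩ := h2
  have h3 : (s + t) • e = 0 := by rw [add_smul, h]; simp
  rcases smul_eq_zero.1 h3 with h4 | h4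
  · have : s = 0 := by linarith
    simp [this] at hy
  · simp [h4] at hy

theorem ne_zero_of_mem_raySlit {e y : E} (hy : y ∈ raySlit e) : y ≠ 0 := by
  rintro rfl
  exact mem_raySlit.1 hy 0 le_rfl (by simp)

/-- The two slit regions meet in the complement of the line through `e`. -/
theorem raySlit_inter {e : E} :
    raySlit e ∩ raySlit (-e) = ((Submodule.span ℝ {e} : Submodule ℝ E) : Set E)ᶜ := by
  ext y
  simp only [mem_inter_iff, mem_raySlit, neg_neg, mem_compl_iff, SetLike.mem_coe,
    Submodule.mem_span_singleton, not_exists]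
  constructor
  · rintro ⟨h1, h2⟩ a ha
    rcases le_total 0 a with h | h
    · exact h2 a h ha
    · exact h1 (-a) (by linarith) (by rw [smul_neg, neg_smul, neg_neg, ha])
  · intro h
    exact ⟨fun s _ hs ↦ h (-s) (by rw [← hs]; simp), fun s _ hs ↦ h s hs⟩

/-- In dimension at least three, the complement of a line is connected. -/
theorem isConnected_raySlit_inter [FiniteDimensional ℝ E] (hE : 2 < Module.finrank ℝ E) {e : E}
    (he : e ≠ 0) : IsConnected (raySlit e ∩ raySlit (-e)) := by
  rw [raySlit_inter]
  refine isConnected_compl_of_one_lt_codim ?_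
  rw [← Module.finrank_eq_rank]
  have h1 := (Submodule.span ℝ {e} : Submodule ℝ E).finrank_quotient_add_finrank
  rw [finrank_span_singleton he] at h1
  have : 1 < Module.finrank ℝ (E ⧸ (Submodule.span ℝ {e} : Submodule ℝ E)) := by omega
  exact_mod_cast this

theorem isConnected_compl_zero [FiniteDimensional ℝ E] (hE : 1 < Module.finrank ℝ E) :
    IsConnected ({0}ᶜ : Set E) := by
  refine isConnected_compl_singleton_of_one_lt_rank ?_ 0
  rw [← Module.finrank_eq_rank]
  exact_mod_cast hE

theorem hasFDerivAt_slice {f : E × E → V} {z : E × E} (hf : DifferentiableAt ℝ f z) :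
    HasFDerivAt (fun y ↦ f (z.1, y)) (fderiv ℝ f z ∘L ContinuousLinearMap.inr ℝ E E) z.2 :=
  HasFDerivAt.comp z.2 (g := f) (f := fun y ↦ (z.1, y)) hf.hasFDerivAt
    (hasFDerivAt_prodMk_right z.1 z.2)

/-- Closed 1-forms on the punctured space of dimension at least three are exact, with smooth
dependence on parameters. The punctured space is the union of two star-shaped sets whose
intersection, the complement of a line, is connected, so that the two primitives can be made to
agree. The primitive is normalized to vanish at `e`. -/
theorem exists_primitive_punctured [FiniteDimensional ℝ E] [CompleteSpace V]
    (hE : 2 < Module.finrank ℝ E) {B : Set E} (hB : IsOpen B) {e : E} (he : e ≠ 0)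
    {η : E × E → E →L[ℝ] V} (hη : ContDiffOn ℝ ∞ η (B ×ˢ {0}ᶜ))
    (hcl : ∀ z ∈ B ×ˢ ({0}ᶜ : Set E), ∀ u v : E,
      fderiv ℝ η z (0, u) v = fderiv ℝ η z (0, v) u) :
    ∃ f : E × E → V, ContDiffOn ℝ ∞ f (B ×ˢ {0}ᶜ) ∧ (∀ x, f (x, e) = 0) ∧
      ∀ z ∈ B ×ˢ ({0}ᶜ : Set E), ∀ v, fderiv ℝ f z (0, v) = η z v := by
  classical
  have he' : -e ≠ 0 := neg_ne_zero.2 he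
  have hs : ∀ e' : E, B ×ˢ raySlit e' ⊆ B ×ˢ {0}ᶜ := fun e' ↦
    prod_mono_right fun y hy ↦ ne_zero_of_mem_raySlit hy
  obtain ⟨f, hf, hfe, hfd⟩ := exists_primitive_of_starConvex hB (isOpen_raySlit he)
    (starConvex_raySlit he) (hη.mono (hs e)) fun z hz ↦ hcl z (hs e hz)
  obtain ⟨g, hg, -, hgd⟩ := exists_primitive_of_starConvex hB (isOpen_raySlit he')
    (starConvex_raySlit he') (hη.mono (hs (-e))) fun z hz ↦ hcl z (hs (-e) hz)
  have hOf := hB.prod (isOpen_raySlit he)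
  have hOg := hB.prod (isOpen_raySlit he')
  obtain ⟨⟨y₁, hy₁⟩, hconn⟩ := isConnected_raySlit_inter hE he
  -- for each `x`, the two primitives are made to agree at the point `y₁` of the intersection
  let g' : E × E → V := fun z ↦ g z + (f (z.1, y₁) - g (z.1, y₁))
  have hfst : ∀ e' : E, y₁ ∈ raySlit e' → ∀ k : E × E → V, ContDiffOn ℝ ∞ k (B ×ˢ raySlit e') →
      ContDiffOn ℝ ∞ (fun z : E × E ↦ k (z.1, y₁)) (B ×ˢ raySlit (-e)) := fun e' hy k hk ↦
    hk.comp (ContDiff.contDiffOn (by fun_prop)) fun z hz ↦ ⟨hz.1, hy⟩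
  have hg' : ContDiffOn ℝ ∞ g' (B ×ˢ raySlit (-e)) :=
    hg.add ((hfst e hy₁.1 f hf).sub (hfst (-e) hy₁.2 g hg))
  have hdf : ∀ z ∈ B ×ˢ raySlit e, DifferentiableAt ℝ f z := fun z hz ↦
    (hf.differentiableOn (by simp)).differentiableAt (hOf.mem_nhds hz)
  have hdg : ∀ z ∈ B ×ˢ raySlit (-e), DifferentiableAt ℝ g z := fun z hz ↦
    (hg.differentiableOn (by simp)).differentiableAt (hOg.mem_nhds hz)
  have hdg' : ∀ z ∈ B ×ˢ raySlit (-e), DifferentiableAt ℝ g' z := fun z hz ↦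
    (hg'.differentiableOn (by simp)).differentiableAt (hOg.mem_nhds hz)
  have hgd' : ∀ z ∈ B ×ˢ raySlit (-e), ∀ v, fderiv ℝ g' z (0, v) = η z v := by
    intro z hz v
    have h1 := (hasFDerivAt_slice (hdg z hz)).add_const (f (z.1, y₁) - g (z.1, y₁))
    have h2 := (hasFDerivAt_slice (hdg' z hz)).unique h1
    rw [← hgd z hz v]
    exact congrArg (fun L : E →L[ℝ] V ↦ L v) h2
  have heq : ∀ x ∈ B, ∀ y ∈ raySlit e ∩ raySlit (-e), f (x, y) = g' (x, y) := by
    intro x hx y hy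
    have h0 : ∀ w ∈ raySlit e ∩ raySlit (-e),
        HasFDerivAt (fun y ↦ f (x, y) - g (x, y)) (0 : E →L[ℝ] V) w := by
      intro w hw
      have h1 := (hasFDerivAt_slice (hdf (x, w) ⟨hx, hw.1⟩)).sub
        (hasFDerivAt_slice (hdg (x, w) ⟨hx, hw.2⟩))
      convert! h1 using 1
      ext v
      simp [hfd (x, w) ⟨hx, hw.1⟩, hgd (x, w) ⟨hx, hw.2⟩]
    have h1 := ((isOpen_raySlit he).inter (isOpen_raySlit he')).is_const_of_fderiv_eq_zero (𝕜 := ℝ)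
      hconn (fun w hw ↦ (h0 w hw).differentiableAt.differentiableWithinAt)
      (fun w hw ↦ (h0 w hw).fderiv) hy hy₁
    simp only [g', ← h1]
    abel
  let h : E × E → V := fun z ↦ if z.2 ∈ raySlit e then f z else g' z
  have hhf : ∀ z ∈ B ×ˢ raySlit e, h z = f z := fun z hz ↦ if_pos hz.2
  have hhg : ∀ z ∈ B ×ˢ raySlit (-e), h z = g' z := by
    intro z hz
    by_cases hze : z.2 ∈ raySlit e
    · rw [hhf z ⟨hz.1, hze⟩]; exact heq z.1 hz.1 z.2 ⟨hze, hz.2⟩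
    · exact if_neg hze
  have hcase : ∀ z ∈ B ×ˢ ({0}ᶜ : Set E),
      ContDiffAt ℝ ∞ h z ∧ ∀ v, fderiv ℝ h z (0, v) = η z v := by
    intro z hz
    rcases raySlit_union (e := e) hz.2 with hze | hze
    · have hev : h =ᶠ[nhds z] f := by
        filter_upwards [hOf.mem_nhds ⟨hz.1, hze⟩] with w hw using hhf w hw
      refine ⟨(hf.contDiffAt (hOf.mem_nhds ⟨hz.1, hze⟩)).congr_of_eventuallyEq hev, fun v ↦ ?_⟩
      rw [hev.fderiv_eq, hfd z ⟨hz.1, hze⟩]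
    · have hev : h =ᶠ[nhds z] g' := by
        filter_upwards [hOg.mem_nhds ⟨hz.1, hze⟩] with w hw using hhg w hw
      refine ⟨(hg'.contDiffAt (hOg.mem_nhds ⟨hz.1, hze⟩)).congr_of_eventuallyEq hev, fun v ↦ ?_⟩
      rw [hev.fderiv_eq, hgd' z ⟨hz.1, hze⟩]
  have hee : e ∈ raySlit e := (starConvex_raySlit he).mem ⟨y₁, hy₁.1⟩
  refine ⟨h, fun z hz ↦ (hcase z hz).1.contDiffWithinAt, fun x ↦ ?_, fun z hz ↦ (hcase z hz).2⟩
  simp only [h, if_pos hee, hfe]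

end PuncturedSpace

/-! ### Homogeneous potentials in coordinates -/

section LocalPotential

variable {E : Type} [NormedAddCommGroup E] [NormedSpace ℝ E] [FiniteDimensional ℝ E]

/-- The restriction of a 2-form on `E × E` to pairs of a vertical and a horizontal vector. -/
noncomputable def mixedPart (σ : (E × E) [⋀^Fin 2]→L[ℝ] ℝ) : E →L[ℝ] E →L[ℝ] ℝ :=
  LinearMap.toContinuousLinearMap
    ((LinearMap.toContinuousLinearMap (𝕜 := ℝ) (E := E) (F' := ℝ)).toLinearMap ∘ₗ
      LinearMap.mk₂ ℝ (fun v u : E ↦ σ ![((0 : E), v), (u, (0 : E))])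
        (fun v v' u ↦ by
          rw [← alternating_add_left]; simp)
        (fun c v u ↦ by
          rw [smul_eq_mul, ← alternating_smul_left]; simp)
        (fun v u u' ↦ by
          rw [← alternating_add_right]; simp)
        (fun c v u ↦ by
          rw [smul_eq_mul, ← alternating_smul_right]; simp))

/-- A closed 2-form on `B × (E \ {0})` that vanishes on pairs of vertical vectors and is annihilated
by the Liouville field and by a second order field is the Hilbert 2-form `d(∂F/∂y^i dx^i)` of a
positively homogeneous function `F`. First `∂F/∂y^i` is found along the fibres, up to a function of
`x`, as a primitive of the mixed part of the form; the rest of the form then lives on `B`, and the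
Poincaré lemma on `B` gives the remaining correction. -/
theorem exists_hilbert_potential (hE : 2 < Module.finrank ℝ E) {B : Set E} (hB : IsOpen B) {x₀ : E}
    (hBs : StarConvex ℝ x₀ B) {σ : E × E → (E × E) [⋀^Fin 2]→L[ℝ] ℝ}
    (hσ : ContDiffOn ℝ ∞ σ (B ×ˢ {0}ᶜ))
    (hcl : ∀ z ∈ B ×ˢ ({0}ᶜ : Set E), extDeriv σ z = 0)
    (hvert : ∀ z ∈ B ×ˢ ({0}ᶜ : Set E), ∀ u v : E, σ z ![(0, u), (0, v)] = 0)
    (hrad : ∀ z ∈ B ×ˢ ({0}ᶜ : Set E), ∀ u : E, σ z ![(0, z.2), (u, 0)] = 0)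
    (hspray : ∀ z ∈ B ×ˢ ({0}ᶜ : Set E), ∀ v : E, σ z ![(0, v), (z.2, 0)] = 0) :
    ∃ F : E × E → ℝ, ContDiffOn ℝ ∞ F (B ×ˢ {0}ᶜ) ∧
      (∀ z ∈ B ×ˢ ({0}ᶜ : Set E), ∀ s : ℝ, 0 < s → F (z.1, s • z.2) = s * F z) ∧
      ∀ z ∈ B ×ˢ ({0}ᶜ : Set E), ∀ X Y : E × E, σ z ![X, Y] =
        fderiv ℝ (fderiv ℝ F) z X (0, Y.1) - fderiv ℝ (fderiv ℝ F) z Y (0, X.1) := by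
  have hO : IsOpen (B ×ˢ ({0}ᶜ : Set E)) := hB.prod isOpen_compl_singleton
  have hσd : ∀ z ∈ B ×ˢ ({0}ᶜ : Set E), DifferentiableAt ℝ σ z := fun z hz ↦
    (hσ.differentiableOn (by simp)).differentiableAt (hO.mem_nhds hz)
  have hσapply : ∀ z ∈ B ×ˢ ({0}ᶜ : Set E), ∀ m X,
      fderiv ℝ (fun z ↦ σ z m) z X = fderiv ℝ σ z X m := fun z hz m X ↦
    fderiv_continuousAlternatingMap_apply_const_apply (hσd z hz) m X
  have : Nontrivial E := Module.nontrivial_of_finrank_pos (R := ℝ) (by omega)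
  obtain ⟨e, he⟩ := exists_ne (0 : E)
  -- the primitive along the fibres of the mixed part
  let η : E × E → E →L[ℝ] E →L[ℝ] ℝ := fun z ↦ mixedPart (σ z)
  have hη : ContDiffOn ℝ ∞ η (B ×ˢ {0}ᶜ) := by
    rw [contDiffOn_clm_apply]
    intro v
    rw [contDiffOn_clm_apply]
    intro u
    exact (ContinuousAlternatingMap.apply ℝ (E × E) ℝ ![(0, v), (u, 0)]).contDiff.comp_contDiffOn hσ
  have hηd : ∀ z ∈ B ×ˢ ({0}ᶜ : Set E), ∀ X v u,
      fderiv ℝ η z X v u = fderiv ℝ σ z X ![(0, v), (u, 0)] := by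
    intro z hz X v u
    have h1 : DifferentiableAt ℝ η z :=
      (hη.differentiableOn (by simp)).differentiableAt (hO.mem_nhds hz)
    rw [← hσapply z hz]
    have h2 := (h1.hasFDerivAt.clm_apply (hasFDerivAt_const v z)).clm_apply (hasFDerivAt_const u z)
    have h3 := h2.fderiv
    change fderiv ℝ (fun z ↦ σ z ![(0, v), (u, 0)]) z = _ at h3
    rw [h3]
    simp
  obtain ⟨θ₀, hθ₀, hθ₀e, hθ₀d⟩ := exists_primitive_punctured hE hB he hη (by
    intro z hz u v
    ext w
    rw [hηd z hz, hηd z hz]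
    have h1 : extDeriv σ z ![(0, u), (0, v), (w, 0)] = 0 := by rw [hcl z hz]; rfl
    rw [extDeriv_apply_triple] at h1
    have h2 : fderiv ℝ σ z (w, 0) ![(0, u), (0, v)] = 0 := by
      rw [← hσapply z hz]
      have : (fun z ↦ σ z ![(0, u), (0, v)]) =ᶠ[nhds z] fun _ ↦ 0 := by
        filter_upwards [hO.mem_nhds hz] with z' hz' using hvert z' hz' u v
      rw [this.fderiv_eq]; simp
    linarith)
  -- the primitive over `B` of the restriction to the slice `y = e`
  have hj : ContDiff ℝ ∞ fun x : E ↦ (x, e) := by fun_prop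
  have hjd : ∀ x : E, fderiv ℝ (fun x : E ↦ (x, e)) x = ContinuousLinearMap.inl ℝ E E := fun x ↦
    (hasFDerivAt_prodMk_left x e).fderiv
  have hjB : ∀ x ∈ B, (x, e) ∈ B ×ˢ ({0}ᶜ : Set E) := fun x hx ↦ ⟨hx, he⟩
  obtain ⟨α, hα, hαd⟩ := exists_extDeriv_eq_of_starConvex hB hBs
    (β := fun x ↦ (σ (x, e)).compContinuousLinearMap (ContinuousLinearMap.inl ℝ E E))
    (ContDiffOn.alternating_comp (hσ.comp hj.contDiffOn hjB) contDiffOn_const) (by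
      intro x hx
      rw [extDeriv_of_eventuallyEq_pullback (f := fun x : E ↦ (x, e)) (η := σ)
        (Filter.Eventually.of_forall fun w ↦ by rw [hjd]) (hσd _ (hjB x hx)) hj.contDiffAt,
        hcl _ (hjB x hx)]
      exact alternating_three_ext fun _ _ _ ↦ rfl)
  have hαd' : ∀ x ∈ B, DifferentiableAt ℝ α x := fun x hx ↦
    (hα.differentiableOn (by simp)).differentiableAt (hB.mem_nhds hx)
  let α' : E → E →L[ℝ] ℝ := fun x ↦
    (ContinuousAlternatingMap.ofSubsingleton ℝ E ℝ (0 : Fin 1)).symm (α x)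
  have hα'a : ∀ x u, α' x u = α x ![u] := by
    intro x u
    simp only [α']
    exact congrArg (α x) (funext fun i ↦ by fin_cases i; rfl)
  have hα' : ContDiffOn ℝ ∞ α' B := by
    rw [contDiffOn_clm_apply]
    intro u
    simp only [hα'a]
    exact (ContinuousAlternatingMap.apply ℝ E ℝ ![u]).contDiff.comp_contDiffOn hα
  let θ : E × E → E →L[ℝ] ℝ := fun z ↦ θ₀ z + α' z.1
  have hθ : ContDiffOn ℝ ∞ θ (B ×ˢ {0}ᶜ) :=
    hθ₀.add (hα'.comp contDiffOn_fst fun z hz ↦ hz.1)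
  have hθdiff : ∀ z ∈ B ×ˢ ({0}ᶜ : Set E), DifferentiableAt ℝ θ z := fun z hz ↦
    (hθ.differentiableOn (by simp)).differentiableAt (hO.mem_nhds hz)
  have hθd : ∀ z ∈ B ×ˢ ({0}ᶜ : Set E), ∀ v u, fderiv ℝ θ z (0, v) u = σ z ![(0, v), (u, 0)] := by
    intro z hz v u
    have h0 : DifferentiableAt ℝ θ₀ z :=
      (hθ₀.differentiableOn (by simp)).differentiableAt (hO.mem_nhds hz)
    have h1 := (hasFDerivAt_slice h0).add_const (α' z.1)
    have h2 := (hasFDerivAt_slice (hθdiff z hz)).unique h1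
    have h3 := congrArg (fun L : E →L[ℝ] E →L[ℝ] ℝ ↦ L v u) h2
    simp only [ContinuousLinearMap.comp_apply, ContinuousLinearMap.inr_apply, hθ₀d z hz] at h3
    exact h3
  -- by Euler's identity, `F` has to be the contraction of `θ = ∂F/∂y` with `y`
  let F : E × E → ℝ := fun z ↦ θ z z.2
  have hF : ContDiffOn ℝ ∞ F (B ×ˢ {0}ᶜ) := hθ.clm_apply contDiffOn_snd
  have hFd : ∀ z ∈ B ×ˢ ({0}ᶜ : Set E), ∀ v, fderiv ℝ F z (0, v) = θ z v := by
    intro z hz v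
    have h1 : HasFDerivAt F
        ((θ z).comp (ContinuousLinearMap.snd ℝ E E) + (fderiv ℝ θ z).flip z.2) z :=
      (hθdiff z hz).hasFDerivAt.clm_apply hasFDerivAt_snd
    rw [h1.fderiv]
    simp [hθd z hz, hspray z hz]
  have hFdd : ∀ z ∈ B ×ˢ ({0}ᶜ : Set E), ∀ X v,
      fderiv ℝ (fderiv ℝ F) z X (0, v) = fderiv ℝ θ z X v := by
    intro z hz X v
    have h1 : DifferentiableAt ℝ (fderiv ℝ F) z :=
      ((hF.fderiv_of_isOpen (m := ∞) hO (by simp)).differentiableOn (by simp)).differentiableAt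
        (hO.mem_nhds hz)
    have h2 := h1.hasFDerivAt.clm_apply (hasFDerivAt_const ((0 : E), v) z)
    have h3 := (hθdiff z hz).hasFDerivAt.clm_apply (hasFDerivAt_const v z)
    have h4 : (fun z ↦ fderiv ℝ F z (0, v)) =ᶠ[nhds z] fun z ↦ θ z v := by
      filter_upwards [hO.mem_nhds hz] with w hw using hFd w hw v
    have h5 := h2.unique (h3.congr_of_eventuallyEq h4)
    simpa using congrArg (fun L : E × E →L[ℝ] ℝ ↦ L X) h5
  -- the horizontal part of `σ - dθ` does not depend on `y`, and vanishes for `y = e`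
  have hhor : ∀ x ∈ B, ∀ y ∈ ({0}ᶜ : Set E), ∀ u v : E, σ (x, y) ![(u, 0), (v, 0)] =
      fderiv ℝ θ (x, y) (u, 0) v - fderiv ℝ θ (x, y) (v, 0) u := by
    intro x hx y hy u v
    have hθθ : ∀ z ∈ B ×ˢ ({0}ᶜ : Set E), DifferentiableAt ℝ (fderiv ℝ θ) z := fun z hz ↦
      ((hθ.fderiv_of_isOpen (m := ∞) hO (by simp)).differentiableOn (by simp)).differentiableAt
        (hO.mem_nhds hz)
    -- the derivatives of the mixed part of `σ` are second derivatives of `θ`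
    have hmix : ∀ z ∈ B ×ˢ ({0}ᶜ : Set E), ∀ a b w : E,
        fderiv ℝ (fderiv ℝ θ) z (0, w) (a, 0) b = fderiv ℝ σ z (a, 0) ![(0, w), (b, 0)] := by
      intro z hz a b w
      have hsym : IsSymmSndFDerivAt ℝ θ z :=
        (hθ.contDiffAt (hO.mem_nhds hz)).isSymmSndFDerivAt (by
          rw [minSmoothness_of_isRCLikeNormedField]; exact WithTop.coe_le_coe.2 le_top)
      rw [hsym.eq, ← hσapply z hz]
      have h2 := ((hθθ z hz).hasFDerivAt.clm_apply (hasFDerivAt_const ((0 : E), w) z)).clm_apply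
        (hasFDerivAt_const b z)
      have h4 : (fun z ↦ σ z ![(0, w), (b, 0)]) =ᶠ[nhds z] fun z ↦ fderiv ℝ θ z (0, w) b := by
        filter_upwards [hO.mem_nhds hz] with z' hz' using (hθd z' hz' w b).symm
      rw [h4.fderiv_eq, h2.fderiv]
      simp
    let k : E → ℝ := fun y ↦ σ (x, y) ![(u, 0), (v, 0)] -
      (fderiv ℝ θ (x, y) (u, 0) v - fderiv ℝ θ (x, y) (v, 0) u)
    have hk : ∀ w ∈ ({0}ᶜ : Set E), HasFDerivAt k (0 : E →L[ℝ] ℝ) w := by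
      intro w hw
      have hz : (x, w) ∈ B ×ˢ ({0}ᶜ : Set E) := ⟨hx, hw⟩
      have h1 : ∀ a b : E, HasFDerivAt (fun z ↦ fderiv ℝ θ z (a, 0) b) _ (x, w) := fun a b ↦
        ((hθθ _ hz).hasFDerivAt.clm_apply (hasFDerivAt_const (a, (0 : E)) (x, w))).clm_apply
          (hasFDerivAt_const b (x, w))
      have h2 := (hσd _ hz).hasFDerivAt.continuousAlternatingMap_apply_const
        ![(u, (0 : E)), (v, (0 : E))]
      have h3 := h2.sub ((h1 u v).sub (h1 v u))
      have h4 := h3.comp w (hasFDerivAt_prodMk_right x w)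
      refine h4.congr_fderiv ?_
      ext w'
      have h5 : extDeriv σ (x, w) ![(0, w'), (u, 0), (v, 0)] = 0 := by rw [hcl _ hz]; rfl
      rw [extDeriv_apply_triple] at h5
      simp only [ContinuousLinearMap.comp_apply, ContinuousLinearMap.inr_apply,
        sub_apply, add_apply,
        ContinuousLinearMap.flip_apply, zero_apply, map_zero, zero_add,
        hmix _ hz]
      change fderiv ℝ σ (x, w) (0, w') ![(u, 0), (v, 0)] - _ = (0 : ℝ)
      linarith
    have hke : k e = 0 := by
      have hz := hjB x hx
      have h1 : ∀ a b : E, fderiv ℝ θ (x, e) (a, 0) b = fderiv ℝ α x a ![b] := by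
        intro a b
        have h0 : HasFDerivAt (fun x ↦ θ (x, e)) _ x := HasFDerivAt.comp x (g := θ)
          (f := fun x ↦ (x, e)) (hθdiff _ hz).hasFDerivAt (hasFDerivAt_prodMk_left x e)
        have h2 := h0.clm_apply (hasFDerivAt_const b x)
        have h3 := (hαd' x hx).hasFDerivAt.continuousAlternatingMap_apply_const ![b]
        have h4 : (fun x ↦ θ (x, e) b) = fun x ↦ α x ![b] := by
          funext x'
          simp [θ, hθ₀e, hα'a]
        rw [h4] at h2
        have h5 := congrArg (fun L : E →L[ℝ] ℝ ↦ L a) (h2.unique h3)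
        simpa using h5
      have h6 := congrArg (fun τ : E [⋀^Fin 2]→L[ℝ] ℝ ↦ τ ![u, v]) (hαd x hx)
      simp only [extDeriv_apply_pair, compContinuousLinearMap_pair] at h6
      simp only [k, h1, h6]
      simp
    have h1 := isOpen_compl_singleton.is_const_of_fderiv_eq_zero (𝕜 := ℝ)
      (isConnected_compl_zero (E := E) (by omega)).isPreconnected
      (fun w hw ↦ (hk w hw).differentiableAt.differentiableWithinAt)
      (fun w hw ↦ (hk w hw).fderiv) hy (show e ∈ ({0}ᶜ : Set E) from he)
    have h2 : k y = 0 := h1.trans hke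
    exact sub_eq_zero.1 h2
  refine ⟨F, hF, ?_, ?_⟩
  · intro z hz s hs
    have hmem : ∀ r ∈ Ioi (0 : ℝ), (z.1, r • z.2) ∈ B ×ˢ ({0}ᶜ : Set E) := fun r hr ↦
      ⟨hz.1, smul_ne_zero (ne_of_gt hr) hz.2⟩
    -- `θ` is constant along the radial half-lines
    have hd : ∀ r ∈ Ioi (0 : ℝ), HasDerivAt (fun r : ℝ ↦ θ (z.1, r • z.2)) 0 r := by
      intro r hr
      have h1 : HasDerivAt (fun r : ℝ ↦ (z.1, r • z.2)) ((0 : E), z.2) r := by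
        refine HasDerivAt.prodMk (hasDerivAt_const _ _) ?_
        simpa using (hasDerivAt_id r).smul_const z.2
      have h2 := (hθdiff _ (hmem r hr)).hasFDerivAt.comp_hasDerivAt r h1
      refine h2.congr_deriv ?_
      ext u
      have h3 := hrad _ (hmem r hr) u
      have h4 : ((0 : E), (z.1, r • z.2).2) = r • ((0 : E), z.2) := by simp
      rw [h4, alternating_smul_left] at h3
      rw [hθd _ (hmem r hr)]
      exact (mul_eq_zero.1 h3).resolve_left (ne_of_gt hr)
    have hconst : θ (z.1, s • z.2) = θ (z.1, (1 : ℝ) • z.2) :=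
      isOpen_Ioi.is_const_of_deriv_eq_zero isPreconnected_Ioi
        (fun r hr ↦ (hd r hr).differentiableAt.differentiableWithinAt)
        (fun r hr ↦ (hd r hr).deriv) hs (mem_Ioi.2 one_pos)
    simp only [F, hconst, one_smul, map_smul, smul_eq_mul]
  · intro z hz X Y
    rw [hFdd z hz, hFdd z hz]
    have hX : X = (X.1, 0) + (0, X.2) := by simp
    have hY : Y = (Y.1, 0) + (0, Y.2) := by simp
    have h1 : ∀ W : E × E, fderiv ℝ θ z W = fderiv ℝ θ z (W.1, 0) + fderiv ℝ θ z (0, W.2) := by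
      intro W
      rw [← map_add]; simp
    rw [h1 X, h1 Y, add_apply, add_apply, hθd z hz,
      hθd z hz]
    conv_lhs => rw [hX, hY]
    rw [alternating_add_left, alternating_add_right, alternating_add_right, hvert z hz,
      hhor z.1 hz.1 z.2 hz.2 X.1 Y.1, alternating_swap _ (X.1, 0) (0, Y.2)]
    ring

end LocalPotential

/-! ### Forms annihilated by a submersion, in coordinates -/

section LocalDescent

variable {E F : Type*} [NormedAddCommGroup E] [NormedSpace ℝ E]
  [NormedAddCommGroup F] [NormedSpace ℝ F]

theorem fderivComp_pair (η : F [⋀^Fin 2]→L[ℝ] ℝ) (A A' : E →L[ℝ] F) (u v : E) :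
    η.fderivCompContinuousLinearMap A A' ![u, v] = η ![A' u, A v] + η ![A u, A' v] := by
  rw [ContinuousAlternatingMap.fderivCompContinuousLinearMap_apply, Fin.sum_univ_two]
  congr 2 <;> (funext j; fin_cases j <;> simp)

/-- A smooth family of right inverses of the differentials of a submersion. -/
theorem exists_smooth_rightInverse [FiniteDimensional ℝ F] {f : E → F} {z : E}
    (hf : ContDiffAt ℝ ∞ f z) (hs : Function.Surjective (fderiv ℝ f z)) :
    ∃ R : E → F →L[ℝ] E, ContDiffAt ℝ ∞ R z ∧
      ∀ᶠ w in nhds z, fderiv ℝ f w ∘L R w = ContinuousLinearMap.id ℝ F := by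
  obtain ⟨S, hS⟩ := exists_clm_rightInverse _ hs
  let g : E → F →L[ℝ] F := fun w ↦ fderiv ℝ f w ∘L S
  have hg : ContDiffAt ℝ ∞ g z := (hf.fderiv_right (m := ∞) (by simp)).clm_comp contDiffAt_const
  have hgz : g z = ((1 : (F →L[ℝ] F)ˣ) : F →L[ℝ] F) := hS
  have hinv : ContDiffAt ℝ ∞ (fun w ↦ Ring.inverse (g w)) z := by
    have h1 := contDiffAt_ringInverse ℝ (n := ∞) (1 : (F →L[ℝ] F)ˣ)
    rw [← hgz] at h1
    exact h1.comp z hg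
  refine ⟨fun w ↦ S ∘L Ring.inverse (g w), contDiffAt_const.clm_comp hinv, ?_⟩
  have hu : ∀ᶠ w in nhds z, IsUnit (g w) := by
    refine hg.continuousAt.eventually ?_
    rw [hgz]
    exact Units.nhds _
  filter_upwards [hu] with w hw
  have h1 : g w * Ring.inverse (g w) = 1 := Ring.mul_inverse_cancel _ hw
  exact h1

/-- If a closed 2-form `σ` is annihilated by the kernels of the differentials of `f` and is locally
the pullback of a family `τ` of forms, then `τ` is constant in the directions of the fibres. -/
theorem fderiv_eq_zero_of_closed_of_pullback {f : E → F} {σ : E → E [⋀^Fin 2]→L[ℝ] ℝ}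
    {τ : E → F [⋀^Fin 2]→L[ℝ] ℝ} {z : E} (hf : ContDiffAt ℝ ∞ f z)
    (hs : Function.Surjective (fderiv ℝ f z)) (hτ : DifferentiableAt ℝ τ z)
    (hστ : ∀ᶠ w in nhds z, σ w = (τ w).compContinuousLinearMap (fderiv ℝ f w))
    (hcl : extDeriv σ z = 0) {X : E} (hX : fderiv ℝ f z X = 0) : fderiv ℝ τ z X = 0 := by
  have hf' : DifferentiableAt ℝ (fderiv ℝ f) z :=
    (hf.fderiv_right (m := ∞) (by simp)).differentiableAt (by simp)
  have hd := hτ.hasFDerivAt.continuousAlternatingMapCompContinuousLinearMap hf'.hasFDerivAt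
  have hσ' : σ =ᶠ[nhds z] fun w ↦ (τ w).compContinuousLinearMap (fderiv ℝ f w) := hστ
  have hD : ∀ Y u v, fderiv ℝ σ z Y ![u, v] =
      fderiv ℝ τ z Y ![fderiv ℝ f z u, fderiv ℝ f z v] +
        (τ z ![fderiv ℝ (fderiv ℝ f) z Y u, fderiv ℝ f z v] +
          τ z ![fderiv ℝ f z u, fderiv ℝ (fderiv ℝ f) z Y v]) := by
    intro Y u v
    rw [hσ'.fderiv_eq, hd.fderiv, ← fderivComp_pair, ← compContinuousLinearMap_pair]
    rfl
  have hsym : IsSymmSndFDerivAt ℝ f z := hf.isSymmSndFDerivAt (by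
    rw [minSmoothness_of_isRCLikeNormedField]; exact WithTop.coe_le_coe.2 le_top)
  have h0l : ∀ (η : F [⋀^Fin 2]→L[ℝ] ℝ) b, η ![0, b] = 0 := fun η b ↦ by
    simpa using alternating_smul_left η 0 0 b
  -- the terms with second derivatives of `f` cancel in `dσ (X, u, v)`, which leaves the derivative
  -- of `τ` along `X`
  refine alternating_two_ext fun a b ↦ ?_
  obtain ⟨u, rfl⟩ := hs a
  obtain ⟨v, rfl⟩ := hs b
  have h1 : extDeriv σ z ![X, u, v] = 0 := by rw [hcl]; rfl
  rw [extDeriv_apply_triple, hD, hD, hD, hX, h0l, h0l, h0l, h0l, hsym.eq u X, hsym.eq v X,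
    alternating_swap (τ z) (fderiv ℝ (fderiv ℝ f) z X v)] at h1
  change _ = (0 : ℝ)
  linarith

/-- Along a curve in a fibre of a submersion `f`, a closed 2-form annihilated by the kernels of the
differentials of `f` is the pullback of one and the same form. -/
theorem eventually_descends_along_curve [FiniteDimensional ℝ E] [FiniteDimensional ℝ F]
    {f : E → F} {σ : E → E [⋀^Fin 2]→L[ℝ] ℝ} {c : ℝ → E} {t₀ : ℝ}
    (hf : ∀ᶠ z in nhds (c t₀), ContDiffAt ℝ ∞ f z)
    (hs : ∀ᶠ z in nhds (c t₀), Function.Surjective (fderiv ℝ f z))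
    (hσ : ContDiffAt ℝ ∞ σ (c t₀)) (hcl : ∀ᶠ z in nhds (c t₀), extDeriv σ z = 0)
    (hker : ∀ᶠ z in nhds (c t₀), ∀ X Y, fderiv ℝ f z X = 0 → σ z ![X, Y] = 0)
    (hc : ∀ᶠ t in nhds t₀, DifferentiableAt ℝ c t) (hfc : ∀ᶠ t in nhds t₀, f (c t) = f (c t₀))
    {B : F [⋀^Fin 2]→L[ℝ] ℝ} (hB : σ (c t₀) = B.compContinuousLinearMap (fderiv ℝ f (c t₀))) :
    ∀ᶠ t in nhds t₀, σ (c t) = B.compContinuousLinearMap (fderiv ℝ f (c t)) := by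
  obtain ⟨R, hR, hfR⟩ := exists_smooth_rightInverse hf.self_of_nhds hs.self_of_nhds
  let τ : E → F [⋀^Fin 2]→L[ℝ] ℝ := fun z ↦ (σ z).compContinuousLinearMap (R z)
  have hτ : ContDiffAt ℝ ∞ τ (c t₀) := ContDiffAt.alternating_comp hσ hR
  have hτd : ∀ᶠ z in nhds (c t₀), DifferentiableAt ℝ τ z := by
    filter_upwards [(hτ.of_le (show (1 : ℕ∞ω) ≤ ∞ by simp)).eventually (by simp)] with z hz
    exact hz.differentiableAt one_ne_zero
  -- `R ∘ df` is the identity modulo the kernel of `df`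
  have hstτ : ∀ᶠ z in nhds (c t₀), σ z = (τ z).compContinuousLinearMap (fderiv ℝ f z) := by
    filter_upwards [hfR, hker] with z hz hk
    have hR' : ∀ u, fderiv ℝ f z (R z u) = u := fun u ↦
      congrArg (fun L : F →L[ℝ] F ↦ L u) hz
    have hsub : ∀ u v, σ z ![u, v] = σ z ![R z (fderiv ℝ f z u), v] := by
      intro u v
      have h1 := hk (u - R z (fderiv ℝ f z u)) v (by rw [map_sub, hR', sub_self])
      have h2 := alternating_add_left (σ z) (u - R z (fderiv ℝ f z u)) (R z (fderiv ℝ f z u)) v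
      rw [h1, zero_add, sub_add_cancel] at h2
      exact h2
    refine alternating_two_ext fun u v ↦ ?_
    rw [compContinuousLinearMap_pair, compContinuousLinearMap_pair, hsub u v, alternating_swap,
      hsub v, ← alternating_swap]
  have hτ₀ : τ (c t₀) = B := by
    refine alternating_two_ext fun a b ↦ ?_
    have hR' : ∀ u, fderiv ℝ f (c t₀) (R (c t₀) u) = u := fun u ↦
      congrArg (fun L : F →L[ℝ] F ↦ L u) hfR.self_of_nhds
    simp only [τ, compContinuousLinearMap_pair, hB, hR']
  have hall := (((hf.and hs).and (hτd.and hcl)).and hstτ.eventually_nhds)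
  have hcont : ContinuousAt c t₀ := hc.self_of_nhds.continuousAt
  have hev := (hcont.eventually hall).and (hc.and hfc.eventually_nhds)
  have hder : ∀ᶠ t in nhds t₀, HasDerivAt (fun t ↦ τ (c t)) 0 t := by
    filter_upwards [hev] with t ht
    obtain ⟨⟨⟨⟨h1, h2⟩, h3, h4⟩, h5⟩, h6, h7⟩ := ht
    have h8 : HasDerivAt (fun t ↦ f (c t)) (fderiv ℝ f (c t) (deriv c t)) t :=
      (h1.differentiableAt (by simp)).hasFDerivAt.comp_hasDerivAt t h6.hasDerivAt
    have h9 : HasDerivAt (fun t ↦ f (c t)) 0 t :=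
      (hasDerivAt_const t (f (c t₀))).congr_of_eventuallyEq h7
    have h10 := h3.hasFDerivAt.comp_hasDerivAt t h6.hasDerivAt
    rwa [fderiv_eq_zero_of_closed_of_pullback h1 h2 h3 h5 h4 (h8.unique h9)] at h10
  obtain ⟨ε, hε, hball⟩ := Metric.eventually_nhds_iff_ball.1 (hder.and (hcont.eventually hstτ))
  filter_upwards [Metric.ball_mem_nhds t₀ hε] with t ht
  have hconst : τ (c t) = τ (c t₀) := Metric.isOpen_ball.is_const_of_deriv_eq_zero
    (convex_ball t₀ ε).isPreconnected
    (fun s hs ↦ (hball s hs).1.differentiableAt.differentiableWithinAt)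
    (fun s hs ↦ (hball s hs).1.deriv) ht (Metric.mem_ball_self hε)
  rw [(hball t ht).2, hconst, hτ₀]

end LocalDescent

/-! ### Forms on manifolds and their pullbacks -/

section ManifoldForms

variable {E : Type*} [NormedAddCommGroup E] [NormedSpace ℝ E]
  {H : Type*} [TopologicalSpace H] (I : ModelWithCorners ℝ E H)
  {N : Type*} [TopologicalSpace N] [ChartedSpace H N]
  {F : Type*} [NormedAddCommGroup F] [NormedSpace ℝ F]
  {K : Type*} [TopologicalSpace K] (J : ModelWithCorners ℝ F K)
  {Q : Type*} [TopologicalSpace Q] [ChartedSpace K Q]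

/-- `σ` is smooth on the open set `O`. -/
def SmoothFormOn {k : ℕ} (O : Set N) (σ : DForm I N k) : Prop :=
  ∀ p : N, ∀ v ∈ (extChartAt I p).source, v ∈ O →
    ContDiffAt ℝ ∞ (formInChart I σ p) (extChartAt I p v)

/-- `σ` is closed on the open set `O`. -/
def ClosedFormOn {k : ℕ} (O : Set N) (σ : DForm I N k) : Prop :=
  ∀ p : N, ∀ v ∈ (extChartAt I p).source, v ∈ O →
    extDeriv (formInChart I σ p) (extChartAt I p v) = 0

/-- The pullback of forms by a differentiable map. -/
noncomputable def pullbackForm {k : ℕ} (f : N → Q) (σ : DForm J Q k) : DForm I N k := fun v ↦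
  (σ (f v)).compContinuousLinearMap (mfderiv I J f v)

/-- The coordinate expression of `f` in the preferred charts at `p` and `q`. -/
noncomputable def mapInCharts (f : N → Q) (p : N) (q : Q) : E → F :=
  extChartAt J q ∘ f ∘ (extChartAt I p).symm

variable {I J}

theorem formInChart_apply {k : ℕ} (σ : DForm I N k) (p : N) (z : E) (m : Fin k → E) :
    formInChart I σ p z m =
      (σ ((extChartAt I p).symm z) : E [⋀^Fin k]→L[ℝ] ℝ)
        fun i ↦ (mfderiv 𝓘(ℝ, E) I (extChartAt I p).symm z : E →L[ℝ] E) (m i) := rfl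

theorem DForm.apply_congr {k : ℕ} (σ : DForm I N k) {v w : N} (h : v = w) (m : Fin k → E) :
    (σ v : E [⋀^Fin k]→L[ℝ] ℝ) m = (σ w : E [⋀^Fin k]→L[ℝ] ℝ) m := by
  subst h; rfl

section Charts

variable [I.Boundaryless] [IsManifold I ∞ N]

instance isManifold_one_of_infty : IsManifold I 1 N := IsManifold.of_le (n := ∞) (by simp)

theorem mdifferentiableAt_extChartAt_symm {p : N} {z : E} (hz : z ∈ (extChartAt I p).target) :
    MDifferentiableAt 𝓘(ℝ, E) I (extChartAt I p).symm z :=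
  ((contMDiffOn_extChartAt_symm (n := ∞) p).mdifferentiableOn (by simp)).mdifferentiableAt
    ((isOpen_extChartAt_target p).mem_nhds hz)

theorem mfderiv_symm_mfderiv_apply {p v : N} (hv : v ∈ (extChartAt I p).source) (X : E) :
    (mfderiv 𝓘(ℝ, E) I (extChartAt I p).symm (extChartAt I p v) : E →L[ℝ] E)
      ((mfderiv I 𝓘(ℝ, E) (extChartAt I p) v : E →L[ℝ] E) X) = X := by
  have h := mfderivWithin_extChartAt_symm_comp_mfderiv_extChartAt' (I := I) hv
  rw [I.range_eq_univ, mfderivWithin_univ] at h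
  exact congrArg (fun L : E →L[ℝ] E ↦ L X) h

theorem mfderiv_mfderiv_symm_apply {p v : N} (hv : v ∈ (extChartAt I p).source) (X : E) :
    (mfderiv I 𝓘(ℝ, E) (extChartAt I p) v : E →L[ℝ] E)
      ((mfderiv 𝓘(ℝ, E) I (extChartAt I p).symm (extChartAt I p v) : E →L[ℝ] E) X) = X := by
  have h := mfderiv_extChartAt_comp_mfderivWithin_extChartAt_symm' (I := I) hv
  rw [I.range_eq_univ, mfderivWithin_univ] at h
  exact congrArg (fun L : E →L[ℝ] E ↦ L X) h

theorem mfderiv_extChartAt_symm_self (p : N) (X : E) :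
    (mfderiv 𝓘(ℝ, E) I (extChartAt I p).symm (extChartAt I p p) : E →L[ℝ] E) X = X := by
  have h := mfderivWithin_range_extChartAt_symm (I := I) (x := p)
  rw [I.range_eq_univ, mfderivWithin_univ] at h
  exact congrArg (fun L : E →L[ℝ] E ↦ L X) h

theorem mfderiv_extChartAt_self_apply (p : N) (X : E) :
    (mfderiv I 𝓘(ℝ, E) (extChartAt I p) p : E →L[ℝ] E) X = X := by
  have h1 := mfderiv_mfderiv_symm_apply (I := I) (mem_extChartAt_source (I := I) p) X
  exact (congrArg _ (mfderiv_extChartAt_symm_self p X).symm).trans h1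

/-- In the preferred chart at `v`, the coordinate expression of a form at `v` is the form. -/
theorem formInChart_self {k : ℕ} (σ : DForm I N k) (v : N) (m : Fin k → E) :
    formInChart I σ v (extChartAt I v v) m = (σ v : E [⋀^Fin k]→L[ℝ] ℝ) m := by
  exact (DForm.apply_congr σ (extChartAt_to_inv (I := I) v) _).trans
    (congrArg _ (funext fun i ↦ mfderiv_extChartAt_symm_self v (m i)))

variable [IsManifold J ∞ Q]

theorem contDiffAt_mapInCharts {f : N → Q} {p v : N} {q : Q} (hf : ContMDiffAt I J ∞ f v)
    (hv : v ∈ (extChartAt I p).source) (hq : f v ∈ (extChartAt J q).source) :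
    ContDiffAt ℝ ∞ (mapInCharts I J f p q) (extChartAt I p v) := by
  rw [← contMDiffAt_iff_contDiffAt]
  have h1 : ContMDiffAt 𝓘(ℝ, E) I ∞ (extChartAt I p).symm (extChartAt I p v) :=
    (contMDiffOn_extChartAt_symm p).contMDiffAt
      ((isOpen_extChartAt_target p).mem_nhds ((extChartAt I p).map_source hv))
  have h2 : (extChartAt I p).symm (extChartAt I p v) = v := (extChartAt I p).left_inv hv
  refine ContMDiffAt.comp _ (I' := J) ?_ (ContMDiffAt.comp _ (I' := I) ?_ h1)
  · simp only [Function.comp_apply, h2]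
    exact contMDiffAt_extChartAt' (by rwa [extChartAt_source] at hq)
  · rwa [h2]

/-- The differential of the coordinate expression of `f`. -/
theorem fderiv_mapInCharts_apply {f : N → Q} {p v : N} {q : Q} (hf : MDifferentiableAt I J f v)
    (hv : v ∈ (extChartAt I p).source) (hq : f v ∈ (extChartAt J q).source) (X : E) :
    fderiv ℝ (mapInCharts I J f p q) (extChartAt I p v) X =
      (mfderiv J 𝓘(ℝ, F) (extChartAt J q) (f v) : F →L[ℝ] F) ((mfderiv I J f v : E →L[ℝ] F)
        ((mfderiv 𝓘(ℝ, E) I (extChartAt I p).symm (extChartAt I p v) : E →L[ℝ] E) X)) := by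
  have h1 := (mdifferentiableAt_extChartAt_symm
    ((extChartAt I p).map_source hv)).hasMFDerivAt
  have h2 : (extChartAt I p).symm (extChartAt I p v) = v := (extChartAt I p).left_inv hv
  have h3 : MDifferentiableAt I J f ((extChartAt I p).symm (extChartAt I p v)) := by rwa [h2]
  have h4 : MDifferentiableAt J 𝓘(ℝ, F) (extChartAt J q)
      (f ((extChartAt I p).symm (extChartAt I p v))) := by
    rw [h2]; exact mdifferentiableAt_extChartAt (by rwa [extChartAt_source] at hq)
  have h5 := (HasMFDerivAt.comp (extChartAt I p v) (g := extChartAt J q)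
    (f := f ∘ (extChartAt I p).symm) h4.hasMFDerivAt
    (HasMFDerivAt.comp (extChartAt I p v) h3.hasMFDerivAt h1)).mfderiv
  rw [← mfderiv_eq_fderiv]
  have h6 := congrArg (fun L : E →L[ℝ] F ↦ L X) h5
  refine h6.trans ?_
  change (mfderiv J 𝓘(ℝ, F) (extChartAt J q) (f ((extChartAt I p).symm (extChartAt I p v))) :
    F →L[ℝ] F) ((mfderiv I J f ((extChartAt I p).symm (extChartAt I p v)) : E →L[ℝ] F)
        ((mfderiv 𝓘(ℝ, E) I (extChartAt I p).symm (extChartAt I p v) : E →L[ℝ] E) X)) = _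
  exact congrArg (fun w ↦ (mfderiv J 𝓘(ℝ, F) (extChartAt J q) (f w) : F →L[ℝ] F)
    ((mfderiv I J f w : E →L[ℝ] F)
      ((mfderiv 𝓘(ℝ, E) I (extChartAt I p).symm (extChartAt I p v) : E →L[ℝ] E) X))) h2

variable [J.Boundaryless]

/-- Near a point, the coordinate expression of a pulled back form is the pullback of the coordinate
expression. -/
theorem eventually_formInChart_pullback {k : ℕ} {O : Set N} (hO : IsOpen O) {f : N → Q}
    (hf : ContMDiffOn I J ∞ f O) {σ : DForm J Q k} {τ : DForm I N k}
    (hτ : ∀ v ∈ O, τ v = pullbackForm I J f σ v) {p v : N} {q : Q} (hvO : v ∈ O)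
    (hv : v ∈ (extChartAt I p).source) (hq : f v ∈ (extChartAt J q).source) :
    ∀ᶠ z in nhds (extChartAt I p v), formInChart I τ p z =
      (formInChart J σ q (mapInCharts I J f p q z)).compContinuousLinearMap
        (fderiv ℝ (mapInCharts I J f p q) z) := by
  have hsymm : ContinuousAt (extChartAt I p).symm (extChartAt I p v) :=
    continuousAt_extChartAt_symm' hv
  have h2 : (extChartAt I p).symm (extChartAt I p v) = v := (extChartAt I p).left_inv hv
  have hfc : ContinuousAt f v := (hf.contMDiffAt (hO.mem_nhds hvO)).continuousAt
  have hA : ∀ᶠ w in nhds v, w ∈ O ∧ w ∈ (extChartAt I p).source ∧ f w ∈ (extChartAt J q).source :=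
    (hO.eventually_mem hvO).and (((isOpen_extChartAt_source p).eventually_mem hv).and
      (hfc.eventually ((isOpen_extChartAt_source q).eventually_mem hq)))
  rw [← h2] at hA
  filter_upwards [hsymm.eventually hA, (isOpen_extChartAt_target (I := I) p).mem_nhds
    ((extChartAt I p).map_source hv)] with z hz hzt
  obtain ⟨hz1, hz2, hz3⟩ := hz
  have hzz : extChartAt I p ((extChartAt I p).symm z) = z := (extChartAt I p).right_inv hzt
  have hmd : MDifferentiableAt I J f ((extChartAt I p).symm z) :=
    (hf.contMDiffAt (hO.mem_nhds hz1)).mdifferentiableAt (by simp)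
  ext m
  have h3 : formInChart I τ p z m =
      (σ (f ((extChartAt I p).symm z)) : F [⋀^Fin k]→L[ℝ] ℝ) fun i ↦
        (mfderiv I J f ((extChartAt I p).symm z) : E →L[ℝ] F)
          ((mfderiv 𝓘(ℝ, E) I (extChartAt I p).symm z : E →L[ℝ] E) (m i)) := by
    rw [formInChart_apply, hτ _ hz1]
    rfl
  have h4 : (extChartAt J q).symm (mapInCharts I J f p q z) = f ((extChartAt I p).symm z) :=
    (extChartAt J q).left_inv hz3
  rw [h3, ContinuousAlternatingMap.compContinuousLinearMap_apply]
  refine ((DForm.apply_congr σ h4 _).trans (congrArg _ (funext fun i ↦ ?_))).symm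
  have h5 := fderiv_mapInCharts_apply (p := p) (q := q) hmd hz2 hz3 (m i)
  rw [hzz] at h5
  exact (congrArg _ h5).trans (mfderiv_symm_mfderiv_apply hz3 _)

theorem extDeriv_formInChart_of_pullback {k : ℕ} {O : Set N} (hO : IsOpen O) {f : N → Q}
    (hf : ContMDiffOn I J ∞ f O) {σ : DForm J Q k} {τ : DForm I N k}
    (hτ : ∀ v ∈ O, τ v = pullbackForm I J f σ v) {p v : N} {q : Q} (hvO : v ∈ O)
    (hv : v ∈ (extChartAt I p).source) (hq : f v ∈ (extChartAt J q).source)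
    (hσ : DifferentiableAt ℝ (formInChart J σ q) (extChartAt J q (f v))) :
    extDeriv (formInChart I τ p) (extChartAt I p v) =
      (extDeriv (formInChart J σ q) (extChartAt J q (f v))).compContinuousLinearMap
        (fderiv ℝ (mapInCharts I J f p q) (extChartAt I p v)) := by
  have hm := contDiffAt_mapInCharts (p := p) (q := q) (hf.contMDiffAt (hO.mem_nhds hvO)) hv hq
  have he : mapInCharts I J f p q (extChartAt I p v) = extChartAt J q (f v) := by
    simp only [mapInCharts, Function.comp_apply, (extChartAt I p).left_inv hv]
  rw [← he] at hσ ⊢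
  exact extDeriv_of_eventuallyEq_pullback (eventually_formInChart_pullback hO hf hτ hvO hv hq)
    hσ hm

variable [FiniteDimensional ℝ E] [FiniteDimensional ℝ F]

theorem contDiffAt_formInChart_of_pullback {k : ℕ} {O : Set N} (hO : IsOpen O) {f : N → Q}
    (hf : ContMDiffOn I J ∞ f O) {σ : DForm J Q k} {τ : DForm I N k}
    (hτ : ∀ v ∈ O, τ v = pullbackForm I J f σ v) {p v : N} {q : Q} (hvO : v ∈ O)
    (hv : v ∈ (extChartAt I p).source) (hq : f v ∈ (extChartAt J q).source)
    (hσ : ContDiffAt ℝ ∞ (formInChart J σ q) (extChartAt J q (f v))) :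
    ContDiffAt ℝ ∞ (formInChart I τ p) (extChartAt I p v) := by
  have hm := contDiffAt_mapInCharts (p := p) (q := q) (hf.contMDiffAt (hO.mem_nhds hvO)) hv hq
  have he : mapInCharts I J f p q (extChartAt I p v) = extChartAt J q (f v) := by
    simp only [mapInCharts, Function.comp_apply, (extChartAt I p).left_inv hv]
  rw [← he] at hσ
  refine ContDiffAt.congr_of_eventuallyEq ?_
    (eventually_formInChart_pullback hO hf hτ hvO hv hq)
  exact ContDiffAt.alternating_comp (hσ.comp _ hm) (hm.fderiv_right (m := ∞) (by simp))

end Charts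

end ManifoldForms

/-! ### Descent of closed 2-forms along submersions -/

section Descent

variable {E : Type*} [NormedAddCommGroup E] [NormedSpace ℝ E] [FiniteDimensional ℝ E]
  {H : Type*} [TopologicalSpace H] {I : ModelWithCorners ℝ E H} [I.Boundaryless]
  {N : Type*} [TopologicalSpace N] [ChartedSpace H N] [IsManifold I ∞ N]
  {F : Type*} [NormedAddCommGroup F] [NormedSpace ℝ F] [FiniteDimensional ℝ F]
  {K : Type*} [TopologicalSpace K] {J : ModelWithCorners ℝ F K} [J.Boundaryless]
  {Q : Type*} [TopologicalSpace Q] [ChartedSpace K Q] [IsManifold J ∞ Q]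

/-- A property of all points of `O` whose images lie in a given chart holds near each such point,
when read in a chart. -/
theorem eventually_chart {O : Set N} (hO : IsOpen O) {f : N → Q} (hf : ContMDiffOn I J ∞ f O)
    {p v : N} {q : Q} (hvO : v ∈ O) (hv : v ∈ (extChartAt I p).source)
    (hq : f v ∈ (extChartAt J q).source) {C : E → Prop}
    (h : ∀ w ∈ O, w ∈ (extChartAt I p).source → f w ∈ (extChartAt J q).source →
      C (extChartAt I p w)) :
    ∀ᶠ z in nhds (extChartAt I p v), C z := by
  have hsymm : ContinuousAt (extChartAt I p).symm (extChartAt I p v) :=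
    continuousAt_extChartAt_symm' hv
  have h2 : (extChartAt I p).symm (extChartAt I p v) = v := (extChartAt I p).left_inv hv
  have hfc : ContinuousAt f v := (hf.contMDiffAt (hO.mem_nhds hvO)).continuousAt
  have hA : ∀ᶠ w in nhds v, w ∈ O ∧ w ∈ (extChartAt I p).source ∧ f w ∈ (extChartAt J q).source :=
    (hO.eventually_mem hvO).and (((isOpen_extChartAt_source p).eventually_mem hv).and
      (hfc.eventually ((isOpen_extChartAt_source q).eventually_mem hq)))
  rw [← h2] at hA
  filter_upwards [hsymm.eventually hA, (isOpen_extChartAt_target (I := I) p).mem_nhds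
    ((extChartAt I p).map_source hv)] with z hz hzt
  have h3 := h _ hz.1 hz.2.1 hz.2.2
  rwa [(extChartAt I p).right_inv hzt] at h3

theorem surjective_fderiv_mapInCharts {f : N → Q} {p v : N} {q : Q}
    (hf : MDifferentiableAt I J f v) (hs : Function.Surjective (mfderiv I J f v))
    (hv : v ∈ (extChartAt I p).source) (hq : f v ∈ (extChartAt J q).source) :
    Function.Surjective (fderiv ℝ (mapInCharts I J f p q) (extChartAt I p v)) := by
  intro a
  obtain ⟨X, hX⟩ := hs ((mfderiv 𝓘(ℝ, F) J (extChartAt J q).symm (extChartAt J q (f v)) :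
    F →L[ℝ] F) a)
  refine ⟨(mfderiv I 𝓘(ℝ, E) (extChartAt I p) v : E →L[ℝ] E) X, ?_⟩
  refine (fderiv_mapInCharts_apply hf hv hq _).trans ?_
  refine Eq.trans ?_ (mfderiv_mfderiv_symm_apply hq a)
  refine congrArg _ (Eq.trans (congrArg _ ?_) hX)
  exact mfderiv_symm_mfderiv_apply hv X

/-- The value at `v` of the 2-form `τ` is the pullback by `f` of the form `B`. -/
def IsDescentAt (I : ModelWithCorners ℝ E H) (J : ModelWithCorners ℝ F K) (f : N → Q)
    (τ : DForm I N 2) (v : N) (B : F [⋀^Fin 2]→L[ℝ] ℝ) : Prop :=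
  ∀ X Y : E, (τ v : E [⋀^Fin 2]→L[ℝ] ℝ) ![X, Y] =
    B ![(mfderiv I J f v : E →L[ℝ] F) X, (mfderiv I J f v : E →L[ℝ] F) Y]

theorem formInChart_pair {τ : DForm I N 2} (p : N) (z X Y : E) :
    formInChart I τ p z ![X, Y] = (τ ((extChartAt I p).symm z) : E [⋀^Fin 2]→L[ℝ] ℝ)
      ![(mfderiv 𝓘(ℝ, E) I (extChartAt I p).symm z : E →L[ℝ] E) X,
        (mfderiv 𝓘(ℝ, E) I (extChartAt I p).symm z : E →L[ℝ] E) Y] := by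
  rw [formInChart_apply]
  congr 1
  funext i
  fin_cases i <;> rfl

theorem formInChart_extChartAt_pair {τ : DForm I N 2} {p v : N}
    (hv : v ∈ (extChartAt I p).source) (X Y : E) :
    formInChart I τ p (extChartAt I p v) ![X, Y] = (τ v : E [⋀^Fin 2]→L[ℝ] ℝ)
      ![(mfderiv 𝓘(ℝ, E) I (extChartAt I p).symm (extChartAt I p v) : E →L[ℝ] E) X,
        (mfderiv 𝓘(ℝ, E) I (extChartAt I p).symm (extChartAt I p v) : E →L[ℝ] E) Y] :=
  (formInChart_pair p _ X Y).trans (DForm.apply_congr τ ((extChartAt I p).left_inv hv) _)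

theorem isDescentAt_iff {f : N → Q} {τ : DForm I N 2} {p v : N} {q : Q}
    (hf : MDifferentiableAt I J f v) (hv : v ∈ (extChartAt I p).source) (hq : f v = q)
    (B : F [⋀^Fin 2]→L[ℝ] ℝ) :
    IsDescentAt I J f τ v B ↔ formInChart I τ p (extChartAt I p v) =
      B.compContinuousLinearMap (fderiv ℝ (mapInCharts I J f p q) (extChartAt I p v)) := by
  subst hq
  have hd : ∀ X, fderiv ℝ (mapInCharts I J f p (f v)) (extChartAt I p v) X =
      (mfderiv I J f v : E →L[ℝ] F)
        ((mfderiv 𝓘(ℝ, E) I (extChartAt I p).symm (extChartAt I p v) : E →L[ℝ] E) X) :=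
    fun X ↦ (fderiv_mapInCharts_apply hf hv (mem_extChartAt_source (f v)) X).trans
      (mfderiv_extChartAt_self_apply _ _)
  constructor
  · intro h
    refine alternating_two_ext fun X Y ↦ ?_
    rw [compContinuousLinearMap_pair, hd, hd]
    exact (formInChart_extChartAt_pair hv X Y).trans (h _ _)
  · intro h X Y
    have h1 : ∀ U V, formInChart I τ p (extChartAt I p v) ![U, V] =
        B ![fderiv ℝ (mapInCharts I J f p (f v)) (extChartAt I p v) U,
          fderiv ℝ (mapInCharts I J f p (f v)) (extChartAt I p v) V] := fun U V ↦ by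
      rw [h, compContinuousLinearMap_pair]
    simp only [hd] at h1
    have h2 := (formInChart_extChartAt_pair (τ := τ) hv _ _).symm.trans
      (h1 ((mfderiv I 𝓘(ℝ, E) (extChartAt I p) v : E →L[ℝ] E) X)
        ((mfderiv I 𝓘(ℝ, E) (extChartAt I p) v : E →L[ℝ] E) Y))
    have h3 := fun X ↦ mfderiv_symm_mfderiv_apply (I := I) hv X
    refine Eq.trans ?_ (h2.trans ?_)
    · exact congrArg₂ (fun X Y ↦ (τ v : E [⋀^Fin 2]→L[ℝ] ℝ) ![X, Y]) (h3 X).symm (h3 Y).symm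
    · exact congrArg₂ (fun X Y ↦ B ![(mfderiv I J f v : E →L[ℝ] F) X,
        (mfderiv I J f v : E →L[ℝ] F) Y]) (h3 X) (h3 Y)

theorem IsDescentAt.unique {f : N → Q} {τ : DForm I N 2} {v : N}
    (hs : Function.Surjective (mfderiv I J f v)) {B B' : F [⋀^Fin 2]→L[ℝ] ℝ}
    (h : IsDescentAt I J f τ v B) (h' : IsDescentAt I J f τ v B') : B = B' := by
  refine alternating_two_ext fun a b ↦ ?_
  obtain ⟨X, rfl⟩ := hs a
  obtain ⟨Y, rfl⟩ := hs b
  exact (h X Y).symm.trans (h' X Y)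

/-- An alternating form annihilated by the kernel of a surjective map is a pullback. -/
theorem exists_alternating_of_ker (η : E [⋀^Fin 2]→L[ℝ] ℝ) (A : E →L[ℝ] F)
    (hA : Function.Surjective A) (hker : ∀ X Y, A X = 0 → η ![X, Y] = 0) :
    ∃ B : F [⋀^Fin 2]→L[ℝ] ℝ, ∀ X Y, η ![X, Y] = B ![A X, A Y] := by
  obtain ⟨S, hS⟩ := exists_clm_rightInverse A hA
  have hS' : ∀ a, A (S a) = a := fun a ↦ congrArg (fun L : F →L[ℝ] F ↦ L a) hS
  refine ⟨η.compContinuousLinearMap S, fun X Y ↦ ?_⟩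
  have hsub : ∀ u w : E, η ![u, w] = η ![S (A u), w] := by
    intro u w
    have h1 := hker (u - S (A u)) w (by rw [map_sub, hS', sub_self])
    have h2 := alternating_add_left η (u - S (A u)) (S (A u)) w
    rw [h1, zero_add, sub_add_cancel] at h2
    exact h2
  rw [compContinuousLinearMap_pair, hsub X Y, alternating_swap, hsub Y, ← alternating_swap]

theorem exists_isDescentAt {f : N → Q} {τ : DForm I N 2} {v : N}
    (hs : Function.Surjective (mfderiv I J f v))
    (hker : ∀ X Y : E, (mfderiv I J f v : E →L[ℝ] F) X = 0 →
      (τ v : E [⋀^Fin 2]→L[ℝ] ℝ) ![X, Y] = 0) :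
    ∃ B, IsDescentAt I J f τ v B :=
  exists_alternating_of_ker (E := E) (F := F) (τ v) (mfderiv I J f v) hs hker

/-- `γ` is a curve from `v` to `w` in the part of a fibre of `f` that lies in `O`. -/
def JoinedInFibre (I : ModelWithCorners ℝ E H) (f : N → Q) (O : Set N) (v w : N) : Prop :=
  ∃ γ : ℝ → N, (∀ t, γ t ∈ O ∧ MDifferentiableAt 𝓘(ℝ, ℝ) I γ t ∧ f (γ t) = f v) ∧
    γ 0 = v ∧ γ 1 = w

/-- Along a curve in a fibre of `f`, the form `τ` is the pullback of one and the same alternating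
form: the set of times at which it is the pullback of `B` is open and closed. -/
theorem isDescentAt_of_joined {O : Set N} (hO : IsOpen O) {f : N → Q}
    (hf : ContMDiffOn I J ∞ f O) (hs : ∀ v ∈ O, Function.Surjective (mfderiv I J f v))
    {τ : DForm I N 2} (hτ : SmoothFormOn I O τ) (hcl : ClosedFormOn I O τ)
    (hker : ∀ v ∈ O, ∀ X Y : E, (mfderiv I J f v : E →L[ℝ] F) X = 0 →
      (τ v : E [⋀^Fin 2]→L[ℝ] ℝ) ![X, Y] = 0) {v w : N} (h : JoinedInFibre I f O v w)
    {B : F [⋀^Fin 2]→L[ℝ] ℝ} (hB : IsDescentAt I J f τ v B) : IsDescentAt I J f τ w B := by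
  obtain ⟨γ, hγ, rfl, rfl⟩ := h
  have hmd : ∀ v ∈ O, MDifferentiableAt I J f v := fun v hv ↦
    (hf.contMDiffAt (hO.mem_nhds hv)).mdifferentiableAt (by simp)
  have hev : ∀ t₀ (B : F [⋀^Fin 2]→L[ℝ] ℝ), IsDescentAt I J f τ (γ t₀) B →
      ∀ᶠ t in nhds t₀, IsDescentAt I J f τ (γ t) B := by
    intro t₀ B hB
    have hp := mem_extChartAt_source (I := I) (γ t₀)
    have hq := mem_extChartAt_source (I := J) (f (γ t₀))
    have hO₀ := (hγ t₀).1
    have hsrc : ∀ᶠ t in nhds t₀, γ t ∈ (extChartAt I (γ t₀)).source :=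
      (hγ t₀).2.1.continuousAt.eventually ((isOpen_extChartAt_source _).eventually_mem hp)
    have hfe : ∀ t, f (γ t) = f (γ t₀) := fun t ↦ (hγ t).2.2.trans (hγ t₀).2.2.symm
    have key := eventually_descends_along_curve (f := mapInCharts I J f (γ t₀) (f (γ t₀)))
      (σ := formInChart I τ (γ t₀)) (c := fun t ↦ extChartAt I (γ t₀) (γ t)) (t₀ := t₀) (B := B)
      (eventually_chart hO hf hO₀ hp hq fun w hw hwp hwq ↦
        contDiffAt_mapInCharts (hf.contMDiffAt (hO.mem_nhds hw)) hwp hwq)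
      (eventually_chart hO hf hO₀ hp hq fun w hw hwp hwq ↦
        surjective_fderiv_mapInCharts (hmd w hw) (hs w hw) hwp hwq)
      (hτ _ _ hp hO₀)
      (eventually_chart hO hf hO₀ hp hq fun w hw hwp hwq ↦ hcl _ _ hwp hw)
      (eventually_chart hO hf hO₀ hp hq fun w hw hwp hwq X Y hX ↦ by
        refine (formInChart_extChartAt_pair hwp X Y).trans (hker w hw _ _ ?_)
        rw [fderiv_mapInCharts_apply (hmd w hw) hwp hwq] at hX
        refine (mfderiv_symm_mfderiv_apply (I := J) hwq _).symm.trans ?_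
        exact (congrArg _ hX).trans (map_zero _))
      (by
        filter_upwards [hsrc] with t ht
        refine mdifferentiableAt_iff_differentiableAt.1 ?_
        exact (mdifferentiableAt_extChartAt (I := I) (x := γ t₀) (by
          rwa [extChartAt_source] at ht)).comp t (hγ t).2.1)
      (by
        filter_upwards [hsrc] with t ht
        simp only [mapInCharts, Function.comp_apply, (extChartAt I (γ t₀)).left_inv ht,
          (extChartAt I (γ t₀)).left_inv hp, hfe t])
      ((isDescentAt_iff (hmd _ hO₀) hp rfl B).1 hB)
    filter_upwards [key, hsrc] with t ht hts
    exact (isDescentAt_iff (hmd _ (hγ t).1) hts (hfe t) B).2 ht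
  have hclopen : IsClopen {t | IsDescentAt I J f τ (γ t) B} := by
    refine ⟨⟨isOpen_iff_mem_nhds.2 fun t₀ ht₀ ↦ ?_⟩,
      isOpen_iff_mem_nhds.2 fun t₀ ht₀ ↦ hev t₀ B ht₀⟩
    obtain ⟨B', hB'⟩ := exists_isDescentAt (J := J) (hs _ (hγ t₀).1) (hker _ (hγ t₀).1)
    filter_upwards [hev t₀ B' hB'] with t ht ht'
    exact ht₀ (ht.unique (hs _ (hγ t).1) ht' ▸ hB')
  have hu := hclopen.eq_univ ⟨0, hB⟩
  have h1 : (1 : ℝ) ∈ {t | IsDescentAt I J f τ (γ t) B} := hu ▸ mem_univ _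
  exact h1

/-- In charts, a form on the base of a submersion is the pullback of its pullback by a local
section. -/
theorem exists_section_formInChart {k : ℕ} {O : Set N} (hO : IsOpen O) {f : N → Q}
    (hf : ContMDiffOn I J ∞ f O) (hs : ∀ v ∈ O, Function.Surjective (mfderiv I J f v))
    {τ : DForm I N k} {σ : DForm J Q k} (hτσ : ∀ v ∈ O, τ v = pullbackForm I J f σ v)
    {v : N} {q : Q} (hv : v ∈ O) (hq : f v ∈ (extChartAt J q).source) :
    ∃ s : F → E, ContDiffAt ℝ ∞ s (extChartAt J q (f v)) ∧
      s (extChartAt J q (f v)) = extChartAt I v v ∧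
      ∀ᶠ z in nhds (extChartAt J q (f v)), formInChart J σ q z =
        (formInChart I τ v (s z)).compContinuousLinearMap (fderiv ℝ s z) := by
  have hp := mem_extChartAt_source (I := I) v
  have hfv := hf.contMDiffAt (hO.mem_nhds hv)
  have hsm := contDiffAt_mapInCharts (q := q) hfv hp hq
  have he : mapInCharts I J f v q (extChartAt I v v) = extChartAt J q (f v) := by
    simp only [mapInCharts, Function.comp_apply, (extChartAt I v).left_inv hp]
  obtain ⟨s, hs1, hs2, hs3⟩ := exists_section_of_surjective_fderiv hsm
    (surjective_fderiv_mapInCharts (hfv.mdifferentiableAt (by simp)) (hs v hv) hp hq)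
  rw [he] at hs1 hs2 hs3
  refine ⟨s, hs1, hs2, ?_⟩
  have h1 := eventually_formInChart_pullback hO hf hτσ hv hp hq
  have h2 : ∀ᶠ z in nhds (extChartAt I v v), ContDiffAt ℝ ∞ (mapInCharts I J f v q) z :=
    eventually_chart hO hf hv hp hq fun w hw hwp hwq ↦
        contDiffAt_mapInCharts (hf.contMDiffAt (hO.mem_nhds hw)) hwp hwq
  rw [← hs2] at h1 h2
  have h3 : ∀ᶠ z in nhds (extChartAt J q (f v)), DifferentiableAt ℝ s z := by
    filter_upwards [(hs1.of_le (show (1 : ℕ∞ω) ≤ ∞ by simp)).eventually (by simp)] with z hz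
    exact hz.differentiableAt one_ne_zero
  filter_upwards [hs1.continuousAt.eventually (h1.and h2), hs3.eventually_nhds, h3]
    with z hz hz3 hzd
  have hd : fderiv ℝ (mapInCharts I J f v q) (s z) ∘L fderiv ℝ s z =
      ContinuousLinearMap.id ℝ F := by
    have h4 := (hz.2.differentiableAt (by simp)).hasFDerivAt.comp z hzd.hasFDerivAt
    exact h4.unique ((hasFDerivAt_id z).congr_of_eventuallyEq hz3)
  rw [hz.1, hz3.self_of_nhds]
  ext m
  simp only [ContinuousAlternatingMap.compContinuousLinearMap_apply]
  congr 1
  funext i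
  exact (congrArg (fun L : F →L[ℝ] F ↦ L (m i)) hd).symm

/-- A form whose pullback by a surjective submersion is smooth is smooth. -/
theorem isSmoothForm_of_pullback {k : ℕ} {O : Set N} (hO : IsOpen O) {f : N → Q}
    (hf : ContMDiffOn I J ∞ f O) (hs : ∀ v ∈ O, Function.Surjective (mfderiv I J f v))
    (hsurj : f '' O = univ)
    {τ : DForm I N k} {σ : DForm J Q k} (hτσ : ∀ v ∈ O, τ v = pullbackForm I J f σ v)
    (hτ : SmoothFormOn I O τ) : IsSmoothForm J σ := by
  intro q z hz
  obtain ⟨v, hv, hfv⟩ := hsurj.symm ▸ mem_univ ((extChartAt J q).symm z)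
  have hq : f v ∈ (extChartAt J q).source := hfv ▸ (extChartAt J q).map_target hz
  have hz' : extChartAt J q (f v) = z := by rw [hfv, (extChartAt J q).right_inv hz]
  obtain ⟨s, hs1, hs2, hs3⟩ := exists_section_formInChart hO hf hs hτσ hv hq
  rw [hz'] at hs1 hs2 hs3
  refine ContDiffAt.contDiffWithinAt (ContDiffAt.congr_of_eventuallyEq ?_ hs3)
  have h1 := hτ v v (mem_extChartAt_source v) hv
  rw [← hs2] at h1
  exact ContDiffAt.alternating_comp (h1.comp z hs1) (hs1.fderiv_right (m := ∞) (by simp))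

theorem formInChart_zero {k : ℕ} (p : N) (z : E) : formInChart I (0 : DForm I N k) p z = 0 := by
  ext m; rfl

/-- A form whose pullback by a surjective submersion is closed is closed. -/
theorem isClosedForm_of_pullback {k : ℕ} {O : Set N} (hO : IsOpen O) {f : N → Q}
    (hf : ContMDiffOn I J ∞ f O) (hs : ∀ v ∈ O, Function.Surjective (mfderiv I J f v))
    (hsurj : f '' O = univ)
    {τ : DForm I N k} {σ : DForm J Q k} (hτσ : ∀ v ∈ O, τ v = pullbackForm I J f σ v)
    (hτ : SmoothFormOn I O τ) (hcl : ClosedFormOn I O τ) : IsClosedForm J σ := by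
  intro q z hz
  obtain ⟨v, hv, hfv⟩ := hsurj.symm ▸ mem_univ ((extChartAt J q).symm z)
  have hq : f v ∈ (extChartAt J q).source := hfv ▸ (extChartAt J q).map_target hz
  have hz' : extChartAt J q (f v) = z := by rw [hfv, (extChartAt J q).right_inv hz]
  obtain ⟨s, hs1, hs2, hs3⟩ := exists_section_formInChart hO hf hs hτσ hv hq
  rw [hz'] at hs1 hs2 hs3
  have h1 := hτ v v (mem_extChartAt_source v) hv
  have h2 := hcl v v (mem_extChartAt_source v) hv
  rw [← hs2] at h1 h2
  rw [extDeriv_of_eventuallyEq_pullback hs3 (h1.differentiableAt (by simp)) hs1, h2,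
    formInChart_zero]
  ext m; rfl

/-- A closed 2-form on `O` that is annihilated by the vertical vectors of a submersion `f` with
connected fibres is the pullback of a closed 2-form. -/
theorem exists_pullback_eq {O : Set N} (hO : IsOpen O) {f : N → Q}
    (hf : ContMDiffOn I J ∞ f O) (hs : ∀ v ∈ O, Function.Surjective (mfderiv I J f v))
    (hsurj : f '' O = univ)
    (hfib : ∀ v ∈ O, ∀ w ∈ O, f v = f w → Relation.ReflTransGen (JoinedInFibre I f O) v w)
    {τ : DForm I N 2} (hτ : SmoothFormOn I O τ) (hcl : ClosedFormOn I O τ)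
    (hker : ∀ v ∈ O, ∀ X Y : E, (mfderiv I J f v : E →L[ℝ] F) X = 0 →
      (τ v : E [⋀^Fin 2]→L[ℝ] ℝ) ![X, Y] = 0) :
    ∃ σ : DForm J Q 2, IsSmoothForm J σ ∧ IsClosedForm J σ ∧
      ∀ v ∈ O, ∀ X Y : E, (τ v : E [⋀^Fin 2]→L[ℝ] ℝ) ![X, Y] =
        (σ (f v) : F [⋀^Fin 2]→L[ℝ] ℝ) ![(mfderiv I J f v : E →L[ℝ] F) X,
          (mfderiv I J f v : E →L[ℝ] F) Y] := by
  have h0 : ∀ q : Q, ∃ v ∈ O, f v = q := fun q ↦ by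
    have := mem_univ q
    rwa [← hsurj] at this
  choose g hg hfg using h0
  have h1 : ∀ q, ∃ B, IsDescentAt I J f τ (g q) B := fun q ↦
    exists_isDescentAt (hs _ (hg q)) (hker _ (hg q))
  choose B hB using h1
  let σ : DForm J Q 2 := fun q ↦ (B q : F [⋀^Fin 2]→L[ℝ] ℝ)
  have h2 : ∀ v ∈ O, IsDescentAt I J f τ v (B (f v)) := by
    intro v hv
    have h3 : ∀ q w, Relation.ReflTransGen (JoinedInFibre I f O) (g q) w →
        IsDescentAt I J f τ w (B q) := by
      intro q w h
      induction h with
      | refl => exact hB q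
      | tail _ hbc ih => exact isDescentAt_of_joined hO hf hs hτ hcl hker hbc ih
    exact h3 _ _ (hfib (g (f v)) (hg _) v hv (hfg _))
  have h3 : ∀ v ∈ O, τ v = pullbackForm I J f σ v := fun v hv ↦
    alternating_two_ext (E := E) fun X Y ↦ (h2 v hv X Y).trans
      (compContinuousLinearMap_pair (E := E) (F := F) (B (f v)) (mfderiv I J f v) X Y).symm
  exact ⟨σ, isSmoothForm_of_pullback hO hf hs hsurj h3 hτ,
    isClosedForm_of_pullback hO hf hs hsurj h3 hτ hcl, h2⟩

end Descent

/-! ### The exterior derivative -/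

section ExteriorDerivative

variable {E : Type*} [NormedAddCommGroup E] [NormedSpace ℝ E]
  {H : Type*} [TopologicalSpace H] {I : ModelWithCorners ℝ E H} [I.Boundaryless]
  {N : Type*} [TopologicalSpace N] [ChartedSpace H N] [IsManifold I ∞ N]

variable (I) in
/-- The exterior derivative of a form; at each point it is computed in the preferred chart at that
point. -/
noncomputable def extDerivForm {k : ℕ} (σ : DForm I N k) : DForm I N (k + 1) := fun v ↦
  (extDeriv (formInChart I σ v) (extChartAt I v v) : E [⋀^Fin (k + 1)]→L[ℝ] ℝ)

theorem eq_pullbackForm_id {k : ℕ} (σ : DForm I N k) (v : N) :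
    σ v = pullbackForm I I (fun v ↦ v) σ v := by
  refine ContinuousAlternatingMap.ext fun m ↦ ?_
  refine Eq.trans ?_ (ContinuousAlternatingMap.compContinuousLinearMap_apply _ _ _).symm
  refine congrArg _ (funext fun i ↦ ?_)
  have h := mfderiv_id (I := I) (x := v)
  exact (congrArg (fun L : E →L[ℝ] E ↦ L (m i)) h).symm

/-- The exterior derivative can be computed in any chart. -/
theorem formInChart_extDerivForm {k : ℕ} {O : Set N} {σ : DForm I N k}
    (hσ : SmoothFormOn I O σ) {p v : N} (hv : v ∈ (extChartAt I p).source) (hvO : v ∈ O) :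
    formInChart I (extDerivForm I σ) p (extChartAt I p v) =
      extDeriv (formInChart I σ p) (extChartAt I p v) := by
  have hp := mem_extChartAt_source (I := I) v
  have hd := (hσ v v hp hvO).differentiableAt (by simp)
  have h1 := extDeriv_formInChart_of_pullback (O := univ) (f := fun v : N ↦ v) (p := p) (q := v)
    isOpen_univ contMDiffOn_id (fun v _ ↦ eq_pullbackForm_id σ v) (mem_univ v) hv hp hd
  rw [h1]
  refine ContinuousAlternatingMap.ext fun m ↦ ?_
  rw [ContinuousAlternatingMap.compContinuousLinearMap_apply]
  refine (DForm.apply_congr (extDerivForm I σ) ((extChartAt I p).left_inv hv) _).trans ?_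
  refine congrArg (extDeriv (formInChart I σ v) (extChartAt I v v)) (funext fun i ↦ ?_)
  refine Eq.symm ((fderiv_mapInCharts_apply (f := fun v : N ↦ v) mdifferentiableAt_id hv hp
    (m i)).trans ?_)
  refine (mfderiv_extChartAt_self_apply v _).trans ?_
  exact congrArg (fun L : E →L[ℝ] E ↦ L
    ((mfderiv 𝓘(ℝ, E) I (extChartAt I p).symm (extChartAt I p v) : E →L[ℝ] E) (m i)))
    (mfderiv_id (I := I) (x := v))

theorem eventually_chart_id {O : Set N} (hO : IsOpen O) {p v : N} (hvO : v ∈ O)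
    (hv : v ∈ (extChartAt I p).source) {C : E → Prop}
    (h : ∀ w ∈ O, w ∈ (extChartAt I p).source → C (extChartAt I p w)) :
    ∀ᶠ z in nhds (extChartAt I p v), C z := by
  have h2 : (extChartAt I p).symm (extChartAt I p v) = v := (extChartAt I p).left_inv hv
  have hA : ∀ᶠ w in nhds v, w ∈ O ∧ w ∈ (extChartAt I p).source :=
    (hO.eventually_mem hvO).and ((isOpen_extChartAt_source p).eventually_mem hv)
  rw [← h2] at hA
  filter_upwards [(continuousAt_extChartAt_symm' hv).eventually hA,
    (isOpen_extChartAt_target (I := I) p).mem_nhds ((extChartAt I p).map_source hv)] with z hz hzt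
  have h3 := h _ hz.1 hz.2
  rwa [(extChartAt I p).right_inv hzt] at h3

theorem eventually_formInChart_extDerivForm {k : ℕ} {O : Set N} (hO : IsOpen O) {σ : DForm I N k}
    (hσ : SmoothFormOn I O σ) {p v : N} (hv : v ∈ (extChartAt I p).source) (hvO : v ∈ O) :
    formInChart I (extDerivForm I σ) p =ᶠ[nhds (extChartAt I p v)]
      extDeriv (formInChart I σ p) :=
  eventually_chart_id hO hvO hv fun _ hw hwp ↦ formInChart_extDerivForm hσ hwp hw

theorem contDiffAt_extDeriv {k : ℕ} {η : E → E [⋀^Fin k]→L[ℝ] ℝ} {z : E}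
    (h : ContDiffAt ℝ ∞ η z) : ContDiffAt ℝ ∞ (extDeriv η) z := by
  have h1 : ContDiffAt ℝ ∞ (fderiv ℝ η) z := h.fderiv_right (m := ∞) (by simp)
  exact (ContinuousAlternatingMap.alternatizeUncurryFinCLM ℝ E ℝ).contDiff.contDiffAt.comp z h1

theorem SmoothFormOn.extDerivForm {k : ℕ} {O : Set N} (hO : IsOpen O) {σ : DForm I N k}
    (hσ : SmoothFormOn I O σ) : SmoothFormOn I O (extDerivForm I σ) := fun p v hv hvO ↦
  (contDiffAt_extDeriv (hσ p v hv hvO)).congr_of_eventuallyEq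
    (eventually_formInChart_extDerivForm hO hσ hv hvO)

theorem closedFormOn_extDerivForm {k : ℕ} {O : Set N} (hO : IsOpen O) {σ : DForm I N k}
    (hσ : SmoothFormOn I O σ) : ClosedFormOn I O (PathGeometry.extDerivForm I σ) :=
  fun p v hv hvO ↦ by
  rw [(eventually_formInChart_extDerivForm hO hσ hv hvO).extDeriv_eq]
  refine extDeriv_extDeriv_apply (hσ p v hv hvO) ?_
  rw [minSmoothness_of_isRCLikeNormedField]
  exact WithTop.coe_le_coe.2 le_top

end ExteriorDerivative

/-! ### Charts of the tangent bundle -/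

section TangentCharts

variable {n : ℕ} {M : Type*} [TopologicalSpace M] [ChartedSpace (EuclideanSpace ℝ (Fin n)) M]
  [IsManifold (𝓡 n) ∞ M]

/-- The preferred chart of `TM` at `p`. -/
noncomputable abbrev tchart (p : TangentBundle (𝓡 n) M) :
    PartialEquiv (TangentBundle (𝓡 n) M) (EuclideanSpace ℝ (Fin n) × EuclideanSpace ℝ (Fin n)) :=
  extChartAt (𝓡 n).tangent p

/-- The differential at `x` of the preferred chart of `M` at `q`. -/
noncomputable def dchart (q x : M) : EuclideanSpace ℝ (Fin n) →L[ℝ] EuclideanSpace ℝ (Fin n) :=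
  mfderiv (𝓡 n) 𝓘(ℝ, EuclideanSpace ℝ (Fin n)) (extChartAt (𝓡 n) q) x

/-- The differential at `x` of the inverse of the preferred chart of `M` at `q`. -/
noncomputable def dchartSymm (q : M) (x : EuclideanSpace ℝ (Fin n)) :
    EuclideanSpace ℝ (Fin n) →L[ℝ] EuclideanSpace ℝ (Fin n) :=
  mfderiv 𝓘(ℝ, EuclideanSpace ℝ (Fin n)) (𝓡 n) (extChartAt (𝓡 n) q).symm x

theorem dchart_dchartSymm {q : M} {x : EuclideanSpace ℝ (Fin n)}
    (hx : x ∈ (extChartAt (𝓡 n) q).target) (y : EuclideanSpace ℝ (Fin n)) :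
    dchart q ((extChartAt (𝓡 n) q).symm x) (dchartSymm q x y) = y := by
  have h := mfderiv_mfderiv_symm_apply ((extChartAt (𝓡 n) q).map_target hx) y
  rw [(extChartAt (𝓡 n) q).right_inv hx] at h
  exact h

theorem dchartSymm_dchart {q x : M}
    (hx : x ∈ (extChartAt (𝓡 n) q).source) (y : EuclideanSpace ℝ (Fin n)) :
    dchartSymm q (extChartAt (𝓡 n) q x) (dchart q x y) = y :=
  mfderiv_symm_mfderiv_apply hx y

theorem dchart_self (x : M) (y : EuclideanSpace ℝ (Fin n)) : dchart x x y = y :=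
  mfderiv_extChartAt_self_apply x y

theorem tchart_source (p : TangentBundle (𝓡 n) M) :
    (tchart p).source = {v | v.1 ∈ (extChartAt (𝓡 n) p.1).source} := by
  ext v
  simp [tchart]

theorem tchart_target (p : TangentBundle (𝓡 n) M) :
    (tchart p).target = (extChartAt (𝓡 n) p.1).target ×ˢ univ := by
  refine (FiberBundle.extChartAt_target (IB := 𝓡 n) (F := EuclideanSpace ℝ (Fin n))
    (E := TangentSpace (𝓡 n) (M := M)) p).trans ?_
  congr 1
  refine inter_eq_left.2 fun x hx ↦ ?_
  have := (extChartAt (𝓡 n) p.1).map_target hx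
  rwa [extChartAt_source] at this

theorem tchart_apply (p v : TangentBundle (𝓡 n) M) (hv : v.1 ∈ (extChartAt (𝓡 n) p.1).source) :
    tchart p v = (extChartAt (𝓡 n) p.1 v.1, dchart p.1 v.1 v.2) := by
  have hd : MDifferentiableAt (𝓡 n) 𝓘(ℝ, EuclideanSpace ℝ (Fin n)) (extChartAt (𝓡 n) p.1) v.1 :=
    mdifferentiableAt_extChartAt (by rwa [extChartAt_source] at hv)
  have h1 : tchart p v = (extChartAt (𝓡 n) p.1 v.1,
      (trivializationAt (EuclideanSpace ℝ (Fin n)) (TangentSpace (𝓡 n)) p.1 v).2) := by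
    rw [tchart, FiberBundle.extChartAt]; rfl
  rw [h1, dchart, MDifferentiableAt.mfderiv hd, TangentBundle.trivializationAt_apply]
  rfl

theorem tchart_symm_apply (p : TangentBundle (𝓡 n) M)
    {z : EuclideanSpace ℝ (Fin n) × EuclideanSpace ℝ (Fin n)}
    (hz : z.1 ∈ (extChartAt (𝓡 n) p.1).target) :
    (tchart p).symm z = ⟨(extChartAt (𝓡 n) p.1).symm z.1, dchartSymm p.1 z.1 z.2⟩ := by
  have hs := (extChartAt (𝓡 n) p.1).map_target hz
  have h1 : tchart p ⟨(extChartAt (𝓡 n) p.1).symm z.1, dchartSymm p.1 z.1 z.2⟩ = z := by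
    rw [tchart_apply _ _ hs]
    refine Prod.ext ((extChartAt (𝓡 n) p.1).right_inv hz) ?_
    exact dchart_dchartSymm hz z.2
  have h2 : (⟨(extChartAt (𝓡 n) p.1).symm z.1, dchartSymm p.1 z.1 z.2⟩ :
      TangentBundle (𝓡 n) M) ∈ (tchart p).source := by
    rw [tchart_source]; exact hs
  have h3 := (tchart p).left_inv h2
  rwa [h1] at h3

theorem isOpen_slit {U : Set M} (hU : IsOpen U) : IsOpen (slit (n := n) U) := by
  rw [isOpen_iff_mem_nhds]
  intro v hv
  have hsrc : IsOpen (tchart v).source := isOpen_extChartAt_source v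
  have hcont : ContinuousOn (tchart v) (tchart v).source := continuousOn_extChartAt v
  have h1 : IsOpen ((tchart v).source ∩ tchart v ⁻¹' (univ ×ˢ {0}ᶜ)) :=
    hcont.isOpen_inter_preimage hsrc (isOpen_univ.prod isOpen_compl_singleton)
  have hproj : IsOpen {w : TangentBundle (𝓡 n) M | w.1 ∈ U} :=
    hU.preimage (FiberBundle.continuous_proj (EuclideanSpace ℝ (Fin n)) (TangentSpace (𝓡 n)))
  have hmem : ∀ w ∈ (tchart v).source, ((tchart v w).2 = 0 ↔ w.2 = 0) := by
    intro w hw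
    rw [tchart_source] at hw
    rw [tchart_apply _ _ hw]
    constructor
    · intro h
      have h2 := dchartSymm_dchart hw w.2
      exact h2.symm.trans ((congrArg _ h).trans (map_zero _))
    · intro h
      exact (congrArg (dchart v.1 w.1) h).trans (map_zero _)
  have hvs : v ∈ (tchart v).source := mem_extChartAt_source v
  filter_upwards [(h1.inter hproj).mem_nhds ⟨⟨hvs, mem_univ _, fun h ↦ hv.2 ((hmem v hvs).1 h)⟩,
    hv.1⟩] with w hw
  exact ⟨hw.2, fun h ↦ hw.1.2.2 ((hmem w hw.1.1).2 h)⟩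

/-- The part of the target of the chart at `p` that corresponds to the slit tangent bundle
of `U`. -/
def slitChart (U : Set M) (p : TangentBundle (𝓡 n) M) :
    Set (EuclideanSpace ℝ (Fin n) × EuclideanSpace ℝ (Fin n)) :=
  {z | z.1 ∈ (extChartAt (𝓡 n) p.1).target ∧ (extChartAt (𝓡 n) p.1).symm z.1 ∈ U ∧ z.2 ≠ 0}

theorem isOpen_slitChart {U : Set M} (hU : IsOpen U) (p : TangentBundle (𝓡 n) M) :
    IsOpen (slitChart U p) := by
  have h1 : IsOpen ((extChartAt (𝓡 n) p.1).target ∩ (extChartAt (𝓡 n) p.1).symm ⁻¹' U) :=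
    (continuousOn_extChartAt_symm p.1).isOpen_inter_preimage (isOpen_extChartAt_target p.1) hU
  have h2 : slitChart U p =
      ((extChartAt (𝓡 n) p.1).target ∩ (extChartAt (𝓡 n) p.1).symm ⁻¹' U) ×ˢ {0}ᶜ := by
    ext z; simp [slitChart, and_assoc]
  rw [h2]
  exact h1.prod isOpen_compl_singleton

theorem symm_mem_slit {U : Set M} {p : TangentBundle (𝓡 n) M}
    {z : EuclideanSpace ℝ (Fin n) × EuclideanSpace ℝ (Fin n)} (hz : z ∈ slitChart U p) :
    (tchart p).symm z ∈ slit U := by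
  rw [tchart_symm_apply p hz.1]
  refine ⟨hz.2.1, fun h ↦ hz.2.2 ?_⟩
  exact (dchart_dchartSymm hz.1 z.2).symm.trans ((congrArg _ h).trans (map_zero _))

theorem mem_target_of_mem_slitChart {U : Set M} {p : TangentBundle (𝓡 n) M}
    {z : EuclideanSpace ℝ (Fin n) × EuclideanSpace ℝ (Fin n)} (hz : z ∈ slitChart U p) :
    z ∈ (tchart p).target := by
  rw [tchart_target]; exact ⟨hz.1, mem_univ _⟩

theorem tchart_mem_slitChart {U : Set M} {p v : TangentBundle (𝓡 n) M}
    (hv : v ∈ (tchart p).source) (hvU : v ∈ slit U) : tchart p v ∈ slitChart U p := by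
  rw [tchart_source] at hv
  rw [tchart_apply _ _ hv]
  refine ⟨(extChartAt (𝓡 n) p.1).map_source hv, ?_, fun h ↦ hvU.2 ?_⟩
  · rw [(extChartAt (𝓡 n) p.1).left_inv hv]; exact hvU.1
  · exact (dchartSymm_dchart hv v.2).symm.trans ((congrArg _ h).trans (map_zero _))

/-- The differential at `z` of the inverse of the chart of `TM` at `p`. -/
noncomputable def dtchartSymm (p : TangentBundle (𝓡 n) M)
    (z : EuclideanSpace ℝ (Fin n) × EuclideanSpace ℝ (Fin n)) :
    EuclideanSpace ℝ (Fin n) × EuclideanSpace ℝ (Fin n) →L[ℝ]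
      EuclideanSpace ℝ (Fin n) × EuclideanSpace ℝ (Fin n) :=
  mfderiv 𝓘(ℝ, EuclideanSpace ℝ (Fin n) × EuclideanSpace ℝ (Fin n)) (𝓡 n).tangent
    (extChartAt (𝓡 n).tangent p).symm z

theorem dtchartSymm_self (v : TangentBundle (𝓡 n) M)
    (X : EuclideanSpace ℝ (Fin n) × EuclideanSpace ℝ (Fin n)) :
    dtchartSymm v (tchart v v) X = X :=
  mfderiv_extChartAt_symm_self v X

theorem hasMFDerivAt_tchart_symm {p : TangentBundle (𝓡 n) M}
    {z : EuclideanSpace ℝ (Fin n) × EuclideanSpace ℝ (Fin n)} (hz : z ∈ (tchart p).target) :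
    HasMFDerivAt 𝓘(ℝ, EuclideanSpace ℝ (Fin n) × EuclideanSpace ℝ (Fin n)) (𝓡 n).tangent
      (tchart p).symm z (dtchartSymm p z) :=
  (mdifferentiableAt_extChartAt_symm hz).hasMFDerivAt

theorem tchart_self (v : TangentBundle (𝓡 n) M) :
    tchart v v = (extChartAt (𝓡 n) v.1 v.1, v.2) := by
  rw [tchart_apply _ _ (mem_extChartAt_source v.1)]
  exact Prod.ext rfl (dchart_self v.1 v.2)

theorem mdifferentiableAt_proj (v : TangentBundle (𝓡 n) M) :
    MDifferentiableAt (𝓡 n).tangent (𝓡 n) (fun w : TangentBundle (𝓡 n) M ↦ w.1) v :=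
  (Bundle.contMDiff_proj (n := 1) (IB := 𝓡 n) (F := EuclideanSpace ℝ (Fin n))
    (TangentSpace (𝓡 n) (M := M))).mdifferentiable one_ne_zero v

/-- In charts, the differential of the projection of `TM` is the first projection. -/
theorem dproj_dtchartSymm {p : TangentBundle (𝓡 n) M}
    {z : EuclideanSpace ℝ (Fin n) × EuclideanSpace ℝ (Fin n)} (hz : z ∈ (tchart p).target)
    (X : EuclideanSpace ℝ (Fin n) × EuclideanSpace ℝ (Fin n)) :
    (dproj ((tchart p).symm z) : EuclideanSpace ℝ (Fin n) × EuclideanSpace ℝ (Fin n) →L[ℝ]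
      EuclideanSpace ℝ (Fin n)) (dtchartSymm p z X) = dchartSymm p.1 z.1 X.1 := by
  have h1 := HasMFDerivAt.comp z (mdifferentiableAt_proj ((tchart p).symm z)).hasMFDerivAt
    (hasMFDerivAt_tchart_symm hz)
  have hz1 : z.1 ∈ (extChartAt (𝓡 n) p.1).target := by
    rw [tchart_target] at hz; exact hz.1
  have h2 : HasMFDerivAt 𝓘(ℝ, EuclideanSpace ℝ (Fin n)) (𝓡 n) (extChartAt (𝓡 n) p.1).symm z.1
      (dchartSymm p.1 z.1) := (mdifferentiableAt_extChartAt_symm hz1).hasMFDerivAt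
  have h3 : HasMFDerivAt 𝓘(ℝ, EuclideanSpace ℝ (Fin n) × EuclideanSpace ℝ (Fin n))
      𝓘(ℝ, EuclideanSpace ℝ (Fin n)) Prod.fst z
      (ContinuousLinearMap.fst ℝ (EuclideanSpace ℝ (Fin n)) (EuclideanSpace ℝ (Fin n))) :=
    (hasFDerivAt_fst (𝕜 := ℝ) (p := z)).hasMFDerivAt
  have h4 := HasMFDerivAt.comp z h2 h3
  have h5 : (extChartAt (𝓡 n) p.1).symm ∘ Prod.fst =ᶠ[nhds z]
      (fun w : TangentBundle (𝓡 n) M ↦ w.1) ∘ (tchart p).symm := by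
    filter_upwards [(isOpen_extChartAt_target (I := (𝓡 n).tangent) p).mem_nhds hz] with w hw
    have hw1 : w ∈ (tchart p).target := hw
    rw [tchart_target] at hw1
    simp only [Function.comp_apply, tchart_symm_apply p hw1.1]
  have h6 := hasMFDerivAt_unique (h1.congr_of_eventuallyEq h5) h4
  exact congrArg (fun L : EuclideanSpace ℝ (Fin n) × EuclideanSpace ℝ (Fin n) →L[ℝ]
    EuclideanSpace ℝ (Fin n) ↦ L X) h6

/-- In charts, the Liouville field is `(x, y) ↦ (0, y)`. -/
theorem liouville_tchart_symm {p : TangentBundle (𝓡 n) M}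
    {z : EuclideanSpace ℝ (Fin n) × EuclideanSpace ℝ (Fin n)} (hz : z ∈ (tchart p).target) :
    (liouville ((tchart p).symm z) : EuclideanSpace ℝ (Fin n) × EuclideanSpace ℝ (Fin n)) =
      dtchartSymm p z (0, z.2) := by
  have hz1 : z.1 ∈ (extChartAt (𝓡 n) p.1).target := by
    rw [tchart_target] at hz; exact hz.1
  let u : ℝ → EuclideanSpace ℝ (Fin n) × EuclideanSpace ℝ (Fin n) := fun s ↦ (z.1, (1 + s) • z.2)
  have hu : HasDerivAt u (0, z.2) 0 := by
    have h1 : HasDerivAt (fun s : ℝ ↦ (1 + s) • z.2) ((1 : ℝ) • z.2) 0 :=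
      ((hasDerivAt_id (0 : ℝ)).const_add 1).smul_const z.2
    rw [one_smul] at h1
    exact (hasDerivAt_const (0 : ℝ) z.1).prodMk h1
  have hu0 : u 0 = z := by simp [u]
  have h1 : HasMFDerivAt 𝓘(ℝ, EuclideanSpace ℝ (Fin n) × EuclideanSpace ℝ (Fin n)) (𝓡 n).tangent
      (tchart p).symm (u 0) (dtchartSymm p z) := by
    rw [hu0]; exact hasMFDerivAt_tchart_symm hz
  have h2 := HasMFDerivAt.comp (0 : ℝ) h1 hu.hasFDerivAt.hasMFDerivAt
  have h3 : (fun s : ℝ ↦ (⟨((tchart p).symm z).1, (1 + s) • ((tchart p).symm z).2⟩ :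
      TangentBundle (𝓡 n) M)) = (tchart p).symm ∘ u := by
    funext s
    rw [tchart_symm_apply p hz1, Function.comp_apply, tchart_symm_apply p (z := u s) hz1]
    simp only [u, map_smul]
    rfl
  rw [liouville, h3]
  have h4 := congrArg (fun L : ℝ →L[ℝ] EuclideanSpace ℝ (Fin n) × EuclideanSpace ℝ (Fin n) ↦ L 1)
    h2.mfderiv
  refine h4.trans ?_
  change dtchartSymm p z ((ContinuousLinearMap.toSpanSingleton ℝ
    ((0, z.2) : EuclideanSpace ℝ (Fin n) × EuclideanSpace ℝ (Fin n))) 1) = _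
  rw [ContinuousLinearMap.toSpanSingleton_apply, one_smul]

end TangentCharts

/-! ### Homogeneous functions -/

section Euler

variable {E : Type*} [NormedAddCommGroup E] [NormedSpace ℝ E]

/-- Euler's identity for functions that are homogeneous of degree 1 in the second variable. -/
theorem fderiv_radial_of_homogeneous {G : E × E → ℝ} {O : Set (E × E)} (hO : IsOpen O)
    (hG : ContDiffOn ℝ ∞ G O) (hh : ∀ z ∈ O, ∀ s : ℝ, 0 < s → G (z.1, s • z.2) = s * G z)
    {z : E × E} (hz : z ∈ O) : fderiv ℝ G z (0, z.2) = G z := by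
  have hd : DifferentiableAt ℝ G z := (hG.differentiableOn (by simp)).differentiableAt
    (hO.mem_nhds hz)
  have hu : HasDerivAt (fun s : ℝ ↦ (z.1, s • z.2)) ((0 : E), z.2) 1 := by
    have h1 := (hasDerivAt_id (1 : ℝ)).smul_const z.2
    rw [one_smul] at h1
    exact (hasDerivAt_const (1 : ℝ) z.1).prodMk h1
  have h1 : HasDerivAt (fun s : ℝ ↦ G (z.1, s • z.2)) (fderiv ℝ G z (0, z.2)) 1 :=
    hd.hasFDerivAt.comp_hasDerivAt_of_eq 1 hu (by simp)
  have h2 : HasDerivAt (fun s : ℝ ↦ G (z.1, s • z.2)) (G z) 1 := by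
    have h3 := (hasDerivAt_id (1 : ℝ)).mul_const (G z)
    rw [one_mul] at h3
    refine h3.congr_of_eventuallyEq ?_
    filter_upwards [lt_mem_nhds (zero_lt_one' ℝ)] with s hs
    exact hh z hz s hs
  exact h1.unique h2

/-- The derivative of Euler's identity. -/
theorem fderiv_fderiv_radial_of_homogeneous {G : E × E → ℝ} {O : Set (E × E)} (hO : IsOpen O)
    (hG : ContDiffOn ℝ ∞ G O) (hh : ∀ z ∈ O, ∀ s : ℝ, 0 < s → G (z.1, s • z.2) = s * G z)
    {z : E × E} (hz : z ∈ O) (Z : E × E) :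
    fderiv ℝ (fderiv ℝ G) z Z (0, z.2) = fderiv ℝ G z (Z.1, 0) := by
  have hd : DifferentiableAt ℝ G z := (hG.differentiableOn (by simp)).differentiableAt
    (hO.mem_nhds hz)
  have hd2 : DifferentiableAt ℝ (fderiv ℝ G) z :=
    ((hG.contDiffAt (hO.mem_nhds hz)).fderiv_right (m := ∞) (by simp)).differentiableAt (by simp)
  have hv : HasFDerivAt (fun w : E × E ↦ ((0 : E), w.2))
      ((0 : E × E →L[ℝ] E).prod (ContinuousLinearMap.snd ℝ E E)) z :=
    (hasFDerivAt_const (0 : E) z).prodMk hasFDerivAt_snd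
  have h1 := hd2.hasFDerivAt.clm_apply hv
  have h2 : (fun w ↦ fderiv ℝ G w (0, w.2)) =ᶠ[nhds z] G := by
    filter_upwards [hO.mem_nhds hz] with w hw
    exact fderiv_radial_of_homogeneous hO hG hh hw
  have h3 := (hd.hasFDerivAt.congr_of_eventuallyEq h2).unique h1
  have h4 := congrArg (fun L : E × E →L[ℝ] ℝ ↦ L Z) h3
  simp only [add_apply, ContinuousLinearMap.comp_apply, ContinuousLinearMap.flip_apply,
    ContinuousLinearMap.prod_apply, zero_apply, ContinuousLinearMap.coe_snd'] at h4
  have h5 : fderiv ℝ G z Z = fderiv ℝ G z (Z.1, 0) + fderiv ℝ G z (0, Z.2) := by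
    rw [← map_add]; simp
  linarith

theorem snd_fderiv_symm {G : E × E → ℝ} {z : E × E} (hG : ContDiffAt ℝ ∞ G z) (X Y : E × E) :
    fderiv ℝ (fderiv ℝ G) z X Y = fderiv ℝ (fderiv ℝ G) z Y X :=
  (hG.isSymmSndFDerivAt (by
    rw [minSmoothness_of_isRCLikeNormedField]; exact WithTop.coe_le_coe.2 le_top)).eq X Y

/-- The second derivative of the restriction of `G` to a fibre is a block of the second derivative
of `G`. -/
theorem fderiv_fderiv_slice {G : E × E → ℝ} {O : Set (E × E)} (hO : IsOpen O)
    (hG : ContDiffOn ℝ ∞ G O) {x y : E} (hz : (x, y) ∈ O) (w w' : E) :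
    fderiv ℝ (fderiv ℝ fun y ↦ G (x, y)) y w w' =
      fderiv ℝ (fderiv ℝ G) (x, y) (0, w) (0, w') := by
  have hd2 : DifferentiableAt ℝ (fderiv ℝ G) (x, y) :=
    ((hG.contDiffAt (hO.mem_nhds hz)).fderiv_right (m := ∞) (by simp)).differentiableAt (by simp)
  have hi : ∀ y : E, HasFDerivAt (fun y : E ↦ (x, y)) (ContinuousLinearMap.inr ℝ E E) y := fun y ↦
    (hasFDerivAt_const x y).prodMk (hasFDerivAt_id y)
  have h2 : fderiv ℝ (fun y ↦ G (x, y)) =ᶠ[nhds y] fun y ↦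
      (fderiv ℝ G (x, y)).comp (ContinuousLinearMap.inr ℝ E E) := by
    filter_upwards [(hi y).continuousAt.eventually (hO.mem_nhds hz)] with y hy
    exact (HasFDerivAt.comp y ((hG.differentiableOn (by simp)).differentiableAt
      (hO.mem_nhds hy)).hasFDerivAt (hi y)).fderiv
  have h3 := (HasFDerivAt.comp y hd2.hasFDerivAt (hi y)).clm_comp
    (hasFDerivAt_const (ContinuousLinearMap.inr ℝ E E) y)
  rw [h2.fderiv_eq]
  have h4 := congrArg (fun L : E →L[ℝ] E →L[ℝ] ℝ ↦ L w w') h3.fderiv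
  refine h4.trans ?_
  simp

end Euler

/-! ### Hilbert forms in coordinates -/

section HilbertForms

/-- The model vector space. -/
abbrev Vec (n : ℕ) : Type := EuclideanSpace ℝ (Fin n)

variable {n : ℕ} {M : Type*} [TopologicalSpace M] [ChartedSpace (EuclideanSpace ℝ (Fin n)) M]
  [IsManifold (𝓡 n) ∞ M]

/-- The coordinate expression of a function on `TM` in the chart at `p`. -/
noncomputable def funInChart (F : TangentBundle (𝓡 n) M → ℝ) (p : TangentBundle (𝓡 n) M) :
    Vec n × Vec n → ℝ := F ∘ (tchart p).symm

theorem contDiffOn_funInChart {U : Set M} (hU : IsOpen U) {F : TangentBundle (𝓡 n) M → ℝ}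
    (hF : ContMDiffOn (𝓡 n).tangent 𝓘(ℝ, ℝ) ∞ F (slit U)) (p : TangentBundle (𝓡 n) M) :
    ContDiffOn ℝ ∞ (funInChart F p) (slitChart U p) := by
  intro z hz
  have h1 : ContMDiffAt 𝓘(ℝ, Vec n × Vec n) (𝓡 n).tangent ∞ (tchart p).symm z :=
    (contMDiffOn_extChartAt_symm p).contMDiffAt
      ((isOpen_extChartAt_target p).mem_nhds (mem_target_of_mem_slitChart hz))
  have h2 := (hF.contMDiffAt ((isOpen_slit hU).mem_nhds (symm_mem_slit hz))).comp z h1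
  exact (contMDiffAt_iff_contDiffAt.1 h2).contDiffWithinAt

theorem contMDiffOn_of_funInChart {U : Set M} {F : TangentBundle (𝓡 n) M → ℝ}
    (h : ∀ v ∈ slit (n := n) U, ∃ p, v ∈ (tchart p).source ∧
      ContDiffAt ℝ ∞ (funInChart F p) (tchart p v)) :
    ContMDiffOn (𝓡 n).tangent 𝓘(ℝ, ℝ) ∞ F (slit U) := by
  intro v hv
  obtain ⟨p, hp, hc⟩ := h v hv
  have h1 : ContMDiffAt (𝓡 n).tangent 𝓘(ℝ, Vec n × Vec n) ∞ (tchart p) v :=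
    contMDiffAt_extChartAt' (by rwa [tchart, extChartAt_source] at hp)
  have h2 := (contMDiffAt_iff_contDiffAt.2 hc).comp v h1
  refine (h2.congr_of_eventuallyEq ?_).contMDiffWithinAt
  filter_upwards [(isOpen_extChartAt_source p).mem_nhds hp] with w hw
  simp only [Function.comp_apply, funInChart]
  exact congrArg F ((tchart p).left_inv hw).symm

theorem tchart_symm_smul (p : TangentBundle (𝓡 n) M) {z : Vec n × Vec n}
    (hz : z.1 ∈ (extChartAt (𝓡 n) p.1).target) (s : ℝ) :
    (tchart p).symm (z.1, s • z.2) =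
      ⟨((tchart p).symm z).1, s • ((tchart p).symm z).2⟩ := by
  rw [tchart_symm_apply p hz, tchart_symm_apply p (z := (z.1, s • z.2)) hz]
  simp only [map_smul]
  rfl

theorem funInChart_homogeneous {U : Set M} {F : TangentBundle (𝓡 n) M → ℝ}
    (hF : ∀ v ∈ slit (n := n) U, ∀ s : ℝ, 0 < s → F ⟨v.1, s • v.2⟩ = s * F v)
    (p : TangentBundle (𝓡 n) M) :
    ∀ z ∈ slitChart U p, ∀ s : ℝ, 0 < s →
      funInChart F p (z.1, s • z.2) = s * funInChart F p z := by
  intro z hz s hs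
  simp only [funInChart, Function.comp_apply]
  rw [tchart_symm_smul p hz.1]
  exact hF _ (symm_mem_slit hz) s hs

/-- In charts, the Hilbert 1-form is `∂F/∂y^i dx^i`. -/
theorem formInChart_hilbertOneForm {U : Set M} (hU : IsOpen U) {F : TangentBundle (𝓡 n) M → ℝ}
    (hF : ContMDiffOn (𝓡 n).tangent 𝓘(ℝ, ℝ) ∞ F (slit U)) {p : TangentBundle (𝓡 n) M}
    {z : Vec n × Vec n} (hz : z ∈ slitChart U p) (X : Vec n × Vec n) :
    formInChart (𝓡 n).tangent (hilbertOneForm F) p z ![X] =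
      fderiv ℝ (funInChart F p) z (0, X.1) := by
  have hd : DifferentiableAt ℝ (funInChart F p) z :=
    ((contDiffOn_funInChart hU hF p).differentiableOn (by simp)).differentiableAt
      ((isOpen_slitChart hU p).mem_nhds hz)
  have hA := fun y ↦ dchart_dchartSymm (n := n) hz.1 y
  have h1 : (fun y : Vec n ↦ F ⟨((tchart p).symm z).1, y⟩) =
      fun y ↦ funInChart F p (z.1, dchart p.1 ((extChartAt (𝓡 n) p.1).symm z.1) y) := by
    funext y
    have h3 := dchartSymm_dchart ((extChartAt (𝓡 n) p.1).map_target hz.1) y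
    rw [(extChartAt (𝓡 n) p.1).right_inv hz.1] at h3
    simp only [funInChart, Function.comp_apply]
    rw [tchart_symm_apply p hz.1, tchart_symm_apply p
      (z := (z.1, dchart p.1 ((extChartAt (𝓡 n) p.1).symm z.1) y)) hz.1]
    exact congrArg (fun y ↦ F ⟨(extChartAt (𝓡 n) p.1).symm z.1, y⟩) h3.symm
  have h2 : HasFDerivAt (fun y : Vec n ↦ (z.1, dchart p.1 ((extChartAt (𝓡 n) p.1).symm z.1) y))
      ((0 : Vec n →L[ℝ] Vec n).prod (dchart p.1 ((extChartAt (𝓡 n) p.1).symm z.1)))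
      (dchartSymm p.1 z.1 z.2) :=
    (hasFDerivAt_const z.1 _).prodMk (ContinuousLinearMap.hasFDerivAt _)
  have hd' : HasFDerivAt (funInChart F p) (fderiv ℝ (funInChart F p) z)
      (z.1, dchart p.1 ((extChartAt (𝓡 n) p.1).symm z.1) (dchartSymm p.1 z.1 z.2)) := by
    rw [hA]; exact hd.hasFDerivAt
  have h3 := (HasFDerivAt.comp (dchartSymm p.1 z.1 z.2) hd' h2).fderiv
  have h4 : ((tchart p).symm z).2 = dchartSymm p.1 z.1 z.2 := by
    rw [tchart_symm_apply p hz.1]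
  have h5 := dproj_dtchartSymm (mem_target_of_mem_slitChart hz) X
  have h6 : (fderiv ℝ (fun y : Vec n ↦ F ⟨((tchart p).symm z).1, y⟩) ((tchart p).symm z).2)
      (dchartSymm p.1 z.1 X.1) = fderiv ℝ (funInChart F p) z (0, X.1) := by
    rw [h1, show fderiv ℝ (fun y ↦ funInChart F p
      (z.1, dchart p.1 ((extChartAt (𝓡 n) p.1).symm z.1) y)) ((tchart p).symm z).2 = _ from
      (congrArg _ h4).trans h3]
    rw [ContinuousLinearMap.comp_apply, ContinuousLinearMap.prod_apply, hA]
    rfl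
  exact (congrArg _ h5).trans h6

theorem smoothFormOn_hilbertOneForm {U : Set M} (hU : IsOpen U) {F : TangentBundle (𝓡 n) M → ℝ}
    (hF : ContMDiffOn (𝓡 n).tangent 𝓘(ℝ, ℝ) ∞ F (slit U)) :
    SmoothFormOn (𝓡 n).tangent (slit U) (hilbertOneForm F) := by
  intro p v hv hvU
  have hO := isOpen_slitChart hU p
  have hz := tchart_mem_slitChart hv hvU
  have hs : ContDiffOn ℝ ∞ (formInChart (𝓡 n).tangent (hilbertOneForm F) p) (slitChart U p) := by
    refine contDiffOn_alternating_of_apply fun m ↦ ?_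
    have hm : m = ![m 0] := by ext i : 1; fin_cases i; rfl
    have h1 : ContDiffOn ℝ ∞ (fun z ↦ fderiv ℝ (funInChart F p) z (0, (m 0).1))
        (slitChart U p) :=
      ((contDiffOn_funInChart hU hF p).fderiv_of_isOpen (m := ∞) hO (by simp)).clm_apply
        contDiffOn_const
    refine h1.congr fun z hz ↦ ?_
    rw [hm]
    exact formInChart_hilbertOneForm hU hF hz (m 0)
  exact hs.contDiffAt (hO.mem_nhds hz)

/-- The Hilbert 2-form of `F`. -/
noncomputable def hilbertTwoForm (F : TangentBundle (𝓡 n) M → ℝ) :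
    DForm (𝓡 n).tangent (TangentBundle (𝓡 n) M) 2 :=
  extDerivForm (𝓡 n).tangent (hilbertOneForm F)

theorem extDeriv_hilbertOneForm {U : Set M} (hU : IsOpen U) {F : TangentBundle (𝓡 n) M → ℝ}
    (hF : ContMDiffOn (𝓡 n).tangent 𝓘(ℝ, ℝ) ∞ F (slit U)) {p : TangentBundle (𝓡 n) M}
    {z : Vec n × Vec n} (hz : z ∈ slitChart U p) (X Y : Vec n × Vec n) :
    extDeriv (formInChart (𝓡 n).tangent (hilbertOneForm F) p) z ![X, Y] =
      fderiv ℝ (fderiv ℝ (funInChart F p)) z X (0, Y.1) -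
        fderiv ℝ (fderiv ℝ (funInChart F p)) z Y (0, X.1) := by
  have hO := isOpen_slitChart hU p
  have hz' := mem_target_of_mem_slitChart hz
  have hd2 : DifferentiableAt ℝ (fderiv ℝ (funInChart F p)) z :=
    (((contDiffOn_funInChart hU hF p).contDiffAt (hO.mem_nhds hz)).fderiv_right (m := ∞)
      (by simp)).differentiableAt (by simp)
  have hs : DifferentiableAt ℝ (formInChart (𝓡 n).tangent (hilbertOneForm F) p) z := by
    have h1 := smoothFormOn_hilbertOneForm hU hF p _ ((tchart p).map_target hz')
      (symm_mem_slit hz)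
    have h2 : tchart p ((tchart p).symm z) = z := (tchart p).right_inv hz'
    rw [h2] at h1
    exact h1.differentiableAt (by simp)
  have key : ∀ X Y : Vec n × Vec n,
      fderiv ℝ (formInChart (𝓡 n).tangent (hilbertOneForm F) p) z X ![Y] =
        fderiv ℝ (fderiv ℝ (funInChart F p)) z X (0, Y.1) := by
    intro X Y
    rw [← fderiv_continuousAlternatingMap_apply_const_apply hs]
    have h3 : (fun z ↦ formInChart (𝓡 n).tangent (hilbertOneForm F) p z ![Y]) =ᶠ[nhds z]
        fun z ↦ fderiv ℝ (funInChart F p) z (0, Y.1) := by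
      filter_upwards [hO.mem_nhds hz] with w hw
      exact formInChart_hilbertOneForm hU hF hw Y
    rw [h3.fderiv_eq]
    have h4 := hd2.hasFDerivAt.clm_apply (hasFDerivAt_const ((0 : Vec n), Y.1) z)
    rw [h4.fderiv]
    simp
  rw [extDeriv_apply_pair, key, key]

theorem formInChart_hilbertTwoForm {U : Set M} (hU : IsOpen U) {F : TangentBundle (𝓡 n) M → ℝ}
    (hF : ContMDiffOn (𝓡 n).tangent 𝓘(ℝ, ℝ) ∞ F (slit U)) {p : TangentBundle (𝓡 n) M}
    {z : Vec n × Vec n} (hz : z ∈ slitChart U p) :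
    formInChart (𝓡 n).tangent (hilbertTwoForm F) p z =
      extDeriv (formInChart (𝓡 n).tangent (hilbertOneForm F) p) z := by
  have hz' := mem_target_of_mem_slitChart hz
  have h1 := formInChart_extDerivForm (smoothFormOn_hilbertOneForm hU hF)
    ((tchart p).map_target hz') (symm_mem_slit hz)
  have h2 : extChartAt (𝓡 n).tangent p ((tchart p).symm z) = z := (tchart p).right_inv hz'
  rw [h2] at h1
  exact h1

/-- In charts, the Hilbert 2-form is `d(∂F/∂y^i) ∧ dx^i`. -/
theorem formInChart_hilbertTwoForm_apply {U : Set M} (hU : IsOpen U)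
    {F : TangentBundle (𝓡 n) M → ℝ}
    (hF : ContMDiffOn (𝓡 n).tangent 𝓘(ℝ, ℝ) ∞ F (slit U)) {p : TangentBundle (𝓡 n) M}
    {z : Vec n × Vec n} (hz : z ∈ slitChart U p) (X Y : Vec n × Vec n) :
    formInChart (𝓡 n).tangent (hilbertTwoForm F) p z ![X, Y] =
      fderiv ℝ (fderiv ℝ (funInChart F p)) z X (0, Y.1) -
        fderiv ℝ (fderiv ℝ (funInChart F p)) z Y (0, X.1) := by
  rw [formInChart_hilbertTwoForm hU hF hz, extDeriv_hilbertOneForm hU hF hz]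

theorem tchart_symm_self (v : TangentBundle (𝓡 n) M) (y : Vec n) :
    (tchart v).symm (extChartAt (𝓡 n) v.1 v.1, y) = ⟨v.1, y⟩ := by
  have h1 : (⟨v.1, y⟩ : TangentBundle (𝓡 n) M) ∈ (tchart v).source := by
    rw [tchart_source]; exact mem_extChartAt_source v.1
  have h2 := (tchart v).left_inv h1
  rw [tchart_apply v ⟨v.1, y⟩ (mem_extChartAt_source v.1)] at h2
  rw [← h2]
  exact congrArg (fun y ↦ (tchart v).symm (extChartAt (𝓡 n) v.1 v.1, y)) (dchart_self v.1 y).symm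

/-- In the preferred chart at `v`, the fibre Hessian is a block of the Hessian. -/
theorem fibreHessian_eq {U : Set M} (hU : IsOpen U) {F : TangentBundle (𝓡 n) M → ℝ}
    (hF : ContMDiffOn (𝓡 n).tangent 𝓘(ℝ, ℝ) ∞ F (slit U)) {v : TangentBundle (𝓡 n) M}
    (hv : v ∈ slit U) (w w' : Vec n) :
    fibreHessian F v w w' =
      fderiv ℝ (fderiv ℝ (funInChart F v)) (tchart v v) (0, w) (0, w') := by
  have hO := isOpen_slitChart hU v
  have hz : tchart v v ∈ slitChart U v := tchart_mem_slitChart (mem_extChartAt_source v) hv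
  rw [tchart_self] at hz ⊢
  have h1 : (fun y : Vec n ↦ F ⟨v.1, y⟩) =
      fun y ↦ funInChart F v (extChartAt (𝓡 n) v.1 v.1, y) := by
    funext y
    simp only [funInChart, Function.comp_apply]
    exact congrArg F (tchart_symm_self v y).symm
  refine Eq.trans ?_ (fderiv_fderiv_slice hO (contDiffOn_funInChart hU hF v) hz w w')
  rw [← h1]
  rfl

end HilbertForms

/-! ### Vector fields and Lie brackets in coordinates -/

section Fields

variable {E : Type*} [NormedAddCommGroup E] [NormedSpace ℝ E]
  {H : Type*} [TopologicalSpace H] {I : ModelWithCorners ℝ E H} [I.Boundaryless]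
  {N : Type*} [TopologicalSpace N] [ChartedSpace H N] [IsManifold I ∞ N]

/-- The coordinate expression of the vector field `W` in the preferred chart at `p`. -/
noncomputable def fieldInChart (W : ∀ v : N, TangentSpace I v) (p : N) (z : E) : E :=
  (mfderiv I 𝓘(ℝ, E) (extChartAt I p) ((extChartAt I p).symm z) : E →L[ℝ] E)
    (W ((extChartAt I p).symm z))

theorem fieldInChart_extChartAt (W : ∀ v : N, TangentSpace I v) {p v : N}
    (hv : v ∈ (extChartAt I p).source) :
    fieldInChart W p (extChartAt I p v) =
      (mfderiv I 𝓘(ℝ, E) (extChartAt I p) v : E →L[ℝ] E) (W v) := by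
  have h := (extChartAt I p).left_inv hv
  exact congrArg (fun w ↦ (mfderiv I 𝓘(ℝ, E) (extChartAt I p) w : E →L[ℝ] E) (W w)) h

theorem fieldInChart_self (W : ∀ v : N, TangentSpace I v) (v : N) :
    fieldInChart W v (extChartAt I v v) = W v :=
  (fieldInChart_extChartAt W (mem_extChartAt_source v)).trans (mfderiv_extChartAt_self_apply v _)

theorem extChartAt_tangent_apply (p v : TangentBundle I N)
    (hv : v.1 ∈ (extChartAt I p.1).source) :
    extChartAt I.tangent p v = (extChartAt I p.1 v.1,
      (mfderiv I 𝓘(ℝ, E) (extChartAt I p.1) v.1 : E →L[ℝ] E) v.2) := by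
  have hd : MDifferentiableAt I 𝓘(ℝ, E) (extChartAt I p.1) v.1 :=
    mdifferentiableAt_extChartAt (by rwa [extChartAt_source] at hv)
  have h1 : extChartAt I.tangent p v = (extChartAt I p.1 v.1,
      (trivializationAt E (TangentSpace I) p.1 v).2) := by
    rw [FiberBundle.extChartAt]; rfl
  rw [h1, MDifferentiableAt.mfderiv hd, TangentBundle.trivializationAt_apply]
  rfl

theorem contDiffAt_fieldInChart {W : ∀ v : N, TangentSpace I v} {p v : N}
    (hW : ContMDiffAt I I.tangent ∞ (fun v ↦ (⟨v, W v⟩ : TangentBundle I N)) v)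
    (hv : v ∈ (extChartAt I p).source) :
    ContDiffAt ℝ ∞ (fieldInChart W p) (extChartAt I p v) := by
  let P : TangentBundle I N := ⟨p, 0⟩
  have h2 : (extChartAt I p).symm (extChartAt I p v) = v := (extChartAt I p).left_inv hv
  have h1 : ContMDiffAt 𝓘(ℝ, E) I ∞ (extChartAt I p).symm (extChartAt I p v) :=
    (contMDiffOn_extChartAt_symm p).contMDiffAt
      ((isOpen_extChartAt_target p).mem_nhds ((extChartAt I p).map_source hv))
  have hvs : (⟨v, W v⟩ : TangentBundle I N) ∈ (chartAt (ModelProd H E) P).source := by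
    rw [TangentBundle.mem_chart_source_iff]
    rwa [extChartAt_source] at hv
  have h3 : ContMDiffAt I.tangent 𝓘(ℝ, E × E) ∞ (extChartAt I.tangent P)
      (⟨v, W v⟩ : TangentBundle I N) := contMDiffAt_extChartAt' hvs
  have h4 : ContMDiffAt I 𝓘(ℝ, E × E) ∞
      (fun v ↦ extChartAt I.tangent P (⟨v, W v⟩ : TangentBundle I N)) v := h3.comp v hW
  rw [← h2] at h4
  have h5 := contMDiffAt_iff_contDiffAt.1 (h4.comp (extChartAt I p v) h1)
  refine (contDiff_snd.contDiffAt.comp _ h5).congr_of_eventuallyEq ?_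
  filter_upwards [(isOpen_extChartAt_target (I := I) p).mem_nhds
    ((extChartAt I p).map_source hv)] with z hz
  simp only [Function.comp_apply]
  rw [extChartAt_tangent_apply P _ ((extChartAt I p).map_target hz)]
  rfl

theorem hasDerivAt_of_hasFDerivAt_comp {F : Type*} [NormedAddCommGroup F] [NormedSpace ℝ F]
    {u : ℝ → F} {t : ℝ} {A : E →L[ℝ] F} {X : E}
    (h : HasFDerivAt u (A.comp ((1 : ℝ →L[ℝ] ℝ).smulRight X)) t) : HasDerivAt u (A X) t := by
  simpa using h.hasDerivAt

theorem hasDerivAt_extChartAt_comp {γ : ℝ → N} {t : ℝ} {X : TangentSpace I (γ t)} {p : N}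
    (hγ : HasMFDerivAt 𝓘(ℝ, ℝ) I γ t ((1 : ℝ →L[ℝ] ℝ).smulRight X))
    (hp : γ t ∈ (extChartAt I p).source) :
    HasDerivAt (fun t ↦ extChartAt I p (γ t))
      ((mfderiv I 𝓘(ℝ, E) (extChartAt I p) (γ t) : E →L[ℝ] E) X) t := by
  have hd : MDifferentiableAt I 𝓘(ℝ, E) (extChartAt I p) (γ t) :=
    mdifferentiableAt_extChartAt (by rwa [extChartAt_source] at hp)
  exact hasDerivAt_of_hasFDerivAt_comp (E := E) (F := E) (X := X)
    (A := mfderiv I 𝓘(ℝ, E) (extChartAt I p) (γ t))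
    (HasMFDerivAt.comp t hd.hasMFDerivAt hγ).hasFDerivAt

theorem hasDerivAt_fieldInChart {γ : ℝ → N} {t : ℝ} {W : ∀ v : N, TangentSpace I v} {p : N}
    (hγ : HasMFDerivAt 𝓘(ℝ, ℝ) I γ t ((1 : ℝ →L[ℝ] ℝ).smulRight (W (γ t))))
    (hp : γ t ∈ (extChartAt I p).source) :
    HasDerivAt (fun t ↦ extChartAt I p (γ t)) (fieldInChart W p (extChartAt I p (γ t))) t := by
  rw [fieldInChart_extChartAt W hp]
  exact hasDerivAt_extChartAt_comp hγ hp

theorem hasFDerivWithinAt_smulRight {u : ℝ → E} {t : ℝ} {X : E} (h : HasDerivAt u X t)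
    (s : Set ℝ) : HasFDerivWithinAt u ((1 : ℝ →L[ℝ] ℝ).smulRight X) s t := by
  have h2 : (1 : ℝ →L[ℝ] ℝ).smulRight X = ContinuousLinearMap.toSpanSingleton ℝ X := by
    ext; simp
  rw [h2]
  exact h.hasFDerivAt.hasFDerivWithinAt

theorem hasMFDerivAt_of_hasDerivAt {γ : ℝ → N} {t : ℝ} {X : TangentSpace I (γ t)}
    (hc : ContinuousAt γ t)
    (hd : HasDerivAt (fun s ↦ extChartAt I (γ t) (γ s)) (X : E) t) :
    HasMFDerivAt 𝓘(ℝ, ℝ) I γ t ((1 : ℝ →L[ℝ] ℝ).smulRight X) := by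
  refine ⟨hc, ?_⟩
  exact hasFDerivWithinAt_smulRight hd _

/-- The Lie bracket at `v`, in the preferred chart at `v`. -/
theorem mlieBracket_eq {V W : ∀ v : N, TangentSpace I v} {v : N} {X Y : E}
    (hX : (V v : E) = X) (hY : (W v : E) = Y) :
    @Eq E (VectorField.mlieBracket I V W v)
      (fderiv ℝ (fieldInChart W v) (extChartAt I v v) X -
        fderiv ℝ (fieldInChart V v) (extChartAt I v v) Y) := by
  have hid : (mfderiv I 𝓘(ℝ, E) (extChartAt I v) v : E →L[ℝ] E) = ContinuousLinearMap.id ℝ E :=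
    ContinuousLinearMap.ext (M₁ := E) (M₂ := E) fun X ↦ mfderiv_extChartAt_self_apply v X
  have hpull : ∀ W : (∀ v : N, TangentSpace I v),
      VectorField.mpullbackWithin 𝓘(ℝ, E) I (extChartAt I v).symm W (range I)
        =ᶠ[nhds (extChartAt I v v)] fieldInChart W v := by
    intro W
    filter_upwards [(isOpen_extChartAt_target (I := I) v).mem_nhds (mem_extChartAt_target v)]
      with z hz
    have hs := (extChartAt I v).map_target hz
    have e1 : ∀ X : E, (mfderiv 𝓘(ℝ, E) I (extChartAt I v).symm z : E →L[ℝ] E)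
        ((mfderiv I 𝓘(ℝ, E) (extChartAt I v) ((extChartAt I v).symm z) : E →L[ℝ] E) X) = X := by
      intro X
      have := mfderiv_symm_mfderiv_apply hs X
      rwa [(extChartAt I v).right_inv hz] at this
    have e2 : ∀ X : E,
        (mfderiv I 𝓘(ℝ, E) (extChartAt I v) ((extChartAt I v).symm z) : E →L[ℝ] E)
        ((mfderiv 𝓘(ℝ, E) I (extChartAt I v).symm z : E →L[ℝ] E) X) = X := by
      intro X
      have := mfderiv_mfderiv_symm_apply hs X
      rwa [(extChartAt I v).right_inv hz] at this
    have h3 : ContinuousLinearMap.inverse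
        (mfderiv 𝓘(ℝ, E) I (extChartAt I v).symm z : E →L[ℝ] E) =
        (mfderiv I 𝓘(ℝ, E) (extChartAt I v) ((extChartAt I v).symm z) : E →L[ℝ] E) :=
      ContinuousLinearMap.inverse_eq (ContinuousLinearMap.ext e1) (ContinuousLinearMap.ext e2)
    rw [VectorField.mpullbackWithin_apply, I.range_eq_univ, mfderivWithin_univ]
    exact congrArg (fun L : E →L[ℝ] E ↦ L (W ((extChartAt I v).symm z))) h3
  let V' : E → E := VectorField.mpullbackWithin 𝓘(ℝ, E) I (extChartAt I v).symm V (range I)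
  let W' : E → E := VectorField.mpullbackWithin 𝓘(ℝ, E) I (extChartAt I v).symm W (range I)
  have hV : V' =ᶠ[nhds (extChartAt I v v)] fieldInChart V v := hpull V
  have hW : W' =ᶠ[nhds (extChartAt I v v)] fieldInChart W v := hpull W
  have h1 : @Eq E (VectorField.mlieBracket I V W v) ((ContinuousLinearMap.inverse
      (mfderiv I 𝓘(ℝ, E) (extChartAt I v) v : E →L[ℝ] E) : E →L[ℝ] E)
      (VectorField.lieBracketWithin ℝ V' W' ((extChartAt I v).symm ⁻¹' univ ∩ range I)
        (extChartAt I v v))) := rfl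
  have h2 : @Eq E (VectorField.mlieBracket I V W v) ((ContinuousLinearMap.inverse
      (ContinuousLinearMap.id ℝ E) : E →L[ℝ] E)
      (VectorField.lieBracketWithin ℝ V' W' ((extChartAt I v).symm ⁻¹' univ ∩ range I)
        (extChartAt I v v))) :=
    h1.trans (congrArg (fun L : E →L[ℝ] E ↦ (ContinuousLinearMap.inverse L : E →L[ℝ] E)
      (VectorField.lieBracketWithin ℝ V' W' ((extChartAt I v).symm ⁻¹' univ ∩ range I)
        (extChartAt I v v))) hid)
  refine h2.trans ?_
  rw [ContinuousLinearMap.inverse_id, ContinuousLinearMap.id_apply,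
    VectorField.lieBracketWithin, I.range_eq_univ, preimage_univ, univ_inter, fderivWithin_univ,
    fderivWithin_univ, hV.fderiv_eq, hW.fderiv_eq, hV.self_of_nhds, hW.self_of_nhds,
    show fieldInChart V v (extChartAt I v v) = X from (fieldInChart_self V v).trans hX,
    show fieldInChart W v (extChartAt I v v) = Y from (fieldInChart_self W v).trans hY]

end Fields

/-! ### Sprays in coordinates -/

section SprayCoordinates

variable {n : ℕ} {M : Type*} [TopologicalSpace M] [ChartedSpace (EuclideanSpace ℝ (Fin n)) M]
  [IsManifold (𝓡 n) ∞ M]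

/-- The value of a vector field on `TM`, as a pair of vectors. -/
def fieldVal (W : VField n M) (v : TangentBundle (𝓡 n) M) : Vec n × Vec n := W v

theorem tangentBundle_ext {x x' : M} {y y' : Vec n} (hx : x = x') (hy : y = y') :
    (⟨x, y⟩ : TangentBundle (𝓡 n) M) = ⟨x', y'⟩ := by
  subst hx hy; rfl

theorem tchart_symm_tchart_self (v : TangentBundle (𝓡 n) M) : (tchart v).symm (tchart v v) = v :=
  (tchart v).left_inv (mem_extChartAt_source v)

theorem tchart_self_mem_slitChart {U : Set M} {v : TangentBundle (𝓡 n) M} (hv : v ∈ slit U) :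
    tchart v v ∈ slitChart U v := tchart_mem_slitChart (mem_extChartAt_source v) hv

theorem dproj_apply (v : TangentBundle (𝓡 n) M) (X : Vec n × Vec n) :
    (dproj v : Vec n × Vec n →L[ℝ] Vec n) X = X.1 := by
  have h1 := dproj_dtchartSymm (mem_extChartAt_target (I := (𝓡 n).tangent) v) X
  have h2 : (dproj ((tchart v).symm (tchart v v)) : Vec n × Vec n →L[ℝ] Vec n)
      (dtchartSymm v (tchart v v) X) = X.1 := by
    refine h1.trans ?_
    refine (congrArg (fun x ↦ dchartSymm v.1 x X.1) (congrArg Prod.fst (tchart_self v))).trans ?_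
    exact mfderiv_extChartAt_symm_self v.1 X.1
  rw [dtchartSymm_self] at h2
  refine Eq.trans ?_ h2
  exact congrArg (fun w ↦ (dproj w : Vec n × Vec n →L[ℝ] Vec n) X) (tchart_symm_tchart_self v).symm

theorem fieldVal_liouville (v : TangentBundle (𝓡 n) M) :
    fieldVal liouville v = (0, v.2) := by
  have h1 := liouville_tchart_symm (mem_extChartAt_target (I := (𝓡 n).tangent) v)
  have h2 : fieldVal liouville ((tchart v).symm (tchart v v)) = (0, v.2) := by
    refine h1.trans ((dtchartSymm_self v _).trans ?_)
    exact congrArg (fun z : Vec n × Vec n ↦ ((0 : Vec n), z.2)) (tchart_self v)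
  rwa [tchart_symm_tchart_self] at h2

theorem dtchartSymm_fieldInChart (W : VField n M) {p : TangentBundle (𝓡 n) M}
    {z : Vec n × Vec n} (hz : z ∈ (tchart p).target) :
    dtchartSymm p z (fieldInChart W p z) = fieldVal W ((tchart p).symm z) := by
  have h1 := mfderiv_symm_mfderiv_apply (I := (𝓡 n).tangent) ((tchart p).map_target hz)
    (fieldVal W ((tchart p).symm z))
  have h2 : extChartAt (𝓡 n).tangent p ((tchart p).symm z) = z := (tchart p).right_inv hz
  rw [h2] at h1
  exact h1

theorem dtchartSymm_injective {p : TangentBundle (𝓡 n) M}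
    {z : Vec n × Vec n} (hz : z ∈ (tchart p).target) : Function.Injective (dtchartSymm p z) := by
  intro X Y h
  have h1 := fun X ↦ mfderiv_mfderiv_symm_apply (I := (𝓡 n).tangent) ((tchart p).map_target hz) X
  have h2 : extChartAt (𝓡 n).tangent p ((tchart p).symm z) = z := (tchart p).right_inv hz
  rw [h2] at h1
  exact (h1 X).symm.trans ((congrArg _ h).trans (h1 Y))

theorem dtchartSymm_surjective {p : TangentBundle (𝓡 n) M}
    {z : Vec n × Vec n} (hz : z ∈ (tchart p).target) : Function.Surjective (dtchartSymm p z) := by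
  intro X
  have h1 := mfderiv_symm_mfderiv_apply (I := (𝓡 n).tangent) ((tchart p).map_target hz) X
  have h2 : extChartAt (𝓡 n).tangent p ((tchart p).symm z) = z := (tchart p).right_inv hz
  rw [h2] at h1
  exact ⟨_, h1⟩

theorem fieldInChart_liouville {p : TangentBundle (𝓡 n) M}
    {z : Vec n × Vec n} (hz : z ∈ (tchart p).target) :
    fieldInChart (liouville : VField n M) p z = (0, z.2) :=
  dtchartSymm_injective hz ((dtchartSymm_fieldInChart liouville hz).trans
    (liouville_tchart_symm hz))

theorem IsSpray.mono {U V : Set M} (h : V ⊆ U) {Γ : VField n M} (hΓ : IsSpray U Γ) :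
    IsSpray V Γ :=
  ⟨hΓ.smooth.mono fun _ hv ↦ ⟨h hv.1, hv.2⟩, fun v hv ↦ hΓ.secondOrder v ⟨h hv.1, hv.2⟩,
    fun v hv ↦ hΓ.homogeneous v ⟨h hv.1, hv.2⟩⟩

theorem IsSpray.fst {U : Set M} {Γ : VField n M} (hΓ : IsSpray U Γ)
    {v : TangentBundle (𝓡 n) M} (hv : v ∈ slit U) : (fieldVal Γ v).1 = v.2 :=
  (dproj_apply v (fieldVal Γ v)).symm.trans (hΓ.secondOrder v hv)

theorem IsSpray.fieldInChart_fst {U : Set M} {Γ : VField n M} (hΓ : IsSpray U Γ)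
    {p : TangentBundle (𝓡 n) M} {z : Vec n × Vec n} (hz : z ∈ slitChart U p) :
    (fieldInChart Γ p z).1 = z.2 := by
  have hz' := mem_target_of_mem_slitChart hz
  have h1 := dproj_dtchartSymm hz' (fieldInChart Γ p z)
  rw [dtchartSymm_fieldInChart Γ hz'] at h1
  have h2 : ((tchart p).symm z).2 = dchartSymm p.1 z.1 z.2 := by rw [tchart_symm_apply p hz.1]
  have h3 : dchartSymm p.1 z.1 (fieldInChart Γ p z).1 = dchartSymm p.1 z.1 z.2 :=
    h1.symm.trans ((dproj_apply _ _).trans ((hΓ.fst (symm_mem_slit hz)).trans h2))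
  have h4 := congrArg (dchart p.1 ((extChartAt (𝓡 n) p.1).symm z.1)) h3
  rwa [dchart_dchartSymm hz.1, dchart_dchartSymm hz.1] at h4

theorem IsSpray.contDiffOn_fieldInChart {U : Set M} (hU : IsOpen U) {Γ : VField n M}
    (hΓ : IsSpray U Γ) (p : TangentBundle (𝓡 n) M) :
    ContDiffOn ℝ ∞ (fieldInChart Γ p) (slitChart U p) := by
  intro z hz
  have hz' := mem_target_of_mem_slitChart hz
  have h1 := contDiffAt_fieldInChart
    (hΓ.smooth.contMDiffAt ((isOpen_slit hU).mem_nhds (symm_mem_slit hz)))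
    ((tchart p).map_target hz')
  have h2 : extChartAt (𝓡 n).tangent p ((tchart p).symm z) = z := (tchart p).right_inv hz'
  rw [h2] at h1
  exact h1.contDiffWithinAt

/-- The infinitesimal form, in the preferred chart at `v`, of the homogeneity of a spray. -/
theorem IsSpray.fderiv_radial {U : Set M} {Γ : VField n M}
    (hΓ : IsSpray U Γ) {v : TangentBundle (𝓡 n) M} (hv : v ∈ slit U) :
    (fderiv ℝ (fieldInChart Γ v) (tchart v v) (0, v.2)).2 = (2 : ℝ) • (fieldVal Γ v).2 := by
  have h1 := mlieBracket_eq (I := (𝓡 n).tangent) (V := liouville) (W := Γ) (v := v)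
    (fieldVal_liouville v) (rfl : (Γ v : Vec n × Vec n) = fieldVal Γ v)
  have h2 : fieldVal Γ v = fderiv ℝ (fieldInChart Γ v) (tchart v v) (0, v.2) -
      fderiv ℝ (fieldInChart liouville v) (tchart v v) (fieldVal Γ v) :=
    (hΓ.homogeneous v hv).symm.trans h1
  have h3 : fieldInChart (liouville : VField n M) v =ᶠ[nhds (tchart v v)]
      fun z ↦ ((0 : Vec n), z.2) := by
    filter_upwards [(isOpen_extChartAt_target (I := (𝓡 n).tangent) v).mem_nhds
      (mem_extChartAt_target v)] with z hz
    exact fieldInChart_liouville hz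
  have h4 : HasFDerivAt (fun z : Vec n × Vec n ↦ ((0 : Vec n), z.2))
      ((0 : Vec n × Vec n →L[ℝ] Vec n).prod (ContinuousLinearMap.snd ℝ (Vec n) (Vec n)))
      (tchart v v) := (hasFDerivAt_const (0 : Vec n) _).prodMk hasFDerivAt_snd
  rw [h3.fderiv_eq, h4.fderiv] at h2
  have h5 := congrArg Prod.snd h2
  simp only [Prod.snd_sub, ContinuousLinearMap.prod_apply, ContinuousLinearMap.coe_snd'] at h5
  rw [two_smul]
  exact (eq_add_of_sub_eq h5.symm)

/-- The homogeneity of sprays: `G(x, s y) = s² G(x, y)`. -/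
theorem IsSpray.snd_smul {U : Set M} (hU : IsOpen U) {Γ : VField n M}
    (hΓ : IsSpray U Γ) {v : TangentBundle (𝓡 n) M} (hv : v ∈ slit U) {s : ℝ} (hs : 0 < s) :
    (fieldVal Γ ⟨v.1, s • v.2⟩).2 = s ^ 2 • (fieldVal Γ v).2 := by
  let x : Vec n := extChartAt (𝓡 n) v.1 v.1
  let y : Vec n := v.2
  have hw : ∀ r : ℝ, 0 < r → (⟨v.1, r • v.2⟩ : TangentBundle (𝓡 n) M) ∈ slit U := fun r hr ↦
    ⟨hv.1, smul_ne_zero hr.ne' hv.2⟩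
  let g : ℝ → Vec n := fun r ↦ (fieldInChart Γ v (x, r • y)).2
  have hg : ∀ r : ℝ, 0 < r → g r = (fieldVal Γ ⟨v.1, r • v.2⟩).2 := by
    intro r _
    have h1 : fieldInChart Γ ⟨v.1, r • v.2⟩ (tchart ⟨v.1, r • v.2⟩ ⟨v.1, r • v.2⟩) =
      fieldVal Γ ⟨v.1, r • v.2⟩ := fieldInChart_self Γ ⟨v.1, r • v.2⟩
    rw [tchart_self] at h1
    exact congrArg Prod.snd h1
  have hgd : ∀ r : ℝ, 0 < r → HasDerivAt g ((2 / r) • g r) r := by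
    intro r hr
    have h1 := hΓ.fderiv_radial (hw r hr)
    rw [tchart_self, ← hg r hr] at h1
    have hz : (x, r • y) ∈ slitChart U v := by
      have := tchart_self_mem_slitChart (hw r hr)
      rw [tchart_self] at this
      exact this
    have hd := ((hΓ.contDiffOn_fieldInChart hU v).differentiableOn (by simp)).differentiableAt
      ((isOpen_slitChart hU v).mem_nhds hz)
    have hu : HasDerivAt (fun r : ℝ ↦ (x, r • y)) ((0 : Vec n), y) r := by
      have h2 := (hasDerivAt_id r).smul_const y
      rw [one_smul] at h2
      exact (hasDerivAt_const r x).prodMk h2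
    have h3 : HasDerivAt (fun r ↦ fieldInChart Γ v (x, r • y))
        (fderiv ℝ (fieldInChart Γ v) (x, r • y) (0, y)) r := by
      have hd' : HasFDerivAt (fieldInChart Γ v) (fderiv ℝ (fieldInChart Γ v) (x, r • y))
        (x, r • y) := hd.hasFDerivAt
      exact hd'.comp_hasDerivAt r hu
    have h4 : HasDerivAt g (fderiv ℝ (fieldInChart Γ v) (x, r • y) (0, y)).2 r := h3.snd
    have h5 : (fderiv ℝ (fieldInChart Γ v) (x, r • y) (0, r • y)).2 = (2 : ℝ) • g r := h1
    have h6 : ((0 : Vec n), r • y) = r • ((0 : Vec n), y) := by simp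
    rw [h6, map_smul, Prod.smul_snd] at h5
    refine h4.congr_deriv ?_
    rw [div_eq_inv_mul, mul_smul, ← h5, smul_smul, inv_mul_cancel₀ hr.ne', one_smul]
  have hconst : ∀ r ∈ Ioi (0 : ℝ), HasDerivAt (fun r ↦ (r ^ 2)⁻¹ • g r) 0 r := by
    intro r hr
    have hr0 : (0 : ℝ) < r := hr
    have h1 := ((hasDerivAt_pow 2 r).inv (pow_ne_zero 2 hr0.ne')).smul (hgd r hr)
    refine h1.congr_deriv ?_
    simp only [Pi.inv_apply]
    rw [smul_smul, ← add_smul]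
    convert zero_smul ℝ (g r) using 2
    field_simp
    simp
    ring
  have h1 := isOpen_Ioi.is_const_of_deriv_eq_zero isPreconnected_Ioi
    (fun r hr ↦ (hconst r hr).differentiableAt.differentiableWithinAt)
    (fun r hr ↦ (hconst r hr).deriv) (mem_Ioi.2 hs) (mem_Ioi.2 one_pos)
  simp only [one_pow, inv_one, one_smul] at h1
  rw [hg s hs, hg 1 one_pos] at h1
  have h2 : (fieldVal Γ ⟨v.1, (1 : ℝ) • v.2⟩).2 = (fieldVal Γ v).2 := by rw [one_smul]
  rw [h2] at h1
  rw [← h1, smul_smul, mul_inv_cancel₀ (pow_ne_zero 2 hs.ne'), one_smul]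

end SprayCoordinates

/-! ### Reparametrizations of intervals -/

section RealReparametrization

theorem hasDerivAt_primitive {J : Set ℝ} (hJ : IsOpen J) (hJc : J.OrdConnected) {f : ℝ → ℝ}
    (hf : ContinuousOn f J) {t₀ t : ℝ} (ht₀ : t₀ ∈ J) (ht : t ∈ J) :
    HasDerivAt (fun t ↦ ∫ r in t₀..t, f r) (f t) t := by
  have hsub : uIcc t₀ t ⊆ J := hJc.uIcc_subset ht₀ ht
  exact intervalIntegral.integral_hasDerivAt_right ((hf.mono hsub).intervalIntegrable)
    (hf.stronglyMeasurableAtFilter hJ t ht) (hf.continuousAt (hJ.mem_nhds ht))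

/-- The inverse `φ` of a primitive of `1 / ρ`, where `ρ > 0`, solves `φ' = ρ ∘ φ`. -/
theorem exists_reparametrization {J : Set ℝ} (hJ : IsOpen J) (hJc : J.OrdConnected) {ρ : ℝ → ℝ}
    (hρ : ContDiffOn ℝ ∞ ρ J) (hpos : ∀ t ∈ J, 0 < ρ t) :
    ∃ (φ : ℝ → ℝ) (J' : Set ℝ), IsOpen J' ∧ J'.OrdConnected ∧ ContDiffOn ℝ ∞ φ J' ∧
      φ '' J' = J ∧ ∀ s ∈ J', HasDerivAt φ (ρ (φ s)) s := by
  rcases J.eq_empty_or_nonempty with rfl | ⟨t₀, ht₀⟩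
  · exact ⟨id, ∅, isOpen_empty, ordConnected_empty, contDiffOn_id, by simp, by simp⟩
  let ψ : ℝ → ℝ := fun t ↦ ∫ r in t₀..t, (ρ r)⁻¹
  have hinv : ContDiffOn ℝ ∞ (fun t ↦ (ρ t)⁻¹) J := hρ.inv fun t ht ↦ (hpos t ht).ne'
  have hψ : ∀ t ∈ J, HasDerivAt ψ (ρ t)⁻¹ t := fun t ht ↦
    hasDerivAt_primitive hJ hJc hinv.continuousOn ht₀ ht
  have hψs : ∀ t ∈ J, HasStrictDerivAt ψ (ρ t)⁻¹ t := fun t ht ↦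
    hasStrictDerivAt_of_hasDerivAt_of_continuousAt
      (Filter.eventually_of_mem (hJ.mem_nhds ht) hψ)
      (hinv.continuousOn.continuousAt (hJ.mem_nhds ht))
  have hψc : ContinuousOn ψ J := fun t ht ↦ (hψ t ht).continuousAt.continuousWithinAt
  have hmono : StrictMonoOn ψ J := by
    refine strictMonoOn_of_deriv_pos hJc.convex hψc fun t ht ↦ ?_
    rw [hJ.interior_eq] at ht
    rw [(hψ t ht).deriv]
    exact inv_pos.2 (hpos t ht)
  have hinj := hmono.injOn
  let φ : ℝ → ℝ := Function.invFunOn ψ J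
  have hφψ : ∀ t ∈ J, φ (ψ t) = t := fun t ht ↦ hinj.leftInvOn_invFunOn ht
  have himg : ∀ t ∈ J, ∀ W ∈ nhds t, ψ '' (W ∩ J) ∈ nhds (ψ t) := by
    intro t ht W hW
    rw [← (hψs t ht).map_nhds_eq (inv_pos.2 (hpos t ht)).ne']
    exact Filter.image_mem_map (Filter.inter_mem hW (hJ.mem_nhds ht))
  have hJ' : IsOpen (ψ '' J) := by
    rw [isOpen_iff_mem_nhds]
    rintro _ ⟨t, ht, rfl⟩
    have := himg t ht univ Filter.univ_mem
    rwa [univ_inter] at this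
  have hφd : ∀ s ∈ ψ '' J, HasDerivAt φ (ρ (φ s)) s := by
    rintro _ ⟨t, ht, rfl⟩
    have hc : ContinuousAt φ (ψ t) := by
      rw [ContinuousAt, hφψ t ht]
      intro W hW
      rw [Filter.mem_map]
      filter_upwards [himg t ht W hW]
      rintro _ ⟨r, hr, rfl⟩
      change φ (ψ r) ∈ W
      rw [hφψ r hr.2]
      exact hr.1
    have h1 : HasDerivAt ψ (ρ t)⁻¹ (φ (ψ t)) := by rw [hφψ t ht]; exact hψ t ht
    have h2 := HasDerivAt.of_local_left_inverse hc h1 (inv_pos.2 (hpos t ht)).ne' (by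
      filter_upwards [hJ'.mem_nhds (mem_image_of_mem ψ ht)]
      rintro _ ⟨r, hr, rfl⟩
      rw [hφψ r hr])
    rw [inv_inv] at h2
    rwa [hφψ t ht]
  have hφJ : ∀ s ∈ ψ '' J, φ s ∈ J := by
    rintro _ ⟨t, ht, rfl⟩
    rw [hφψ t ht]; exact ht
  refine ⟨φ, ψ '' J, hJ', (hJc.isPreconnected.image ψ hψc).ordConnected,
    contDiffOn_of_hasDerivAt_comp hJ' hρ hφJ hφd, ?_, hφd⟩
  refine Subset.antisymm (by rintro _ ⟨s, hs, rfl⟩; exact hφJ s hs) fun t ht ↦ ?_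
  exact ⟨ψ t, mem_image_of_mem ψ ht, hφψ t ht⟩

/-- Solution of the equation `φ'' = f(φ) (φ')²` of the reparametrizations of geodesics. -/
theorem exists_reparametrization_second_order {J : Set ℝ} (hJ : IsOpen J) (hJc : J.OrdConnected)
    {f : ℝ → ℝ} (hf : ContDiffOn ℝ ∞ f J) :
    ∃ (φ : ℝ → ℝ) (J' : Set ℝ), IsOpen J' ∧ J'.OrdConnected ∧ ContDiffOn ℝ ∞ φ J' ∧
      (∀ s ∈ J', 0 < deriv φ s) ∧ φ '' J' = J ∧
      ∀ s ∈ J', HasDerivAt φ (deriv φ s) s ∧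
        HasDerivAt (deriv φ) (f (φ s) * deriv φ s ^ 2) s := by
  rcases J.eq_empty_or_nonempty with rfl | ⟨t₀, ht₀⟩
  · exact ⟨id, ∅, isOpen_empty, ordConnected_empty, contDiffOn_id, by simp, by simp, by simp⟩
  let L : ℝ → ℝ := fun t ↦ ∫ r in t₀..t, f r
  have hL : ∀ t ∈ J, HasDerivAt L (f t) t := fun t ht ↦
    hasDerivAt_primitive hJ hJc hf.continuousOn ht₀ ht
  have hLs : ContDiffOn ℝ ∞ L J := by
    refine (contDiffOn_infty_iff_deriv_of_isOpen hJ).2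
      ⟨fun t ht ↦ (hL t ht).differentiableAt.differentiableWithinAt, ?_⟩
    exact hf.congr fun t ht ↦ (hL t ht).deriv
  obtain ⟨φ, J', h1, h2, h3, h4, h5⟩ := exists_reparametrization hJ hJc
    (ρ := fun t ↦ Real.exp (L t))
    hLs.exp fun t _ ↦ Real.exp_pos _
  have hφJ : ∀ s ∈ J', φ s ∈ J := fun s hs ↦ h4 ▸ mem_image_of_mem φ hs
  have hder : ∀ s ∈ J', deriv φ s = Real.exp (L (φ s)) := fun s hs ↦ (h5 s hs).deriv
  refine ⟨φ, J', h1, h2, h3, fun s hs ↦ by rw [hder s hs]; exact Real.exp_pos _, h4,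
    fun s hs ↦ ⟨(h5 s hs).differentiableAt.hasDerivAt, ?_⟩⟩
  have h6 : HasDerivAt (fun s ↦ Real.exp (L (φ s)))
      (Real.exp (L (φ s)) * (f (φ s) * Real.exp (L (φ s)))) s :=
    ((hL _ (hφJ s hs)).comp s (h5 s hs)).exp
  rw [hder s hs]
  refine (h6.congr_of_eventuallyEq ?_).congr_deriv (by ring)
  filter_upwards [h1.mem_nhds hs] with r hr
  exact hder r hr

end RealReparametrization

/-! ### Integral curves of sprays -/

section Geodesics

variable {n : ℕ} {M : Type*} [TopologicalSpace M] [ChartedSpace (EuclideanSpace ℝ (Fin n)) M]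
  [IsManifold (𝓡 n) ∞ M]

theorem continuousAt_of_integralCurve {J : Set ℝ} (hJ : IsOpen J) {Γ : VField n M}
    {γ : ℝ → TangentBundle (𝓡 n) M} (hγ : IsMIntegralCurveOn γ Γ J) {t : ℝ} (ht : t ∈ J) :
    ContinuousAt γ t := (hγ.continuousOn).continuousAt (hJ.mem_nhds ht)

theorem hasMFDerivAt_of_integralCurve {J : Set ℝ} (hJ : IsOpen J) {Γ : VField n M}
    {γ : ℝ → TangentBundle (𝓡 n) M} (hγ : IsMIntegralCurveOn γ Γ J) {t : ℝ} (ht : t ∈ J) :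
    HasMFDerivAt 𝓘(ℝ, ℝ) (𝓡 n).tangent γ t ((1 : ℝ →L[ℝ] ℝ).smulRight (Γ (γ t))) :=
  (hγ t ht).hasMFDerivAt (hJ.mem_nhds ht)

theorem hasDerivAt_tchart_of_integralCurve {J : Set ℝ} (hJ : IsOpen J) {Γ : VField n M}
    {γ : ℝ → TangentBundle (𝓡 n) M} (hγ : IsMIntegralCurveOn γ Γ J) {t : ℝ} (ht : t ∈ J)
    {p : TangentBundle (𝓡 n) M} (hp : γ t ∈ (tchart p).source) :
    HasDerivAt (fun t ↦ tchart p (γ t)) (fieldInChart Γ p (tchart p (γ t))) t :=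
  hasDerivAt_fieldInChart (hasMFDerivAt_of_integralCurve hJ hγ ht) hp

/-- Integral curves of sprays are smooth. -/
theorem contDiffAt_tchart_of_integralCurve {U : Set M} (hU : IsOpen U) {J : Set ℝ}
    (hJ : IsOpen J) {Γ : VField n M} (hΓ : IsSpray U Γ)
    {γ : ℝ → TangentBundle (𝓡 n) M} (hγ : IsMIntegralCurveOn γ Γ J)
    (hγU : ∀ t ∈ J, γ t ∈ slit U) {t : ℝ} (ht : t ∈ J)
    {p : TangentBundle (𝓡 n) M} (hp : γ t ∈ (tchart p).source) :
    ContDiffAt ℝ ∞ (fun t ↦ tchart p (γ t)) t := by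
  have hJ' : IsOpen (J ∩ γ ⁻¹' (tchart p).source) :=
    hγ.continuousOn.isOpen_inter_preimage hJ (isOpen_extChartAt_source p)
  exact (contDiffOn_of_hasDerivAt_comp hJ' (hΓ.contDiffOn_fieldInChart hU p)
    (fun t ht ↦ tchart_mem_slitChart ht.2 (hγU t ht.1))
    (fun t ht ↦ hasDerivAt_tchart_of_integralCurve hJ hγ ht.1 ht.2)).contDiffAt
    (hJ'.mem_nhds ⟨ht, hp⟩)

/-- The lift of a geodesic to an integral curve of the spray is its velocity. -/
theorem velocity_eq_of_integralCurve {U : Set M} {J : Set ℝ}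
    (hJ : IsOpen J) {Γ : VField n M} (hΓ : IsSpray U Γ)
    {γ : ℝ → TangentBundle (𝓡 n) M} (hγ : IsMIntegralCurveOn γ Γ J)
    (hγU : ∀ t ∈ J, γ t ∈ slit U) {c : ℝ → M} (hc : ∀ t ∈ J, (γ t).1 = c t) {t : ℝ} (ht : t ∈ J) :
    velocity c t = γ t := by
  have h1 := HasMFDerivAt.comp t (mdifferentiableAt_proj (γ t)).hasMFDerivAt
    (hasMFDerivAt_of_integralCurve hJ hγ ht)
  have h2 : c =ᶠ[nhds t] (fun w : TangentBundle (𝓡 n) M ↦ w.1) ∘ γ := by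
    filter_upwards [hJ.mem_nhds ht] with s hs
    exact (hc s hs).symm
  have h3 := (h1.congr_of_eventuallyEq h2).mfderiv
  refine (tangentBundle_ext (hc t ht).symm ?_ : _ = (⟨(γ t).1, (γ t).2⟩ : TangentBundle (𝓡 n) M))
  have h4 := congrArg (fun L : ℝ →L[ℝ] Vec n ↦ L 1) h3
  refine h4.trans ?_
  have h5 : ((1 : ℝ →L[ℝ] ℝ).smulRight (fieldVal Γ (γ t))) 1 = fieldVal Γ (γ t) := by simp
  refine (congrArg (dproj (γ t) : Vec n × Vec n →L[ℝ] Vec n) h5).trans ?_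
  exact hΓ.secondOrder _ (hγU t ht)

/-- Integral curves of sprays exist, and stay for a short time in the slit tangent bundle. -/
theorem exists_integralCurve {U : Set M} (hU : IsOpen U) {Γ : VField n M} (hΓ : IsSpray U Γ)
    {v : TangentBundle (𝓡 n) M} (hv : v ∈ slit U) :
    ∃ (γ : ℝ → TangentBundle (𝓡 n) M) (J : Set ℝ), IsOpen J ∧ J.OrdConnected ∧ (0 : ℝ) ∈ J ∧
      γ 0 = v ∧ IsMIntegralCurveOn γ Γ J ∧ ∀ t ∈ J, γ t ∈ slit U := by
  obtain ⟨γ, h0, hγ⟩ := exists_isMIntegralCurveAt_of_contMDiffAt_boundaryless (t₀ := 0)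
    ((hΓ.smooth.contMDiffAt ((isOpen_slit hU).mem_nhds hv)).of_le (by simp))
  obtain ⟨ε, hε, hγε⟩ := isMIntegralCurveAt_iff'.1 hγ
  have hc : ContinuousAt γ 0 := hγ.continuousAt
  have hs : ∀ᶠ t in nhds (0 : ℝ), γ t ∈ slit U :=
    hc.eventually ((isOpen_slit hU).eventually_mem (by rw [h0]; exact hv))
  obtain ⟨δ, hδ, hsδ⟩ := Metric.eventually_nhds_iff_ball.1 hs
  refine ⟨γ, Metric.ball 0 (min ε δ), Metric.isOpen_ball, (convex_ball _ _).ordConnected,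
    Metric.mem_ball_self (lt_min hε hδ), h0,
    hγε.mono (Metric.ball_subset_ball (min_le_left _ _)),
    fun t ht ↦ hsδ t (Metric.ball_subset_ball (min_le_right _ _) ht)⟩

end Geodesics

/-! ### Euler-Lagrange equations and the Hilbert 2-form -/

section EulerLagrange

variable {n : ℕ} {M : Type*} [TopologicalSpace M] [ChartedSpace (EuclideanSpace ℝ (Fin n)) M]
  [IsManifold (𝓡 n) ∞ M]

/-- The value of a 2-form on `TM`, as a form on the model space. -/
def formVal (τ : DForm (𝓡 n).tangent (TangentBundle (𝓡 n) M) 2) (v : TangentBundle (𝓡 n) M) :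
    (Vec n × Vec n) [⋀^Fin 2]→L[ℝ] ℝ := τ v

theorem formInChart_eq_formVal (τ : DForm (𝓡 n).tangent (TangentBundle (𝓡 n) M) 2)
    (p : TangentBundle (𝓡 n) M) (z X Y : Vec n × Vec n) :
    formInChart (𝓡 n).tangent τ p z ![X, Y] =
      formVal τ ((tchart p).symm z) ![dtchartSymm p z X, dtchartSymm p z Y] :=
  formInChart_pair p z X Y

/-- In the preferred chart at `v`, the Hilbert 2-form of `F`. -/
theorem formVal_hilbertTwoForm {U : Set M} (hU : IsOpen U) {F : TangentBundle (𝓡 n) M → ℝ}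
    (hF : ContMDiffOn (𝓡 n).tangent 𝓘(ℝ, ℝ) ∞ F (slit U)) {v : TangentBundle (𝓡 n) M}
    (hv : v ∈ slit U) (X Y : Vec n × Vec n) :
    formVal (hilbertTwoForm F) v ![X, Y] =
      fderiv ℝ (fderiv ℝ (funInChart F v)) (tchart v v) X (0, Y.1) -
        fderiv ℝ (fderiv ℝ (funInChart F v)) (tchart v v) Y (0, X.1) := by
  rw [← formInChart_hilbertTwoForm_apply hU hF (tchart_self_mem_slitChart hv) X Y]
  exact (formInChart_self (hilbertTwoForm F) v ![X, Y]).symm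

theorem fderiv_fderiv_liouville {U : Set M} (hU : IsOpen U) {F : TangentBundle (𝓡 n) M → ℝ}
    (hF : ContMDiffOn (𝓡 n).tangent 𝓘(ℝ, ℝ) ∞ F (slit U))
    (hh : ∀ v ∈ slit (n := n) U, ∀ s : ℝ, 0 < s → F ⟨v.1, s • v.2⟩ = s * F v)
    {p : TangentBundle (𝓡 n) M} {z : Vec n × Vec n} (hz : z ∈ slitChart U p) (Z : Vec n × Vec n) :
    fderiv ℝ (fderiv ℝ (funInChart F p)) z Z (0, z.2) = fderiv ℝ (funInChart F p) z (Z.1, 0) :=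
  fderiv_fderiv_radial_of_homogeneous (isOpen_slitChart hU p) (contDiffOn_funInChart hU hF p)
    (funInChart_homogeneous hh p) hz Z

/-- The Liouville field annihilates Hilbert 2-forms. -/
theorem formVal_hilbertTwoForm_liouville {U : Set M} (hU : IsOpen U)
    {F : TangentBundle (𝓡 n) M → ℝ}
    (hF : ContMDiffOn (𝓡 n).tangent 𝓘(ℝ, ℝ) ∞ F (slit U))
    (hh : ∀ v ∈ slit (n := n) U, ∀ s : ℝ, 0 < s → F ⟨v.1, s • v.2⟩ = s * F v)
    {v : TangentBundle (𝓡 n) M} (hv : v ∈ slit U) (Y : Vec n × Vec n) :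
    formVal (hilbertTwoForm F) v ![(0, v.2), Y] = 0 := by
  have hz := tchart_self_mem_slitChart hv
  rw [formVal_hilbertTwoForm hU hF hv, snd_fderiv_symm
    ((contDiffOn_funInChart hU hF v).contDiffAt ((isOpen_slitChart hU v).mem_nhds hz))]
  have h1 := fderiv_fderiv_liouville hU hF hh hz (0, Y.1)
  have h2 : (tchart v v).2 = v.2 := congrArg Prod.snd (tchart_self v)
  rw [h2] at h1
  rw [h1]
  have h3 : ((0 : Vec n), (0 : Vec n)) = 0 := rfl
  simp [h3]

/-- The Euler-Lagrange equations express that the spray annihilates the Hilbert 2-form. -/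
theorem formInChart_hilbertTwoForm_spray {U : Set M} (hU : IsOpen U)
    {F : TangentBundle (𝓡 n) M → ℝ}
    (hF : ContMDiffOn (𝓡 n).tangent 𝓘(ℝ, ℝ) ∞ F (slit U))
    (hh : ∀ v ∈ slit (n := n) U, ∀ s : ℝ, 0 < s → F ⟨v.1, s • v.2⟩ = s * F v)
    {p : TangentBundle (𝓡 n) M} {z : Vec n × Vec n} (hz : z ∈ slitChart U p)
    {Γ : VField n M} (hΓ : IsSpray U Γ) (Y : Vec n × Vec n) :
    formInChart (𝓡 n).tangent (hilbertTwoForm F) p z ![fieldInChart Γ p z, Y] =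
      fderiv ℝ (fderiv ℝ (funInChart F p)) z (fieldInChart Γ p z) (0, Y.1) -
        fderiv ℝ (funInChart F p) z (Y.1, 0) := by
  rw [formInChart_hilbertTwoForm_apply hU hF hz, hΓ.fieldInChart_fst hz,
    fderiv_fderiv_liouville hU hF hh hz]

theorem hasDerivAt_fderiv_funInChart {U : Set M} (hU : IsOpen U) {J : Set ℝ} (hJ : IsOpen J)
    {F : TangentBundle (𝓡 n) M → ℝ}
    (hF : ContMDiffOn (𝓡 n).tangent 𝓘(ℝ, ℝ) ∞ F (slit U)) {Γ : VField n M}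
    {γ : ℝ → TangentBundle (𝓡 n) M} (hγ : IsMIntegralCurveOn γ Γ J)
    (hγU : ∀ t ∈ J, γ t ∈ slit U) {t : ℝ} (ht : t ∈ J) {p : TangentBundle (𝓡 n) M}
    (hp : γ t ∈ (tchart p).source) (e : Vec n) :
    HasDerivAt (fun s ↦ fderiv ℝ (funInChart F p) (tchart p (γ s)) (0, e))
      (fderiv ℝ (fderiv ℝ (funInChart F p)) (tchart p (γ t))
        (fieldInChart Γ p (tchart p (γ t))) (0, e)) t := by
  have hz := tchart_mem_slitChart hp (hγU t ht)
  have hd2 : DifferentiableAt ℝ (fderiv ℝ (funInChart F p)) (tchart p (γ t)) :=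
    (((contDiffOn_funInChart hU hF p).contDiffAt ((isOpen_slitChart hU p).mem_nhds hz)).fderiv_right
      (m := ∞) (by simp)).differentiableAt (by simp)
  have h1 : HasDerivAt (fun s ↦ fderiv ℝ (funInChart F p) (tchart p (γ s)))
      (fderiv ℝ (fderiv ℝ (funInChart F p)) (tchart p (γ t))
        (fieldInChart Γ p (tchart p (γ t)))) t :=
    hd2.hasFDerivAt.comp_hasDerivAt t (hasDerivAt_tchart_of_integralCurve hJ hγ ht hp)
  have h2 := h1.clm_apply (hasDerivAt_const t ((0 : Vec n), e))
  simpa using h2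

/-- The geodesic sprays of `F` are the sprays that annihilate its Hilbert 2-form. -/
theorem mem_geodesicSprays_iff {U : Set M} (hU : IsOpen U) {F : TangentBundle (𝓡 n) M → ℝ}
    (hF : ContMDiffOn (𝓡 n).tangent 𝓘(ℝ, ℝ) ∞ F (slit U))
    (hh : ∀ v ∈ slit (n := n) U, ∀ s : ℝ, 0 < s → F ⟨v.1, s • v.2⟩ = s * F v)
    {Γ : VField n M} (hΓ : IsSpray U Γ) :
    Γ ∈ geodesicSprays U F ↔
      ∀ v ∈ slit U, ∀ Y, formVal (hilbertTwoForm F) v ![fieldVal Γ v, Y] = 0 := by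
  constructor
  · rintro ⟨-, h⟩ v hv Y
    obtain ⟨γ, J, hJ, hJc, h0, rfl, hγ, hγU⟩ := exists_integralCurve hU hΓ hv
    have hvel : ∀ t ∈ J, velocity (fun t ↦ (γ t).1) t = γ t := fun t ht ↦
      velocity_eq_of_integralCurve hJ hΓ hγ hγU (fun _ _ ↦ rfl) ht
    have hEL := h (fun t ↦ (γ t).1) J ⟨hJ, hJc, γ, hγ, fun t ht ↦ ⟨hγU t ht, rfl⟩⟩ 0 h0
      (γ 0) (by rw [hvel 0 h0]; exact mem_extChartAt_source _) Y.1
    rw [hvel 0 h0] at hEL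
    have h1 := hasDerivAt_fderiv_funInChart hU hJ hF hγ hγU h0
      (mem_extChartAt_source (I := (𝓡 n).tangent) (γ 0)) Y.1
    have h2 : (fun s ↦ fderiv ℝ (funInChart F (γ 0)) (tchart (γ 0) (γ s)) (0, Y.1)) =ᶠ[nhds 0]
        fun s ↦ fderiv ℝ (F ∘ (extChartAt (𝓡 n).tangent (γ 0)).symm)
          (extChartAt (𝓡 n).tangent (γ 0) (velocity (fun t ↦ (γ t).1) s)) (0, Y.1) := by
      filter_upwards [hJ.mem_nhds h0] with s hs
      rw [hvel s hs]
      rfl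
    have h3 := h1.unique (hEL.congr_of_eventuallyEq h2)
    have hz := tchart_self_mem_slitChart hv
    have h4 := formInChart_hilbertTwoForm_spray hU hF hh hz hΓ Y
    have h5 : formInChart (𝓡 n).tangent (hilbertTwoForm F) (γ 0) (tchart (γ 0) (γ 0))
        ![fieldInChart Γ (γ 0) (tchart (γ 0) (γ 0)), Y] = 0 := by
      rw [h4]; exact sub_eq_zero.2 h3
    rw [formInChart_eq_formVal, dtchartSymm_self, dtchartSymm_self,
      tchart_symm_tchart_self] at h5
    exact (congrArg (fun X : Vec n × Vec n ↦ formVal (hilbertTwoForm F) (γ 0) ![X, Y])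
      (show fieldVal Γ (γ 0) = fieldInChart Γ (γ 0) (tchart (γ 0) (γ 0)) from
        (fieldInChart_self Γ (γ 0)).symm)).trans h5
  · intro h
    refine ⟨hΓ, ?_⟩
    rintro c J ⟨hJ, hJc, γ, hγ, hγc⟩ t ht p hp e
    have hγU : ∀ t ∈ J, γ t ∈ slit U := fun t ht ↦ (hγc t ht).1
    have hvel : ∀ t ∈ J, velocity c t = γ t := fun t ht ↦
      velocity_eq_of_integralCurve hJ hΓ hγ hγU (fun t ht ↦ (hγc t ht).2) ht
    rw [hvel t ht] at hp ⊢
    have h1 := hasDerivAt_fderiv_funInChart hU hJ hF hγ hγU ht hp e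
    have hz := tchart_mem_slitChart hp (hγU t ht)
    have hz' := mem_target_of_mem_slitChart hz
    have h4 := formInChart_hilbertTwoForm_spray hU hF hh hz hΓ (e, 0)
    rw [formInChart_eq_formVal, dtchartSymm_fieldInChart Γ hz',
      h _ (symm_mem_slit hz)] at h4
    refine (h1.congr_of_eventuallyEq ?_).congr_deriv (sub_eq_zero.1 h4.symm)
    filter_upwards [hJ.mem_nhds ht] with s hs
    rw [hvel s hs]
    rfl

end EulerLagrange

/-! ### Projective equivalence of sprays -/

section Projective

variable {n : ℕ} {M : Type*} [TopologicalSpace M] [ChartedSpace (EuclideanSpace ℝ (Fin n)) M]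
  [IsManifold (𝓡 n) ∞ M]

theorem liouville_fst (v : TangentBundle (𝓡 n) M) : (fieldVal liouville v).1 = 0 :=
  congrArg Prod.fst (fieldVal_liouville v)

theorem liouville_snd (v : TangentBundle (𝓡 n) M) : (fieldVal liouville v).2 = v.2 :=
  congrArg Prod.snd (fieldVal_liouville v)

theorem mem_tchart_source {p v : TangentBundle (𝓡 n) M} (h : v.1 = p.1) :
    v ∈ (tchart p).source := by
  rw [tchart_source]
  change v.1 ∈ (extChartAt (𝓡 n) p.1).source
  rw [h]
  exact mem_extChartAt_source p.1

theorem tchart_smul {p w : TangentBundle (𝓡 n) M} (hw : w ∈ (tchart p).source) (r : ℝ) :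
    tchart p ⟨w.1, r • w.2⟩ = ((tchart p w).1, r • (tchart p w).2) := by
  rw [tchart_source] at hw
  rw [tchart_apply p w hw, tchart_apply p ⟨w.1, r • w.2⟩ hw]
  exact Prod.ext rfl (map_smul (dchart p.1 w.1) r w.2)

/-- If the geodesics of `Γ₁` are, up to orientation-preserving reparametrization, geodesics of
`Γ₂`, then `Γ₁ - Γ₂` is a multiple of the Liouville field. -/
theorem GeodesicsReparametrize.exists_eq_add {U : Set M} (hU : IsOpen U) {Γ₁ Γ₂ : VField n M}
    (h₁ : IsSpray U Γ₁) (h₂ : IsSpray U Γ₂) (h : GeodesicsReparametrize U Γ₁ Γ₂)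
    {v : TangentBundle (𝓡 n) M} (hv : v ∈ slit U) :
    ∃ k : ℝ, fieldVal Γ₁ v = fieldVal Γ₂ v + k • fieldVal liouville v := by
  obtain ⟨γ₁, J, hJ, hJc, h0, h0v, hγ₁, hγ₁U⟩ := exists_integralCurve hU h₁ hv
  obtain ⟨φ, J', hJ', -, hφs, hφpos, hφJ, -, -, γ₂, hγ₂, hγ₂U⟩ :=
    h (fun t ↦ (γ₁ t).1) J ⟨hJ, hJc, γ₁, hγ₁, fun t ht ↦ ⟨hγ₁U t ht, rfl⟩⟩
  obtain ⟨s₀, hs₀, hφs₀⟩ : (0 : ℝ) ∈ φ '' J' := hφJ ▸ h0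
  have hφm : ∀ s ∈ J', φ s ∈ J := fun s hs ↦ hφJ ▸ mem_image_of_mem φ hs
  have hφd : ∀ s ∈ J', HasDerivAt φ (deriv φ s) s := fun s hs ↦
    ((hφs.differentiableOn (by simp)).differentiableAt (hJ'.mem_nhds hs)).hasDerivAt
  have hφdd : HasDerivAt (deriv φ) (deriv (deriv φ) s₀) s₀ :=
    ((((contDiffOn_infty_iff_deriv_of_isOpen hJ').1 hφs).2.differentiableOn
      (by simp)).differentiableAt (hJ'.mem_nhds hs₀)).hasDerivAt
  -- the two curves in the preferred chart at `v`
  let u₁ : ℝ → Vec n × Vec n := fun t ↦ tchart v (γ₁ t)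
  let u₂ : ℝ → Vec n × Vec n := fun s ↦ tchart v (γ₂ s)
  have hbase : (γ₂ s₀).1 = v.1 := by
    have h3 := (hγ₂U s₀ hs₀).2
    simp only [Function.comp_apply, hφs₀, h0v] at h3
    exact h3
  have hsrc₁ : ∀ᶠ s in nhds s₀, γ₁ (φ s) ∈ (tchart v).source := by
    have hc : ContinuousAt (fun s ↦ γ₁ (φ s)) s₀ :=
      ContinuousAt.comp (by rw [hφs₀]; exact continuousAt_of_integralCurve hJ hγ₁ h0)
        (hφd s₀ hs₀).continuousAt
    refine hc.eventually ((isOpen_extChartAt_source v).eventually_mem ?_)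
    simp only [hφs₀, h0v]
    exact mem_extChartAt_source v
  have hsrc₂ : ∀ᶠ s in nhds s₀, γ₂ s ∈ (tchart v).source :=
    (continuousAt_of_integralCurve hJ' hγ₂ hs₀).eventually
      ((isOpen_extChartAt_source v).eventually_mem (mem_tchart_source hbase))
  have hall := (hsrc₁.and hsrc₂).and (hJ'.eventually_mem hs₀)
  have hd₁ : ∀ t ∈ J, γ₁ t ∈ (tchart v).source → HasDerivAt u₁ (fieldInChart Γ₁ v (u₁ t)) t :=
    fun t ht hp ↦ hasDerivAt_tchart_of_integralCurve hJ hγ₁ ht hp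
  have hd₂ : ∀ s ∈ J', γ₂ s ∈ (tchart v).source → HasDerivAt u₂ (fieldInChart Γ₂ v (u₂ s)) s :=
    fun s hs hp ↦ hasDerivAt_tchart_of_integralCurve hJ' hγ₂ hs hp
  have hfst : ∀ s, γ₁ (φ s) ∈ (tchart v).source → γ₂ s ∈ (tchart v).source → s ∈ J' →
      (u₂ s).1 = (u₁ (φ s)).1 := by
    intro s hp₁ hp₂ hs
    rw [tchart_source] at hp₁ hp₂
    simp only [u₁, u₂, tchart_apply v _ hp₁, tchart_apply v _ hp₂]
    exact congrArg _ (hγ₂U s hs).2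
  -- comparison of the first derivatives: `c ∘ φ` has velocity `φ' • c'`
  have hsnd : ∀ᶠ s in nhds s₀, (u₂ s).2 = deriv φ s • (u₁ (φ s)).2 := by
    filter_upwards [hall.eventually_nhds] with s hs
    obtain ⟨⟨hp₁, hp₂⟩, hsJ⟩ := hs.self_of_nhds
    have e1 : HasDerivAt (fun r ↦ (u₁ (φ r)).1) (deriv φ s • (u₁ (φ s)).2) s := by
      have : HasDerivAt (fun r ↦ (u₁ (φ r)).1) (deriv φ s • fieldInChart Γ₁ v (u₁ (φ s))).1 s :=
        ((hd₁ _ (hφm s hsJ) hp₁).scomp s (hφd s hsJ)).fst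
      rw [Prod.smul_fst, h₁.fieldInChart_fst (tchart_mem_slitChart hp₁ (hγ₁U _ (hφm s hsJ)))]
        at this
      exact this
    have e2 : HasDerivAt (fun r ↦ (u₂ r).1) (u₂ s).2 s := by
      have : HasDerivAt (fun r ↦ (u₂ r).1) (fieldInChart Γ₂ v (u₂ s)).1 s := (hd₂ s hsJ hp₂).fst
      rw [h₂.fieldInChart_fst (tchart_mem_slitChart hp₂ (hγ₂U s hsJ).1)] at this
      exact this
    refine e2.unique (e1.congr_of_eventuallyEq ?_)
    filter_upwards [hs] with r hr
    exact hfst r hr.1.1 hr.1.2 hr.2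
  obtain ⟨⟨hp₁, hp₂⟩, -⟩ := hall.self_of_nhds
  have hu₁ : u₁ (φ s₀) = tchart v v := by simp only [u₁, hφs₀, h0v]
  have hu₁' : fieldInChart Γ₁ v (u₁ (φ s₀)) = fieldVal Γ₁ v := by
    rw [hu₁]; exact fieldInChart_self Γ₁ v
  let r : ℝ := deriv φ s₀
  have hr : 0 < r := hφpos s₀ hs₀
  have hw : γ₂ s₀ = ⟨v.1, r • v.2⟩ := by
    have e1 : u₂ s₀ = (extChartAt (𝓡 n) v.1 v.1, r • v.2) := by
      refine Prod.ext ?_ ?_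
      · rw [hfst s₀ hp₁ hp₂ hs₀, hu₁, tchart_self]
      · rw [hsnd.self_of_nhds, hu₁, tchart_self]
        rfl
    exact ((tchart v).left_inv hp₂).symm.trans
      ((congrArg (tchart v).symm e1).trans (tchart_symm_self v (r • v.2)))
  have hu₂' : (fieldInChart Γ₂ v (u₂ s₀)).2 = r ^ 2 • (fieldVal Γ₂ v).2 := by
    have e1 : fieldInChart Γ₂ v (tchart v ⟨v.1, r • v.2⟩) = fieldVal Γ₂ ⟨v.1, r • v.2⟩ :=
      fieldInChart_self Γ₂ (⟨v.1, r • v.2⟩ : TangentBundle (𝓡 n) M)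
    simp only [u₂, hw]
    rw [e1]
    exact h₂.snd_smul hU hv hr
  -- comparison of the second derivatives
  let y : Vec n := v.2
  have e1 : HasDerivAt (fun s ↦ deriv φ s • (u₁ (φ s)).2)
      (r • r • (fieldVal Γ₁ v).2 + deriv (deriv φ) s₀ • y) s₀ := by
    have e2 : HasDerivAt (fun s ↦ (u₁ (φ s)).2) (r • fieldInChart Γ₁ v (u₁ (φ s₀))).2 s₀ :=
      ((hd₁ _ (hφm s₀ hs₀) hp₁).scomp s₀ (hφd s₀ hs₀)).snd
    rw [hu₁', Prod.smul_snd] at e2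
    have e3 := hφdd.fun_smul e2
    have e4 : (u₁ (φ s₀)).2 = y := by rw [hu₁, tchart_self]
    rw [e4] at e3
    exact e3
  have e0 : HasDerivAt (fun s ↦ (u₂ s).2) (fieldInChart Γ₂ v (u₂ s₀)).2 s₀ := (hd₂ s₀ hs₀ hp₂).snd
  have e2 := e0.unique (e1.congr_of_eventuallyEq hsnd)
  rw [hu₂'] at e2
  have hr2 : r ^ 2 ≠ 0 := pow_ne_zero 2 hr.ne'
  refine ⟨-((r ^ 2)⁻¹ * deriv (deriv φ) s₀), Prod.ext ?_ ?_⟩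
  · rw [Prod.fst_add, Prod.smul_fst, liouville_fst, smul_zero, add_zero, h₁.fst hv, h₂.fst hv]
  · have e3 := congrArg (fun X ↦ (r ^ 2)⁻¹ • X) e2
    simp only [smul_add, smul_smul] at e3
    rw [inv_mul_cancel₀ hr2, one_smul, show (r ^ 2)⁻¹ * (r * r) = 1 by field_simp, one_smul] at e3
    have e4 : (fieldVal liouville v).2 = y := liouville_snd v
    rw [Prod.snd_add, Prod.smul_snd, e3, e4, neg_smul]
    abel

/-- If `Γ₂ - Γ₁` is a multiple of the Liouville field, then the geodesics of `Γ₁` are, up to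
reparametrization, geodesics of `Γ₂`. -/
theorem geodesicsReparametrize_of_eq_add {U : Set M} (hU : IsOpen U) {Γ₁ Γ₂ : VField n M}
    (h₁ : IsSpray U Γ₁) (h₂ : IsSpray U Γ₂)
    (h : ∀ v ∈ slit (n := n) U, ∃ k : ℝ,
      fieldVal Γ₂ v = fieldVal Γ₁ v + k • fieldVal liouville v) :
    GeodesicsReparametrize U Γ₁ Γ₂ := by
  rintro c J ⟨hJ, hJc, γ, hγ, hγc⟩
  have hγU : ∀ t ∈ J, γ t ∈ slit U := fun t ht ↦ (hγc t ht).1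
  choose! k hk using h
  -- the multiple is smooth along integral curves, since it can be recovered by an inner product
  -- with the nonzero vector `y`
  have hchart : ∀ p : TangentBundle (𝓡 n) M, ∀ z ∈ slitChart U p, k ((tchart p).symm z) =
      (inner ℝ z.2 z.2)⁻¹ * inner ℝ z.2 ((fieldInChart Γ₂ p z).2 - (fieldInChart Γ₁ p z).2) := by
    intro p z hz
    have hz' := mem_target_of_mem_slitChart hz
    have e1 : fieldInChart Γ₂ p z = fieldInChart Γ₁ p z + k ((tchart p).symm z) • (0, z.2) := by
      apply dtchartSymm_injective hz'
      rw [map_add, map_smul, dtchartSymm_fieldInChart Γ₁ hz', dtchartSymm_fieldInChart Γ₂ hz',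
        hk _ (symm_mem_slit hz), ← liouville_tchart_symm hz']
      rfl
    have e2 : inner ℝ z.2 z.2 ≠ 0 := inner_self_ne_zero.2 hz.2.2
    rw [e1, Prod.snd_add, add_sub_cancel_left, Prod.smul_snd, inner_smul_right]
    field_simp
  have hf : ContDiffOn ℝ ∞ (fun t ↦ k (γ t)) J := by
    intro t ht
    refine ContDiffAt.contDiffWithinAt ?_
    let p := γ t
    have hp : γ t ∈ (tchart p).source := mem_extChartAt_source (γ t)
    have hu := contDiffAt_tchart_of_integralCurve hU hJ h₁ hγ hγU ht hp
    have hz := tchart_mem_slitChart hp (hγU t ht)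
    have hO := (isOpen_slitChart hU p).mem_nhds hz
    have hG : ContDiffAt ℝ ∞ (fun z : Vec n × Vec n ↦ (inner ℝ z.2 z.2)⁻¹ *
        inner ℝ z.2 ((fieldInChart Γ₂ p z).2 - (fieldInChart Γ₁ p z).2)) (tchart p (γ t)) := by
      have e2 : inner ℝ (tchart p (γ t)).2 (tchart p (γ t)).2 ≠ 0 := inner_self_ne_zero.2 hz.2.2
      refine ((contDiffAt_snd.inner ℝ contDiffAt_snd).inv e2).mul
        (contDiffAt_snd.inner ℝ (ContDiffAt.sub ?_ ?_))
      · exact contDiff_snd.contDiffAt.comp _ ((h₂.contDiffOn_fieldInChart hU p).contDiffAt hO)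
      · exact contDiff_snd.contDiffAt.comp _ ((h₁.contDiffOn_fieldInChart hU p).contDiffAt hO)
    refine (hG.comp t hu).congr_of_eventuallyEq ?_
    filter_upwards [hJ.mem_nhds ht, (continuousAt_of_integralCurve hJ hγ ht).eventually
      ((isOpen_extChartAt_source p).eventually_mem hp)] with s hs hsp
    have e3 := hchart p _ (tchart_mem_slitChart hsp (hγU s hs))
    have e4 : (tchart p).symm (tchart p (γ s)) = γ s := (tchart p).left_inv hsp
    rw [e4] at e3
    exact e3
  obtain ⟨φ, J', hJ', hJ'c, hφs, hφpos, hφJ, hφd⟩ :=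
    exists_reparametrization_second_order hJ hJc hf
  have hφm : ∀ s ∈ J', φ s ∈ J := fun s hs ↦ hφJ ▸ mem_image_of_mem φ hs
  -- the velocity of the reparametrized geodesic
  let γ₂ : ℝ → TangentBundle (𝓡 n) M := fun s ↦ ⟨(γ (φ s)).1, deriv φ s • (γ (φ s)).2⟩
  refine ⟨φ, J', hJ', hJ'c, hφs, hφpos, hφJ, hJ', hJ'c, γ₂, fun s hs ↦ ?_, fun s hs ↦
    ⟨⟨(hγU _ (hφm s hs)).1, smul_ne_zero (hφpos s hs).ne' (hγU _ (hφm s hs)).2⟩,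
      (hγc _ (hφm s hs)).2⟩⟩
  refine HasMFDerivAt.hasMFDerivWithinAt ?_
  let w := γ (φ s)
  let r := deriv φ s
  have hw : w ∈ slit U := hγU _ (hφm s hs)
  have hws : γ (φ s) ∈ (tchart w).source := mem_extChartAt_source w
  have hu := hasDerivAt_tchart_of_integralCurve hJ hγ (hφm s hs) hws
  have hu' : fieldInChart Γ₁ w (tchart w (γ (φ s))) = fieldVal Γ₁ w := fieldInChart_self Γ₁ w
  rw [hu'] at hu
  have hu2 := hu.scomp s (hφd s hs).1
  have hder : HasDerivAt (fun s ↦ ((tchart w (γ (φ s))).1, deriv φ s • (tchart w (γ (φ s))).2))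
      (fieldVal Γ₂ (γ₂ s)) s := by
    have e0 : HasDerivAt (fun s ↦ (tchart w (γ (φ s))).1) (r • fieldVal Γ₁ w).1 s := hu2.fst
    have e0' : HasDerivAt (fun s ↦ (tchart w (γ (φ s))).2) (r • fieldVal Γ₁ w).2 s := hu2.snd
    refine (e0.prodMk ((hφd s hs).2.fun_smul e0')).congr_deriv ?_
    have hw2 : γ₂ s ∈ slit U := ⟨hw.1, smul_ne_zero (hφpos s hs).ne' hw.2⟩
    have e2 : (tchart w (γ (φ s))).2 = (w.2 : Vec n) := congrArg Prod.snd (tchart_self w)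
    refine Prod.ext ?_ ?_
    · rw [h₂.fst hw2]
      simp only [Prod.smul_fst, h₁.fst hw]
      rfl
    · have e3 : (fieldVal Γ₂ (γ₂ s)).2 = r ^ 2 • (fieldVal Γ₂ w).2 := h₂.snd_smul hU hw (hφpos s hs)
      have e4 : (fieldVal liouville w).2 = (tchart w w).2 := (liouville_snd w).trans e2.symm
      rw [e3, hk w hw]
      simp only [Prod.smul_snd, Prod.snd_add]
      rw [e4, smul_add, smul_smul, smul_smul, mul_comm (k (γ (φ s))), pow_two]
  have hev : (fun s ↦ tchart w (γ₂ s)) =ᶠ[nhds s]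
      fun s ↦ ((tchart w (γ (φ s))).1, deriv φ s • (tchart w (γ (φ s))).2) := by
    have hc : ContinuousAt (fun s ↦ γ (φ s)) s :=
      ContinuousAt.comp (continuousAt_of_integralCurve hJ hγ (hφm s hs)) (hφd s hs).1.continuousAt
    filter_upwards [hc.eventually ((isOpen_extChartAt_source w).eventually_mem hws)] with q hq
    exact tchart_smul hq _
  have hsrc : ∀ᶠ q in nhds s, γ₂ q ∈ (tchart w).source := by
    have hc : ContinuousAt (fun s ↦ γ (φ s)) s :=
      ContinuousAt.comp (continuousAt_of_integralCurve hJ hγ (hφm s hs)) (hφd s hs).1.continuousAt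
    filter_upwards [hc.eventually ((isOpen_extChartAt_source w).eventually_mem hws)] with q hq
    have hq' : γ (φ q) ∈ (tchart w).source := hq
    rw [tchart_source] at hq' ⊢
    exact hq'
  have hcont : ContinuousAt γ₂ s := by
    have h3 : ContinuousAt (fun q ↦ (tchart w).symm (tchart w (γ₂ q))) s := by
      have h4 : tchart w (γ₂ s) ∈ (tchart w).target := (tchart w).map_source hsrc.self_of_nhds
      have h5 : ContinuousAt (fun s ↦ tchart w (γ₂ s)) s :=
        hder.continuousAt.congr hev.symm
      exact ContinuousAt.comp (continuousAt_extChartAt_symm'' h4) h5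
    refine h3.congr ?_
    filter_upwards [hsrc] with q hq
    exact (tchart w).left_inv hq
  refine hasMFDerivAt_of_hasDerivAt hcont ?_
  exact hder.congr_of_eventuallyEq hev

/-- Two sprays are projectively equivalent if and only if they differ by a multiple of the Liouville
field. -/
theorem projectivelyEquivalent_iff {U : Set M} (hU : IsOpen U) {Γ₁ Γ₂ : VField n M}
    (h₁ : IsSpray U Γ₁) (h₂ : IsSpray U Γ₂) :
    ProjectivelyEquivalent U Γ₁ Γ₂ ↔ ∀ v ∈ slit (n := n) U, ∃ k : ℝ,
      fieldVal Γ₂ v = fieldVal Γ₁ v + k • fieldVal liouville v := by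
  constructor
  · intro h v hv
    exact h.2.exists_eq_add hU h₂ h₁ hv
  · intro h
    refine ⟨geodesicsReparametrize_of_eq_add hU h₁ h₂ h,
      geodesicsReparametrize_of_eq_add hU h₂ h₁ fun v hv ↦ ?_⟩
    obtain ⟨k, hk⟩ := h v hv
    exact ⟨-k, by rw [hk, neg_smul, add_neg_cancel_right]⟩

end Projective

/-! ### Geodesic classes of pseudo-Finsler functions -/

section Metrizability

variable {n : ℕ} {M : Type*} [TopologicalSpace M] [ChartedSpace (EuclideanSpace ℝ (Fin n)) M]
  [IsManifold (𝓡 n) ∞ M]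

theorem zero_zero_vec : ((0 : Vec n), (0 : Vec n)) = 0 := rfl

theorem contDiffAt_funInChart_self {U : Set M} (hU : IsOpen U)
    {F : TangentBundle (𝓡 n) M → ℝ}
    (hF : ContMDiffOn (𝓡 n).tangent 𝓘(ℝ, ℝ) ∞ F (slit U)) {v : TangentBundle (𝓡 n) M}
    (hv : v ∈ slit U) : ContDiffAt ℝ ∞ (funInChart F v) (tchart v v) :=
  (contDiffOn_funInChart hU hF v).contDiffAt
    ((isOpen_slitChart hU v).mem_nhds (tchart_self_mem_slitChart hv))

/-- The contraction of the Hilbert 2-form with vertical vectors is the fibre Hessian. -/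
theorem formVal_hilbertTwoForm_vertical {U : Set M} (hU : IsOpen U)
    {F : TangentBundle (𝓡 n) M → ℝ}
    (hF : ContMDiffOn (𝓡 n).tangent 𝓘(ℝ, ℝ) ∞ F (slit U)) {v : TangentBundle (𝓡 n) M}
    (hv : v ∈ slit U) (w : Vec n) (Y : Vec n × Vec n) :
    formVal (hilbertTwoForm F) v ![(0, w), Y] = fibreHessian F v w Y.1 := by
  rw [formVal_hilbertTwoForm hU hF hv, fibreHessian_eq hU hF hv]
  simp [zero_zero_vec]

theorem fibreHessian_symm {U : Set M} (hU : IsOpen U) {F : TangentBundle (𝓡 n) M → ℝ}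
    (hF : ContMDiffOn (𝓡 n).tangent 𝓘(ℝ, ℝ) ∞ F (slit U)) {v : TangentBundle (𝓡 n) M}
    (hv : v ∈ slit U) (w w' : Vec n) : fibreHessian F v w w' = fibreHessian F v w' w := by
  rw [fibreHessian_eq hU hF hv, fibreHessian_eq hU hF hv,
    snd_fderiv_symm (contDiffAt_funInChart_self hU hF hv)]

theorem formVal_hilbertTwoForm_fieldVal_liouville {U : Set M} (hU : IsOpen U)
    {F : TangentBundle (𝓡 n) M → ℝ}
    (hF : ContMDiffOn (𝓡 n).tangent 𝓘(ℝ, ℝ) ∞ F (slit U))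
    (hh : ∀ v ∈ slit (n := n) U, ∀ s : ℝ, 0 < s → F ⟨v.1, s • v.2⟩ = s * F v)
    {v : TangentBundle (𝓡 n) M} (hv : v ∈ slit U) (Y : Vec n × Vec n) :
    formVal (hilbertTwoForm F) v ![fieldVal liouville v, Y] = 0 :=
  (congrArg (fun X : Vec n × Vec n ↦ formVal (hilbertTwoForm F) v ![X, Y])
    (fieldVal_liouville v)).trans (formVal_hilbertTwoForm_liouville hU hF hh hv Y)

/-- The kernel of the Hilbert 2-form of a pseudo-Finsler function is the distribution `𝒟`, as soon
as it contains the spray `Γ`: the fibre Hessian shows first that the horizontal part of a kernel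
vector is a multiple of `y`, and then, after subtraction of a multiple of `Γ`, that the rest is
radial. -/
theorem IsPseudoFinsler.mem_kernel_iff {U : Set M} (hU : IsOpen U)
    {F : TangentBundle (𝓡 n) M → ℝ} (hF : IsPseudoFinsler U F) {Γ : VField n M}
    (hΓ : IsSpray U Γ)
    (hker : ∀ v ∈ slit U, ∀ Y, formVal (hilbertTwoForm F) v ![fieldVal Γ v, Y] = 0)
    {v : TangentBundle (𝓡 n) M} (hv : v ∈ slit U) (X : Vec n × Vec n) :
    (∀ Y, formVal (hilbertTwoForm F) v ![X, Y] = 0) ↔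
      ∃ a b : ℝ, X = a • fieldVal liouville v + b • fieldVal Γ v := by
  constructor
  · intro h
    obtain ⟨b, hb⟩ := (hF.quasiRegular v hv X.1).1 fun w' ↦ by
      have h1 := h (0, w')
      rw [alternating_swap, formVal_hilbertTwoForm_vertical hU hF.smooth hv, neg_eq_zero] at h1
      rw [fibreHessian_symm hU hF.smooth hv, h1]
    have hvert : X - b • fieldVal Γ v = (0, X.2 - b • (fieldVal Γ v).2) := by
      refine Prod.ext ?_ rfl
      rw [Prod.fst_sub, Prod.smul_fst, hΓ.fst hv, hb]
      exact sub_self (b • (v.2 : Vec n))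
    obtain ⟨a, ha⟩ := (hF.quasiRegular v hv (X.2 - b • (fieldVal Γ v).2)).1 fun w' ↦ by
      have h1 := formVal_hilbertTwoForm_vertical hU hF.smooth hv (X.2 - b • (fieldVal Γ v).2)
        (w', 0)
      rw [← hvert, sub_eq_add_neg, ← neg_smul, alternating_add_left, alternating_smul_left, h,
        hker v hv, mul_zero, add_zero] at h1
      exact h1.symm
    refine ⟨a, b, ?_⟩
    rw [← sub_eq_iff_eq_add, hvert, ha, fieldVal_liouville]
    exact Prod.ext (smul_zero a).symm rfl
  · rintro ⟨a, b, rfl⟩ Y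
    rw [alternating_add_left, alternating_smul_left, alternating_smul_left, hker v hv,
      formVal_hilbertTwoForm_fieldVal_liouville hU hF.smooth hF.homogeneous hv]
    simp

/-- If the kernel of the Hilbert 2-form is contained in `𝒟`, then the fibre Hessian is
quasi-regular: a vector in its kernel is, as a vertical vector, in the kernel of the Hilbert
2-form. -/
theorem isPseudoFinsler_of_kernel {U : Set M} (hU : IsOpen U)
    {F : TangentBundle (𝓡 n) M → ℝ}
    (hF : ContMDiffOn (𝓡 n).tangent 𝓘(ℝ, ℝ) ∞ F (slit U))
    (hh : ∀ v ∈ slit (n := n) U, ∀ s : ℝ, 0 < s → F ⟨v.1, s • v.2⟩ = s * F v)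
    {Γ : VField n M} (hΓ : IsSpray U Γ)
    (hker : ∀ v ∈ slit U, ∀ X, (∀ Y, formVal (hilbertTwoForm F) v ![X, Y] = 0) →
      ∃ a b : ℝ, X = a • fieldVal liouville v + b • fieldVal Γ v) :
    IsPseudoFinsler U F := by
  refine ⟨hF, hh, fun v hv w ↦ ⟨fun h ↦ ?_, ?_⟩⟩
  · obtain ⟨a, b, hab⟩ := hker v hv (0, w) fun Y ↦ by
      rw [formVal_hilbertTwoForm_vertical hU hF hv]; exact h Y.1
    have h1 := congrArg Prod.fst hab
    rw [Prod.fst_add, Prod.smul_fst, Prod.smul_fst, liouville_fst, smul_zero, zero_add,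
      hΓ.fst hv] at h1
    have hb : b = 0 := (smul_eq_zero.1 h1.symm).resolve_right hv.2
    have h2 := congrArg Prod.snd hab
    rw [hb, zero_smul, add_zero, Prod.smul_snd, liouville_snd] at h2
    exact ⟨a, h2⟩
  · rintro ⟨k, rfl⟩ w'
    have h1 := (formVal_hilbertTwoForm_vertical hU hF hv v.2 (w', 0)).symm.trans
      (formVal_hilbertTwoForm_liouville hU hF hh hv (w', 0))
    have h2 := congrArg (fun L : Vec n →L[ℝ] ℝ ↦ L w')
      (map_smul (fibreHessian F v) k (v.2 : Vec n))
    refine h2.trans ?_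
    exact (congrArg (k • ·) h1).trans (smul_zero k)

theorem ProjectivelyEquivalent.refl {U : Set M} (hU : IsOpen U) {Γ : VField n M}
    (hΓ : IsSpray U Γ) : ProjectivelyEquivalent U Γ Γ :=
  (projectivelyEquivalent_iff hU hΓ hΓ).2 fun v _ ↦ ⟨0, by rw [zero_smul, add_zero]⟩

/-- A projective class is the geodesic class of a pseudo-Finsler function if and only if one of its
sprays annihilates the Hilbert 2-form. -/
theorem isMetrizedBy_iff {U : Set M} (hU : IsOpen U) {F : TangentBundle (𝓡 n) M → ℝ}
    {Γ : VField n M} (hΓ : IsSpray U Γ) :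
    IsMetrizedBy U Γ F ↔ IsPseudoFinsler U F ∧
      ∀ v ∈ slit U, ∀ Y, formVal (hilbertTwoForm F) v ![fieldVal Γ v, Y] = 0 := by
  constructor
  · rintro ⟨hF, h⟩
    refine ⟨hF, (mem_geodesicSprays_iff hU hF.smooth hF.homogeneous hΓ).1 ?_⟩
    rw [← h]
    exact ⟨hΓ, ProjectivelyEquivalent.refl hU hΓ⟩
  · rintro ⟨hF, hker⟩
    refine ⟨hF, Subset.antisymm ?_ ?_⟩
    · rintro Γ' ⟨hΓ', hp⟩
      rw [mem_geodesicSprays_iff hU hF.smooth hF.homogeneous hΓ']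
      intro v hv
      obtain ⟨k, hk⟩ := (projectivelyEquivalent_iff hU hΓ hΓ').1 hp v hv
      refine (hF.mem_kernel_iff hU hΓ hker hv _).2 ⟨k, 1, ?_⟩
      rw [hk, one_smul, add_comm]
    · intro Γ' h
      have hΓ' := h.1
      rw [mem_geodesicSprays_iff hU hF.smooth hF.homogeneous hΓ'] at h
      refine ⟨hΓ', (projectivelyEquivalent_iff hU hΓ hΓ').2 fun v hv ↦ ?_⟩
      obtain ⟨a, b, hab⟩ := (hF.mem_kernel_iff hU hΓ hker hv _).1 (h v hv)
      have h1 := congrArg Prod.fst hab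
      rw [Prod.fst_add, Prod.smul_fst, Prod.smul_fst, liouville_fst, smul_zero, zero_add,
        hΓ.fst hv, hΓ'.fst hv] at h1
      have h2 : (1 - b) • (v.2 : Vec n) = 0 := by
        rw [sub_smul, one_smul]; exact sub_eq_zero.2 h1
      have hb : b = 1 := by
        have := (smul_eq_zero.1 h2).resolve_right hv.2
        linarith
      exact ⟨a, by rw [hab, hb, one_smul, add_comm]⟩

end Metrizability

/-! ### Curves tangent to the path distribution -/

section Leaves

variable {n : ℕ} {M : Type*} [TopologicalSpace M] [ChartedSpace (EuclideanSpace ℝ (Fin n)) M]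
  [IsManifold (𝓡 n) ∞ M]

theorem eq_smulRight {G : Type*} [NormedAddCommGroup G] [NormedSpace ℝ G] {A : ℝ →L[ℝ] G} {X : G}
    (h : A 1 = X) : A = (1 : ℝ →L[ℝ] ℝ).smulRight X := by
  refine ContinuousLinearMap.ext_ring ?_
  rw [h]
  exact (one_smul ℝ X).symm

theorem hasMFDerivAt_comp_real {γ : ℝ → TangentBundle (𝓡 n) M} {r : ℝ → ℝ} {t r' : ℝ}
    {X : Vec n × Vec n}
    (hγ : HasMFDerivAt 𝓘(ℝ, ℝ) (𝓡 n).tangent γ (r t) ((1 : ℝ →L[ℝ] ℝ).smulRight X))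
    (hr : HasDerivAt r r' t) :
    HasMFDerivAt 𝓘(ℝ, ℝ) (𝓡 n).tangent (γ ∘ r) t ((1 : ℝ →L[ℝ] ℝ).smulRight (r' • X)) := by
  have h1 := HasMFDerivAt.comp t hγ hr.hasFDerivAt.hasMFDerivAt
  have h2 := eq_smulRight (A := ((1 : ℝ →L[ℝ] ℝ).smulRight X).comp
    (ContinuousLinearMap.toSpanSingleton ℝ r')) (X := r' • X) (by simp)
  exact h2 ▸ h1

theorem contDiff_exp_smul (y : Vec n) : ContDiff ℝ ∞ fun t : ℝ ↦ Real.exp t • y :=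
  Real.contDiff_exp.smul contDiff_const

theorem hasDerivAt_exp_smul (y : Vec n) (t : ℝ) :
    HasDerivAt (fun t : ℝ ↦ Real.exp t • y) (Real.exp t • y) t :=
  (Real.hasDerivAt_exp t).smul_const y

/-- Smooth curves, defined on all of `ℝ`, in the slit tangent bundle that are tangent to `𝒟`. -/
structure IsLeafCurve (Γ : VField n M) (γ : ℝ → TangentBundle (𝓡 n) M) : Prop where
  smooth : ContMDiff 𝓘(ℝ, ℝ) (𝓡 n).tangent ∞ γ
  mem_slit : ∀ t, γ t ∈ slit univ
  tangent : ∀ t, ∃ a b : ℝ, HasMFDerivAt 𝓘(ℝ, ℝ) (𝓡 n).tangent γ t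
    ((1 : ℝ →L[ℝ] ℝ).smulRight (a • fieldVal liouville (γ t) + b • fieldVal Γ (γ t)))

theorem isLeafCurve_of_sameLeaf {Γ : VField n M} {γ : ℝ → TangentBundle (𝓡 n) M}
    (h : ContMDiff 𝓘(ℝ, ℝ) (𝓡 n).tangent ∞ γ)
    (hD : ∀ t : ℝ, γ t ∈ slit univ ∧
      mfderiv 𝓘(ℝ, ℝ) (𝓡 n).tangent γ t (1 : ℝ) ∈ pathDistribution Γ (γ t)) : IsLeafCurve Γ γ := by
  refine ⟨h, fun t ↦ (hD t).1, fun t ↦ ?_⟩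
  obtain ⟨a, b, hab⟩ := Submodule.mem_span_pair.1 (hD t).2
  refine ⟨a, b, ?_⟩
  have h1 := (h.mdifferentiableAt (x := t) (by simp)).hasMFDerivAt
  have h2 := eq_smulRight (G := Vec n × Vec n) hab.symm
  exact h2 ▸ h1

theorem IsLeafCurve.comp {Γ : VField n M} {γ : ℝ → TangentBundle (𝓡 n) M} (h : IsLeafCurve Γ γ)
    {r : ℝ → ℝ} (hr : ContDiff ℝ ∞ r) : IsLeafCurve Γ (γ ∘ r) := by
  refine ⟨h.smooth.comp hr.contMDiff, fun t ↦ h.mem_slit _, fun t ↦ ?_⟩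
  obtain ⟨a, b, hab⟩ := h.tangent (r t)
  refine ⟨deriv r t * a, deriv r t * b, ?_⟩
  have h1 := hasMFDerivAt_comp_real hab (hr.differentiable (by simp) t).hasDerivAt
  have h3 : deriv r t • (a • fieldVal liouville (γ (r t)) + b • fieldVal Γ (γ (r t))) =
      (deriv r t * a) • fieldVal liouville (γ (r t)) + (deriv r t * b) • fieldVal Γ (γ (r t)) := by
    rw [smul_add, smul_smul, smul_smul]
  exact h3 ▸ h1

theorem IsLeafCurve.sameLeaf {Γ : VField n M} {γ : ℝ → TangentBundle (𝓡 n) M}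
    (h : IsLeafCurve Γ γ) (s t : ℝ) : SameLeaf Γ (γ s) (γ t) := by
  have h1 := h.comp (r := fun r ↦ s + r * (t - s)) (by fun_prop)
  refine ⟨_, h1.smooth, by simp, by simp, fun r ↦ ⟨h1.mem_slit r, ?_⟩⟩
  obtain ⟨a, b, hab⟩ := h1.tangent r
  refine Submodule.mem_span_pair.2 ⟨a, b, ?_⟩
  have h2 := congrArg (fun L : ℝ →L[ℝ] Vec n × Vec n ↦ L 1) hab.mfderiv
  exact ((one_smul ℝ (a • fieldVal liouville _ + b • fieldVal Γ _)).symm).trans h2.symm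

theorem isLeafCurve_of_integralCurve {Γ : VField n M} (hΓ : IsSpray univ Γ)
    {γ : ℝ → TangentBundle (𝓡 n) M} {J : Set ℝ} (hJ : IsOpen J) (hγ : IsMIntegralCurveOn γ Γ J)
    (hγU : ∀ t ∈ J, γ t ∈ slit univ) {r : ℝ → ℝ} (hr : ContDiff ℝ ∞ r) (hrJ : ∀ t, r t ∈ J) :
    IsLeafCurve Γ (γ ∘ r) := by
  refine ⟨fun t ↦ contMDiffAt_iff_target.2 ⟨?_, ?_⟩, fun t ↦ hγU _ (hrJ t),
    fun t ↦ ⟨0, deriv r t, ?_⟩⟩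
  · exact ContinuousAt.comp (continuousAt_of_integralCurve hJ hγ (hrJ t)) hr.continuous.continuousAt
  · refine ContDiffAt.contMDiffAt ?_
    exact ContDiffAt.comp (g := fun s ↦ tchart (γ (r t)) (γ s)) t
      (contDiffAt_tchart_of_integralCurve isOpen_univ hJ hΓ hγ hγU (hrJ t)
      (p := γ (r t)) (mem_extChartAt_source _)) hr.contDiffAt
  · have h1 := hasMFDerivAt_comp_real (X := fieldVal Γ (γ (r t)))
      (hasMFDerivAt_of_integralCurve hJ hγ (hrJ t)) (hr.differentiable (by simp) t).hasDerivAt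
    have h3 : deriv r t • fieldVal Γ (γ (r t)) =
        (0 : ℝ) • fieldVal liouville (γ (r t)) + deriv r t • fieldVal Γ (γ (r t)) := by
      rw [zero_smul, zero_add]
    exact h3 ▸ h1

/-- Curves in a tangent space of `M` are smooth as curves in `TM`. -/
theorem contMDiff_fibreCurve (v : TangentBundle (𝓡 n) M) {y : ℝ → Vec n} (hy : ContDiff ℝ ∞ y) :
    ContMDiff 𝓘(ℝ, ℝ) (𝓡 n).tangent ∞ (fun t ↦ (⟨v.1, y t⟩ : TangentBundle (𝓡 n) M)) := by
  have h1 : (fun t ↦ (⟨v.1, y t⟩ : TangentBundle (𝓡 n) M)) =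
      (tchart v).symm ∘ fun t ↦ (extChartAt (𝓡 n) v.1 v.1, y t) := by
    funext t; exact (tchart_symm_self v (y t)).symm
  rw [h1]
  have h2 : ContDiff ℝ ∞ fun t ↦ (extChartAt (𝓡 n) v.1 v.1, y t) := contDiff_const.prodMk hy
  refine contMDiffOn_univ.1 (((contMDiffOn_extChartAt_symm (I := (𝓡 n).tangent) v).comp
    h2.contMDiff.contMDiffOn) fun t _ ↦ ?_)
  change _ ∈ (tchart v).target
  rw [tchart_target]
  exact ⟨mem_extChartAt_target v.1, mem_univ _⟩

/-- The velocity of a curve in a tangent space of `M`, as a curve in `TM`. -/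
theorem hasMFDerivAt_fibreCurve (v : TangentBundle (𝓡 n) M) {y : ℝ → Vec n} (hy : ContDiff ℝ ∞ y)
    {y' : Vec n} {t : ℝ} (hd : HasDerivAt y y' t) :
    HasMFDerivAt 𝓘(ℝ, ℝ) (𝓡 n).tangent (fun t ↦ (⟨v.1, y t⟩ : TangentBundle (𝓡 n) M)) t
      ((1 : ℝ →L[ℝ] ℝ).smulRight (((0 : Vec n), y') : Vec n × Vec n)) := by
  refine hasMFDerivAt_of_hasDerivAt (γ := fun t ↦ (⟨v.1, y t⟩ : TangentBundle (𝓡 n) M))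
    (contMDiff_fibreCurve v hy).continuous.continuousAt ?_
  have h1 : (fun s ↦ tchart ⟨v.1, y t⟩ (⟨v.1, y s⟩ : TangentBundle (𝓡 n) M)) =
      fun s ↦ (extChartAt (𝓡 n) v.1 v.1, y s) := by
    funext s
    refine (tchart_apply ⟨v.1, y t⟩ ⟨v.1, y s⟩ (mem_extChartAt_source v.1)).trans ?_
    exact Prod.ext rfl (dchart_self v.1 (y s))
  have h2 : HasDerivAt (fun s ↦ (extChartAt (𝓡 n) v.1 v.1, y s)) ((0 : Vec n), y') t :=
    (hasDerivAt_const t _).prodMk hd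
  exact h1 ▸ h2

/-- The radial half-lines are tangent to `𝒟`. -/
theorem isLeafCurve_radial (Γ : VField n M) {v : TangentBundle (𝓡 n) M} (hv : v ∈ slit univ) :
    IsLeafCurve Γ (fun t ↦ ⟨v.1, Real.exp t • v.2⟩) := by
  let y₀ : Vec n := v.2
  have hy := contDiff_exp_smul y₀
  refine ⟨contMDiff_fibreCurve v hy, fun t ↦ ⟨mem_univ _, smul_ne_zero (Real.exp_pos t).ne' hv.2⟩,
    fun t ↦ ⟨1, 0, ?_⟩⟩
  have h1 := hasMFDerivAt_fibreCurve v hy (hasDerivAt_exp_smul y₀ t)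
  have h2 : ((0 : Vec n), Real.exp t • y₀) =
      (1 : ℝ) • fieldVal liouville ⟨v.1, Real.exp t • v.2⟩ +
        (0 : ℝ) • fieldVal Γ ⟨v.1, Real.exp t • v.2⟩ := by
    rw [one_smul, zero_smul, add_zero, fieldVal_liouville]
    rfl
  exact h2 ▸ h1

end Leaves

/-! ### The path space -/

section PathSpace

variable {n : ℕ} {M : Type*} [TopologicalSpace M] [ChartedSpace (EuclideanSpace ℝ (Fin n)) M]
  [IsManifold (𝓡 n) ∞ M]
  {P : Type*} [TopologicalSpace P] [ChartedSpace (EuclideanSpace ℝ (Fin (2 * n - 2))) P]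
  [IsManifold (𝓡 (2 * n - 2)) ∞ P]

/-- The differential of a map on `TM`, as a map of the model spaces. -/
noncomputable def dpath (π : TangentBundle (𝓡 n) M → P) (v : TangentBundle (𝓡 n) M) :
    Vec n × Vec n →L[ℝ] Vec (2 * n - 2) := mfderiv (𝓡 n).tangent (𝓡 (2 * n - 2)) π v

theorem IsPathSpace.mdifferentiableAt {Γ : VField n M} {π : TangentBundle (𝓡 n) M → P}
    (hπ : IsPathSpace Γ π) {v : TangentBundle (𝓡 n) M} (hv : v ∈ slit univ) :
    MDifferentiableAt (𝓡 n).tangent (𝓡 (2 * n - 2)) π v :=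
  (hπ.smooth.contMDiffAt ((isOpen_slit isOpen_univ).mem_nhds hv)).mdifferentiableAt (by simp)

theorem IsPathSpace.eq_of_isLeafCurve {Γ : VField n M} {π : TangentBundle (𝓡 n) M → P}
    (hπ : IsPathSpace Γ π) {γ : ℝ → TangentBundle (𝓡 n) M} (h : IsLeafCurve Γ γ) (s t : ℝ) :
    π (γ s) = π (γ t) :=
  (hπ.fibres _ (h.mem_slit s) _ (h.mem_slit t)).2 (h.sameLeaf s t)

theorem IsPathSpace.dpath_velocity {Γ : VField n M} {π : TangentBundle (𝓡 n) M → P}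
    (hπ : IsPathSpace Γ π) {γ : ℝ → TangentBundle (𝓡 n) M} (h : IsLeafCurve Γ γ) {t : ℝ}
    {X : Vec n × Vec n}
    (hX : HasMFDerivAt 𝓘(ℝ, ℝ) (𝓡 n).tangent γ t ((1 : ℝ →L[ℝ] ℝ).smulRight X)) :
    dpath π (γ t) X = 0 := by
  have h1 := HasMFDerivAt.comp t (hπ.mdifferentiableAt (h.mem_slit t)).hasMFDerivAt hX
  have h2 : π ∘ γ = fun _ ↦ π (γ t) := funext fun s ↦ hπ.eq_of_isLeafCurve h s t
  rw [h2] at h1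
  have h3 := hasMFDerivAt_unique h1 (hasMFDerivAt_const _ _)
  have h4 := congrArg (fun L : ℝ →L[ℝ] Vec (2 * n - 2) ↦ L 1) h3
  refine Eq.trans ?_ h4
  exact congrArg (dpath π (γ t)) (one_smul ℝ X).symm

theorem IsPathSpace.dpath_liouville {Γ : VField n M} {π : TangentBundle (𝓡 n) M → P}
    (hπ : IsPathSpace Γ π) {v : TangentBundle (𝓡 n) M} (hv : v ∈ slit univ) :
    dpath π v (fieldVal liouville v) = 0 := by
  let y₀ : Vec n := v.2
  have h1 := hπ.dpath_velocity (isLeafCurve_radial Γ hv)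
    (hasMFDerivAt_fibreCurve v (contDiff_exp_smul y₀) (hasDerivAt_exp_smul y₀ 0))
  have h2 : Real.exp 0 • y₀ = y₀ := by rw [Real.exp_zero, one_smul]
  have h3 : (⟨v.1, Real.exp 0 • v.2⟩ : TangentBundle (𝓡 n) M) = v := tangentBundle_ext rfl h2
  have h4 : dpath π (⟨v.1, Real.exp 0 • v.2⟩ : TangentBundle (𝓡 n) M) (0, y₀) = 0 := by
    rw [← h2]; exact h1
  rw [h3] at h4
  exact (congrArg (dpath π v) (fieldVal_liouville v)).trans h4

theorem IsPathSpace.dpath_spray {Γ : VField n M} (hΓ : IsSpray univ Γ)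
    {π : TangentBundle (𝓡 n) M → P}
    (hπ : IsPathSpace Γ π) {v : TangentBundle (𝓡 n) M} (hv : v ∈ slit univ) :
    dpath π v (fieldVal Γ v) = 0 := by
  obtain ⟨γ, J, hJ, -, h0, h0v, hγ, hγU⟩ := exists_integralCurve isOpen_univ hΓ hv
  obtain ⟨δ, hδ, hδJ⟩ := Metric.isOpen_iff.1 hJ 0 h0
  -- the time change is bounded, so that the reparametrized curve is defined on the whole line
  let r : ℝ → ℝ := fun s ↦ δ / 2 * Real.sin s
  have hr : ContDiff ℝ ∞ r := contDiff_const.mul Real.contDiff_sin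
  have hrJ : ∀ s, r s ∈ J := fun s ↦ hδJ <| by
    rw [mem_ball_zero_iff, Real.norm_eq_abs, abs_mul, abs_of_pos (half_pos hδ)]
    have := Real.abs_sin_le_one s
    nlinarith [abs_nonneg (Real.sin s)]
  have h1 := isLeafCurve_of_integralCurve hΓ hJ hγ hγU hr hrJ
  have hr0 : r 0 = 0 := by simp [r]
  have hrd : HasDerivAt r (δ / 2) 0 := by
    have := (Real.hasDerivAt_sin 0).const_mul (δ / 2)
    rwa [Real.cos_zero, mul_one] at this
  have h3 := hπ.dpath_velocity h1 (t := 0) (hasMFDerivAt_comp_real (X := fieldVal Γ (γ (r 0)))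
    (hasMFDerivAt_of_integralCurve hJ hγ (hrJ 0)) hrd)
  have h6 : dpath π v ((δ / 2) • fieldVal Γ v) = 0 := by
    rw [Function.comp_apply, hr0, h0v] at h3
    exact h3
  rw [map_smul] at h6
  exact (smul_eq_zero.1 h6).resolve_left (half_pos hδ).ne'

/-- The kernel of the differential of `π` is the distribution `𝒟`. -/
theorem IsPathSpace.dpath_eq_zero_iff (hn : 2 ≤ n) {Γ : VField n M} (hΓ : IsSpray univ Γ)
    {π : TangentBundle (𝓡 n) M → P}
    (hπ : IsPathSpace Γ π) {v : TangentBundle (𝓡 n) M} (hv : v ∈ slit univ) (X : Vec n × Vec n) :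
    dpath π v X = 0 ↔ ∃ a b : ℝ, X = a • fieldVal liouville v + b • fieldVal Γ v := by
  constructor
  · intro hX
    have hle : Submodule.span ℝ {fieldVal liouville v, fieldVal Γ v} ≤
        LinearMap.ker (dpath π v).toLinearMap := by
      rw [Submodule.span_le]
      rintro _ (rfl | rfl)
      · exact hπ.dpath_liouville hv
      · exact hπ.dpath_spray hΓ hv
    have hli : LinearIndependent ℝ ![fieldVal liouville v, fieldVal Γ v] := by
      refine LinearIndependent.pair_iff.2 fun a b hab ↦ ?_
      have h1 := congrArg Prod.fst hab
      rw [Prod.fst_add, Prod.smul_fst, Prod.smul_fst, liouville_fst, smul_zero, zero_add,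
        hΓ.fst hv] at h1
      have hb : b = 0 := (smul_eq_zero.1 h1).resolve_right hv.2
      have h2 := congrArg Prod.snd hab
      rw [hb, zero_smul, add_zero, Prod.smul_snd, liouville_snd] at h2
      exact ⟨(smul_eq_zero.1 h2).resolve_right hv.2, hb⟩
    have h1 : Module.finrank ℝ (Submodule.span ℝ {fieldVal liouville v, fieldVal Γ v}) = 2 := by
      have := finrank_span_eq_card hli
      rw [Matrix.range_cons, Matrix.range_cons, Matrix.range_empty, union_empty,
        singleton_union] at this
      simpa using this
    -- the kernel has dimension `2 n - (2 n - 2) = 2`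
    have h2 := LinearMap.finrank_range_add_finrank_ker (dpath π v).toLinearMap
    have h3 : LinearMap.range (dpath π v).toLinearMap = ⊤ :=
      LinearMap.range_eq_top.2 (hπ.submersion v hv)
    rw [h3, finrank_top, Module.finrank_prod, finrank_euclideanSpace_fin,
      finrank_euclideanSpace_fin] at h2
    have h4 := Submodule.eq_of_le_of_finrank_eq hle (by omega)
    have h5 : X ∈ Submodule.span ℝ {fieldVal liouville v, fieldVal Γ v} := by rw [h4]; exact hX
    obtain ⟨a, b, hab⟩ := Submodule.mem_span_pair.1 h5
    exact ⟨a, b, hab.symm⟩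
  · rintro ⟨a, b, rfl⟩
    rw [map_add, map_smul, map_smul, hπ.dpath_liouville hv, hπ.dpath_spray hΓ hv]
    simp

/-- The fibres of `π` are connected. -/
theorem IsPathSpace.joinedInFibre {Γ : VField n M} {π : TangentBundle (𝓡 n) M → P}
    (hπ : IsPathSpace Γ π) {v w : TangentBundle (𝓡 n) M} (hv : v ∈ slit univ)
    (hw : w ∈ slit univ) (h : π v = π w) :
    Relation.ReflTransGen (JoinedInFibre (𝓡 n).tangent π (slit univ)) v w := by
  obtain ⟨γ, hγ, h0, h1, hD⟩ := (hπ.fibres v hv w hw).1 h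
  have hl := isLeafCurve_of_sameLeaf hγ hD
  refine Relation.ReflTransGen.single ⟨γ, fun t ↦ ⟨hl.mem_slit t,
    hγ.mdifferentiableAt (by simp), ?_⟩, h0, h1⟩
  rw [hπ.eq_of_isLeafCurve hl t 0, h0]

theorem joinedInFibre_proj_of_linearIndependent (x : M) {y y' : Vec n}
    (h : LinearIndependent ℝ ![y, y']) :
    JoinedInFibre (𝓡 n).tangent (fun w : TangentBundle (𝓡 n) M ↦ w.1) (slit univ)
      ⟨x, y⟩ ⟨x, y'⟩ := by
  refine ⟨fun t ↦ ⟨x, (1 - t) • y + t • y'⟩, fun t ↦ ⟨⟨mem_univ _, fun h0 ↦ ?_⟩, ?_, rfl⟩,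
    tangentBundle_ext rfl (by simp), tangentBundle_ext rfl (by simp)⟩
  · have h1 := LinearIndependent.pair_iff.1 h _ _ h0
    linarith [h1.1, h1.2]
  · have hy : ContDiff ℝ ∞ fun t : ℝ ↦ (1 - t) • y + t • y' := by fun_prop
    exact (contMDiff_fibreCurve (⟨x, y⟩ : TangentBundle (𝓡 n) M) hy).mdifferentiableAt (by simp)

/-- Two nonzero vectors on one line can be joined by way of a vector outside that line. -/
theorem exists_linearIndependent_intermediate (hn : 2 ≤ n) {y y' : Vec n} (hy : y ≠ 0)
    (hy' : y' ≠ 0) (hli : ¬ LinearIndependent ℝ ![y, y']) :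
    ∃ u : Vec n, LinearIndependent ℝ ![y, u] ∧ LinearIndependent ℝ ![u, y'] := by
  obtain ⟨u, hu⟩ : ∃ u : Vec n, u ∉ Submodule.span ℝ {y} := by
    by_contra hcon
    push Not at hcon
    have h1 := finrank_span_singleton (K := ℝ) hy
    rw [(Submodule.eq_top_iff'.2 hcon), finrank_top, finrank_euclideanSpace_fin] at h1
    omega
  obtain ⟨a, ha⟩ : ∃ a : ℝ, y' = a • y := by
    by_contra hcon
    push Not at hcon
    exact hli ((LinearIndependent.pair_iff' hy).2 fun a ha ↦ hcon a ha.symm)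
  refine ⟨u, (LinearIndependent.pair_iff' hy).2 fun b hb ↦
    hu (Submodule.mem_span_singleton.2 ⟨b, hb⟩), ?_⟩
  exact LinearIndependent.pair_symm_iff.1 ((LinearIndependent.pair_iff' hy').2 fun b hb ↦
    hu (Submodule.mem_span_singleton.2 ⟨b * a, by rw [mul_smul, ← ha, hb]⟩))

/-- The slit tangent spaces are connected. -/
theorem joinedInFibre_proj (hn : 2 ≤ n) {v w : TangentBundle (𝓡 n) M} (hv : v ∈ slit univ)
    (hw : w ∈ slit univ) (h : v.1 = w.1) :
    Relation.ReflTransGen (JoinedInFibre (𝓡 n).tangent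
      (fun w : TangentBundle (𝓡 n) M ↦ w.1) (slit univ)) v w := by
  obtain ⟨x, y⟩ := v
  obtain ⟨x', y'⟩ := w
  obtain rfl : x = x' := h
  by_cases hli : LinearIndependent ℝ ![(y : Vec n), y']
  · exact Relation.ReflTransGen.single (joinedInFibre_proj_of_linearIndependent x hli)
  · obtain ⟨u, h1, h2⟩ := exists_linearIndependent_intermediate hn hv.2 hw.2 hli
    exact (Relation.ReflTransGen.single (joinedInFibre_proj_of_linearIndependent x h1)).tail
      (joinedInFibre_proj_of_linearIndependent x h2)

end PathSpace

/-! ### Local nature of smoothness and closedness -/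

section LocalForms

variable {E : Type*} [NormedAddCommGroup E] [NormedSpace ℝ E]
  {H : Type*} [TopologicalSpace H] {I : ModelWithCorners ℝ E H}
  {N : Type*} [TopologicalSpace N] [ChartedSpace H N]

theorem formInChart_congr {k : ℕ} {σ τ : DForm I N k} {p : N} {z : E}
    (h : σ ((extChartAt I p).symm z) = τ ((extChartAt I p).symm z)) :
    formInChart I σ p z = formInChart I τ p z := by
  simp only [formInChart, h]

theorem eventuallyEq_formInChart [I.Boundaryless] [IsManifold I ∞ N] {k : ℕ} {O : Set N}
    (hO : IsOpen O) {σ τ : DForm I N k} (h : ∀ v ∈ O, σ v = τ v)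
    {p v : N} (hv : v ∈ (extChartAt I p).source) (hvO : v ∈ O) :
    formInChart I σ p =ᶠ[nhds (extChartAt I p v)] formInChart I τ p :=
  eventually_chart_id hO hvO hv fun w hw hwp ↦
    formInChart_congr (by rw [(extChartAt I p).left_inv hwp]; exact h w hw)

theorem smoothFormOn_of_locally_eq [I.Boundaryless] [IsManifold I ∞ N] {k : ℕ} {O : Set N}
    {τ : DForm I N k}
    (h : ∀ v ∈ O, ∃ O' : Set N, IsOpen O' ∧ v ∈ O' ∧ ∃ σ : DForm I N k,
      SmoothFormOn I O' σ ∧ ∀ w ∈ O', τ w = σ w) : SmoothFormOn I O τ := by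
  intro p v hv hvO
  obtain ⟨O', hO', hvO', σ, hσ, he⟩ := h v hvO
  exact (hσ p v hv hvO').congr_of_eventuallyEq (eventuallyEq_formInChart hO' he hv hvO')

theorem closedFormOn_of_locally_eq [I.Boundaryless] [IsManifold I ∞ N] {k : ℕ} {O : Set N}
    {τ : DForm I N k}
    (h : ∀ v ∈ O, ∃ O' : Set N, IsOpen O' ∧ v ∈ O' ∧ ∃ σ : DForm I N k,
      ClosedFormOn I O' σ ∧ ∀ w ∈ O', τ w = σ w) : ClosedFormOn I O τ := by
  intro p v hv hvO
  obtain ⟨O', hO', hvO', σ, hσ, he⟩ := h v hvO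
  rw [(eventuallyEq_formInChart hO' he hv hvO').extDeriv_eq]
  exact hσ p v hv hvO'

end LocalForms

/-! ### Path forms and symplectic forms on the path space -/

section PathForms

variable {n : ℕ} {M : Type*} [TopologicalSpace M] [ChartedSpace (EuclideanSpace ℝ (Fin n)) M]
  [IsManifold (𝓡 n) ∞ M]

/-- The 2-forms on the slit tangent bundle that are candidates for the Hilbert 2-form of a
pseudo-Finsler function with geodesic class the class of `Γ`: they are closed, they vanish on pairs
of vertical vectors, and their kernel is `𝒟`. -/
structure IsPathForm (Γ : VField n M)
    (τ : DForm (𝓡 n).tangent (TangentBundle (𝓡 n) M) 2) : Prop where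
  smooth : SmoothFormOn (𝓡 n).tangent (slit univ) τ
  closed : ClosedFormOn (𝓡 n).tangent (slit univ) τ
  vertical : ∀ v ∈ slit univ, ∀ w w' : Vec n, formVal τ v ![(0, w), (0, w')] = 0
  kernel : ∀ v ∈ slit univ, ∀ X, (∀ Y, formVal τ v ![X, Y] = 0) ↔
    ∃ a b : ℝ, X = a • fieldVal liouville v + b • fieldVal Γ v

theorem IsPathForm.spray {Γ : VField n M} {τ : DForm (𝓡 n).tangent (TangentBundle (𝓡 n) M) 2}
    (hτ : IsPathForm Γ τ) {v : TangentBundle (𝓡 n) M} (hv : v ∈ slit univ) (Y : Vec n × Vec n) :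
    formVal τ v ![fieldVal Γ v, Y] = 0 :=
  (hτ.kernel v hv _).2 ⟨0, 1, by rw [zero_smul, one_smul, zero_add]⟩ Y

theorem IsPathForm.liouville {Γ : VField n M}
    {τ : DForm (𝓡 n).tangent (TangentBundle (𝓡 n) M) 2}
    (hτ : IsPathForm Γ τ) {v : TangentBundle (𝓡 n) M} (hv : v ∈ slit univ) (Y : Vec n × Vec n) :
    formVal τ v ![fieldVal liouville v, Y] = 0 :=
  (hτ.kernel v hv _).2 ⟨1, 0, by rw [zero_smul, one_smul, add_zero]⟩ Y

/-- A homogeneous function that has the 2-form `τ` as its Hilbert 2-form is a pseudo-Finsler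
function for the class of `Γ`. -/
theorem IsPathForm.isMetrizedBy {Γ : VField n M}
    {τ : DForm (𝓡 n).tangent (TangentBundle (𝓡 n) M) 2}
    (hτ : IsPathForm Γ τ) (hΓ : IsSpray univ Γ) {U : Set M} (hU : IsOpen U)
    {F : TangentBundle (𝓡 n) M → ℝ}
    (hF : ContMDiffOn (𝓡 n).tangent 𝓘(ℝ, ℝ) ∞ F (slit U))
    (hh : ∀ v ∈ slit (n := n) U, ∀ s : ℝ, 0 < s → F ⟨v.1, s • v.2⟩ = s * F v)
    (he : ∀ v ∈ slit U, hilbertTwoForm F v = τ v) : IsMetrizedBy U Γ F := by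
  have hΓU := hΓ.mono (subset_univ U)
  have he' : ∀ v ∈ slit U, formVal (hilbertTwoForm F) v = formVal τ v := he
  have hsub : ∀ v ∈ slit (n := n) U, v ∈ slit univ := fun v hv ↦ ⟨mem_univ _, hv.2⟩
  refine (isMetrizedBy_iff hU hΓU).2
    ⟨isPseudoFinsler_of_kernel hU hF hh hΓU fun v hv X hX ↦ ?_, fun v hv Y ↦ ?_⟩
  · rw [he' v hv] at hX
    exact (hτ.kernel v (hsub v hv) X).1 hX
  · rw [he' v hv]
    exact hτ.spray (hsub v hv) Y

/-- Local pseudo-Finsler functions with a common Hilbert 2-form give a global form `τ`. The second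
assertion, a consequence of quasi-regularity, says that the vertical subspaces are maximal isotropic
modulo `Γ`. -/
theorem isPathForm_of_sameHilbertTwoForm {Γ : VField n M} (hΓ : IsSpray univ Γ) {U : M → Set M}
    {F : M → TangentBundle (𝓡 n) M → ℝ}
    (h : ∀ x, IsOpen (U x) ∧ x ∈ U x ∧ IsMetrizedBy (U x) Γ (F x))
    (hs : ∀ x x', SameHilbertTwoForm (U x ∩ U x') (F x) (F x')) :
    ∃ τ : DForm (𝓡 n).tangent (TangentBundle (𝓡 n) M) 2, IsPathForm Γ τ ∧
      ∀ v ∈ slit (n := n) univ, ∀ X : Vec n × Vec n,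
        (∀ w, formVal τ v ![(0, w), X] = 0) → ∃ k : ℝ, X.1 = k • (v.2 : Vec n) := by
  let τ : DForm (𝓡 n).tangent (TangentBundle (𝓡 n) M) 2 := fun v ↦ hilbertTwoForm (F v.1) v
  have hx : ∀ x, IsPseudoFinsler (U x) (F x) ∧
      ∀ v ∈ slit (U x), ∀ Y, formVal (hilbertTwoForm (F x)) v ![fieldVal Γ v, Y] = 0 := fun x ↦
    (isMetrizedBy_iff (h x).1 (hΓ.mono (subset_univ _))).1 (h x).2.2
  have hloc : ∀ x, ∀ v ∈ slit (U x), τ v = hilbertTwoForm (F x) v := fun x v hv ↦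
    hs v.1 x v _ (mem_extChartAt_target v)
      (by rw [extChartAt_to_inv]; exact ⟨⟨(h v.1).2.1, hv.1⟩, hv.2⟩)
  have hself : ∀ v ∈ slit (n := n) univ, v ∈ slit (U v.1) := fun v hv ↦ ⟨(h v.1).2.1, hv.2⟩
  have hsm := fun x ↦ smoothFormOn_hilbertOneForm (h x).1 (hx x).1.smooth
  refine ⟨τ, ⟨?_, ?_, fun v hv w w' ↦ ?_, fun v hv X ↦ ?_⟩, fun v hv X hX ↦ ?_⟩
  · exact smoothFormOn_of_locally_eq fun v hv ↦ ⟨slit (U v.1), isOpen_slit (h v.1).1, hself v hv,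
      hilbertTwoForm (F v.1), (hsm v.1).extDerivForm (isOpen_slit (h v.1).1), hloc v.1⟩
  · exact closedFormOn_of_locally_eq fun v hv ↦ ⟨slit (U v.1), isOpen_slit (h v.1).1, hself v hv,
      hilbertTwoForm (F v.1), closedFormOn_extDerivForm (isOpen_slit (h v.1).1) (hsm v.1),
      hloc v.1⟩
  · refine (formVal_hilbertTwoForm_vertical (h v.1).1 (hx v.1).1.smooth (hself v hv) w
      (0, w')).trans ?_
    exact map_zero _
  · exact (hx v.1).1.mem_kernel_iff (h v.1).1 (hΓ.mono (subset_univ _)) (hx v.1).2 (hself v hv) X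
  · refine ((hx v.1).1.quasiRegular v (hself v hv) X.1).1 fun w ↦ ?_
    rw [fibreHessian_symm (h v.1).1 (hx v.1).1.smooth (hself v hv),
      ← formVal_hilbertTwoForm_vertical (h v.1).1 (hx v.1).1.smooth (hself v hv)]
    exact hX w

variable {P : Type*} [TopologicalSpace P] [ChartedSpace (EuclideanSpace ℝ (Fin (2 * n - 2))) P]
  [IsManifold (𝓡 (2 * n - 2)) ∞ P]

theorem mem_hatTangent_iff {π : TangentBundle (𝓡 n) M → P} {v : TangentBundle (𝓡 n) M}
    {ξ : Vec (2 * n - 2)} : ξ ∈ hatTangent π v ↔ ∃ w : Vec n, dpath π v (0, w) = ξ := by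
  constructor
  · rintro ⟨X, hX, rfl⟩
    have h1 : (X : Vec n × Vec n).1 = 0 := (dproj_apply v X).symm.trans hX
    refine ⟨(X : Vec n × Vec n).2, ?_⟩
    exact congrArg (dpath π v) (Prod.ext h1.symm rfl)
  · rintro ⟨w, rfl⟩
    exact ⟨((0, w) : Vec n × Vec n), dproj_apply v (0, w), rfl⟩

/-- The value of a 2-form on the path space, as a form on the model space. -/
def pathFormVal (Ω : DForm (𝓡 (2 * n - 2)) P 2) (q : P) :
    Vec (2 * n - 2) [⋀^Fin 2]→L[ℝ] ℝ := Ω q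

/-- The pullback to the slit tangent bundle of a symplectic form for which all `x̂` are
Lagrangian is a path form. -/
theorem IsPathSpace.isPathForm_pullback (hn : 2 ≤ n) {Γ : VField n M} (hΓ : IsSpray univ Γ)
    {π : TangentBundle (𝓡 n) M → P} (hπ : IsPathSpace Γ π)
    {Ω : DForm (𝓡 (2 * n - 2)) P 2} (hΩ : IsSymplectic (𝓡 (2 * n - 2)) Ω)
    (hL : ∀ x : M, HatIsLagrangian π Ω x) :
    IsPathForm Γ (pullbackForm (𝓡 n).tangent (𝓡 (2 * n - 2)) π Ω) := by
  have hO : IsOpen (slit (n := n) (M := M) univ) := isOpen_slit isOpen_univ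
  have hval : ∀ v X Y, formVal (pullbackForm (𝓡 n).tangent (𝓡 (2 * n - 2)) π Ω) v ![X, Y] =
      pathFormVal Ω (π v) ![dpath π v X, dpath π v Y] := fun v X Y ↦
    compContinuousLinearMap_pair (pathFormVal Ω (π v)) (dpath π v) X Y
  have hsm : ∀ q, ContDiffAt ℝ ∞ (formInChart (𝓡 (2 * n - 2)) Ω q)
      (extChartAt (𝓡 (2 * n - 2)) q q) := fun q ↦
    (hΩ.smooth q).contDiffAt ((isOpen_extChartAt_target q).mem_nhds (mem_extChartAt_target q))
  refine ⟨fun p v hv hvO ↦ ?_, fun p v hv hvO ↦ ?_, fun v hv w w' ↦ ?_, fun v hv X ↦ ?_⟩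
  · exact contDiffAt_formInChart_of_pullback hO hπ.smooth (fun _ _ ↦ rfl) hvO hv
      (mem_extChartAt_source (π v)) (hsm _)
  · rw [extDeriv_formInChart_of_pullback hO hπ.smooth (fun _ _ ↦ rfl) hvO hv
      (mem_extChartAt_source (π v)) ((hsm _).differentiableAt (by simp)),
      hΩ.closed _ _ (mem_extChartAt_target _), formInChart_zero]
    ext m; rfl
  · rw [hval]
    exact (hL v.1 v ⟨rfl, hv.2⟩ _).1 (mem_hatTangent_iff.2 ⟨w, rfl⟩) _
      (mem_hatTangent_iff.2 ⟨w', rfl⟩)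
  · rw [← hπ.dpath_eq_zero_iff hn hΓ hv]
    constructor
    · intro h
      refine hΩ.nondegenerate (π v) (dpath π v X) fun η ↦ ?_
      obtain ⟨Y, rfl⟩ := hπ.submersion v hv η
      exact (hval v X Y).symm.trans (h Y)
    · intro h Y
      rw [hval, h]
      have := alternating_smul_left (pathFormVal Ω (π v)) 0 0 (dpath π v Y)
      rwa [zero_smul, zero_mul] at this

/-- The form `τ` descends to the path space, since its kernel is the kernel of `dπ` and the fibres
of `π` are connected. The hypothesis `hmax` that the vertical subspaces are maximal isotropic modulo
`Γ` makes the isotropic subspaces `x̂` Lagrangian. -/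
theorem IsPathSpace.hasLagrangianSymplecticForm (hn : 2 ≤ n) {Γ : VField n M}
    (hΓ : IsSpray univ Γ) {π : TangentBundle (𝓡 n) M → P} (hπ : IsPathSpace Γ π)
    {τ : DForm (𝓡 n).tangent (TangentBundle (𝓡 n) M) 2} (hτ : IsPathForm Γ τ)
    (hmax : ∀ v ∈ slit (n := n) univ, ∀ X : Vec n × Vec n,
      (∀ w, formVal τ v ![(0, w), X] = 0) → ∃ k : ℝ, X.1 = k • (v.2 : Vec n)) :
    HasLagrangianSymplecticForm π := by
  have hsurj : ∀ q : P, ∃ v ∈ slit (n := n) (M := M) univ, π v = q := fun q ↦ by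
    have := mem_univ q
    rwa [← hπ.surjective] at this
  obtain ⟨Ω, hΩs, hΩc, hΩ⟩ := exists_pullback_eq (J := 𝓡 (2 * n - 2)) (f := π)
    (isOpen_slit isOpen_univ) hπ.smooth
    hπ.submersion hπ.surjective (fun v hv w hw h ↦ hπ.joinedInFibre hv hw h) hτ.smooth hτ.closed
    (fun v hv X Y hX ↦ (hτ.kernel v hv X).2 ((hπ.dpath_eq_zero_iff hn hΓ hv X).1 hX) Y)
  have hval : ∀ v ∈ slit (n := n) (M := M) univ, ∀ X Y, formVal τ v ![X, Y] =
      pathFormVal Ω (π v) ![dpath π v X, dpath π v Y] := hΩ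
  refine ⟨Ω, ⟨hΩs, hΩc, fun q ξ hξ ↦ ?_⟩, fun x v hv ξ ↦ ?_⟩
  · obtain ⟨v, hv, rfl⟩ := hsurj q
    obtain ⟨X, rfl⟩ := hπ.submersion v hv ξ
    exact (hπ.dpath_eq_zero_iff hn hΓ hv X).2 ((hτ.kernel v hv X).1 fun Y ↦
      (hval v hv X Y).trans (hξ _))
  · have hv' : v ∈ slit (n := n) (M := M) univ := ⟨mem_univ _, hv.2⟩
    constructor
    · intro h η hη
      obtain ⟨w, rfl⟩ := mem_hatTangent_iff.1 h
      obtain ⟨w', rfl⟩ := mem_hatTangent_iff.1 hη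
      exact (hval v hv' _ _).symm.trans (hτ.vertical v hv' w w')
    · intro h
      obtain ⟨X, hX⟩ : ∃ X : Vec n × Vec n, dpath π v X = ξ := hπ.submersion v hv' ξ
      obtain ⟨k, hk⟩ := hmax v hv' X fun w ↦ by
        rw [alternating_swap, hval v hv']
        refine neg_eq_zero.2 ?_
        have h1 := h (dpath π v (0, w)) (mem_hatTangent_iff.2 ⟨w, rfl⟩)
        rw [← hX] at h1
        exact h1
      -- modulo the spray, `X` is vertical
      refine mem_hatTangent_iff.2 ⟨X.2 - k • (fieldVal Γ v).2, ?_⟩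
      have h2 : ((0 : Vec n), X.2 - k • (fieldVal Γ v).2) =
          X - k • fieldVal Γ v := by
        refine Prod.ext ?_ rfl
        rw [Prod.fst_sub, Prod.smul_fst, hΓ.fst hv', hk]
        exact (sub_self (k • (v.2 : Vec n))).symm
      rw [h2, map_sub, map_smul, hπ.dpath_spray hΓ hv', smul_zero, sub_zero]
      exact hX

end PathForms

/-! ### Local potentials of path forms -/

section LocalPotential

variable {n : ℕ} {M : Type*} [TopologicalSpace M] [ChartedSpace (EuclideanSpace ℝ (Fin n)) M]
  [IsManifold (𝓡 n) ∞ M]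

theorem eq_of_formInChart_eq {σ τ : DForm (𝓡 n).tangent (TangentBundle (𝓡 n) M) 2}
    {p v : TangentBundle (𝓡 n) M} (hv : v ∈ (tchart p).source)
    (h : ∀ X Y : Vec n × Vec n, formInChart (𝓡 n).tangent σ p (tchart p v) ![X, Y] =
      formInChart (𝓡 n).tangent τ p (tchart p v) ![X, Y]) : σ v = τ v := by
  have h1 : formVal σ ((tchart p).symm (tchart p v)) =
      formVal τ ((tchart p).symm (tchart p v)) := by
    refine alternating_two_ext fun X Y ↦ ?_
    obtain ⟨X, rfl⟩ := dtchartSymm_surjective ((tchart p).map_source hv) X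
    obtain ⟨Y, rfl⟩ := dtchartSymm_surjective ((tchart p).map_source hv) Y
    rw [← formInChart_eq_formVal, ← formInChart_eq_formVal]
    exact h X Y
  rw [(tchart p).left_inv hv] at h1
  exact h1

theorem dtchartSymm_vertical {p : TangentBundle (𝓡 n) M} {z : Vec n × Vec n}
    (hz : z ∈ (tchart p).target) (u : Vec n) :
    dtchartSymm p z (0, u) = (0, (dtchartSymm p z (0, u)).2) := by
  refine Prod.ext ?_ rfl
  exact (dproj_apply _ _).symm.trans ((dproj_dtchartSymm hz (0, u)).trans (map_zero _))

/-- Each point of `M` has a neighbourhood over which `τ` is the Hilbert 2-form of a positively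
homogeneous function. -/
theorem IsPathForm.exists_local_potential (hn : 3 ≤ n) {Γ : VField n M} (hΓ : IsSpray univ Γ)
    {τ : DForm (𝓡 n).tangent (TangentBundle (𝓡 n) M) 2} (hτ : IsPathForm Γ τ) (x : M) :
    ∃ (U : Set M) (F : TangentBundle (𝓡 n) M → ℝ), IsOpen U ∧ x ∈ U ∧
      ContMDiffOn (𝓡 n).tangent 𝓘(ℝ, ℝ) ∞ F (slit U) ∧
      (∀ v ∈ slit (n := n) U, ∀ s : ℝ, 0 < s → F ⟨v.1, s • v.2⟩ = s * F v) ∧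
      ∀ v ∈ slit U, hilbertTwoForm F v = τ v := by
  let p : TangentBundle (𝓡 n) M := ⟨x, 0⟩
  obtain ⟨r, hr, hrB⟩ := Metric.isOpen_iff.1 (isOpen_extChartAt_target (I := 𝓡 n) x) _
    (mem_extChartAt_target x)
  let B := Metric.ball (extChartAt (𝓡 n) x x) r
  let U : Set M := (extChartAt (𝓡 n) x).source ∩ extChartAt (𝓡 n) x ⁻¹' B
  have hU : IsOpen U :=
    (continuousOn_extChartAt x).isOpen_inter_preimage (isOpen_extChartAt_source x)
      Metric.isOpen_ball
  have hxU : x ∈ U := ⟨mem_extChartAt_source x, Metric.mem_ball_self hr⟩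
  have hsub : ∀ z ∈ B ×ˢ ({0}ᶜ : Set (Vec n)), z ∈ slitChart (M := M) univ p := fun z hz ↦
    ⟨hrB hz.1, mem_univ _, hz.2⟩
  have hO : IsOpen (B ×ˢ ({0}ᶜ : Set (Vec n))) := Metric.isOpen_ball.prod isOpen_compl_singleton
  have hinv : ∀ z ∈ B ×ˢ ({0}ᶜ : Set (Vec n)), tchart p ((tchart p).symm z) = z := fun z hz ↦
    (tchart p).right_inv (mem_target_of_mem_slitChart (hsub z hz))
  have hsrc : ∀ z ∈ B ×ˢ ({0}ᶜ : Set (Vec n)), (tchart p).symm z ∈ (tchart p).source :=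
    fun z hz ↦ (tchart p).map_target (mem_target_of_mem_slitChart (hsub z hz))
  let σ := formInChart (𝓡 n).tangent τ p
  have hvert : ∀ z ∈ B ×ˢ ({0}ᶜ : Set (Vec n)), ∀ u v : Vec n, σ z ![(0, u), (0, v)] = 0 := by
    intro z hz u v
    have hz' := mem_target_of_mem_slitChart (hsub z hz)
    refine (formInChart_eq_formVal τ p z _ _).trans ?_
    rw [dtchartSymm_vertical hz' u, dtchartSymm_vertical hz' v]
    exact hτ.vertical _ (symm_mem_slit (hsub z hz)) _ _
  obtain ⟨F, hF, hFh, hFσ⟩ := exists_hilbert_potential (E := Vec n) (by simp; omega)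
    Metric.isOpen_ball ((convex_ball (extChartAt (𝓡 n) x x) r).starConvex
      (Metric.mem_ball_self hr)) (σ := σ)
    (fun z hz ↦ by
      have h1 := hτ.smooth p _ (hsrc z hz) (symm_mem_slit (hsub z hz))
      rw [hinv z hz] at h1
      exact h1.contDiffWithinAt)
    (fun z hz ↦ by
      have h1 := hτ.closed p _ (hsrc z hz) (symm_mem_slit (hsub z hz))
      rwa [hinv z hz] at h1)
    hvert
    (fun z hz u ↦ by
      refine (formInChart_eq_formVal τ p z _ _).trans ?_
      have h1 := dtchartSymm_fieldInChart (PathGeometry.liouville : VField n M)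
        (mem_target_of_mem_slitChart (hsub z hz))
      rw [fieldInChart_liouville (mem_target_of_mem_slitChart (hsub z hz))] at h1
      rw [h1]
      exact hτ.liouville (symm_mem_slit (hsub z hz)) _)
    (fun z hz u ↦ by
      -- modulo a vertical vector, `(y, 0)` is the spray
      have h1 : (z.2, (0 : Vec n)) =
          fieldInChart Γ p z + (-1 : ℝ) • (0, (fieldInChart Γ p z).2) := by
        refine Prod.ext ?_ ?_
        · rw [Prod.fst_add, hΓ.fieldInChart_fst (hsub z hz), Prod.smul_fst, smul_zero, add_zero]
        · rw [Prod.snd_add, Prod.smul_snd, neg_one_smul, add_neg_cancel]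
      rw [h1, alternating_add_right, alternating_smul_right, hvert z hz, alternating_swap]
      have h2 : σ z ![fieldInChart Γ p z, (0, u)] = 0 := by
        refine (formInChart_eq_formVal τ p z _ _).trans ?_
        rw [dtchartSymm_fieldInChart Γ (mem_target_of_mem_slitChart (hsub z hz))]
        exact hτ.spray (symm_mem_slit (hsub z hz)) _
      rw [h2]
      simp)
  have hslit : ∀ v ∈ slit U, v ∈ (tchart p).source ∧ tchart p v ∈ B ×ˢ ({0}ᶜ : Set (Vec n)) := by
    intro v hv
    have hvs : v ∈ (tchart p).source := by rw [tchart_source]; exact hv.1.1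
    have h2 := tchart_mem_slitChart hvs hv
    refine ⟨hvs, ?_, h2.2.2⟩
    rw [tchart_apply p v hv.1.1]
    exact hv.1.2
  have heq : ∀ v ∈ slit U, funInChart (F ∘ tchart p) p =ᶠ[nhds (tchart p v)] F := by
    intro v hv
    filter_upwards [hO.mem_nhds (hslit v hv).2] with z hz
    simp only [funInChart, Function.comp_apply, hinv z hz]
  have hFs : ContMDiffOn (𝓡 n).tangent 𝓘(ℝ, ℝ) ∞ (F ∘ tchart p) (slit U) :=
    contMDiffOn_of_funInChart fun v hv ↦ ⟨p, (hslit v hv).1,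
      (hF.contDiffAt (hO.mem_nhds (hslit v hv).2)).congr_of_eventuallyEq (heq v hv)⟩
  refine ⟨U, F ∘ tchart p, hU, hxU, hFs, fun v hv s hs ↦ ?_, fun v hv ↦ ?_⟩
  · simp only [Function.comp_apply]
    rw [tchart_smul (hslit v hv).1]
    exact hFh _ (hslit v hv).2 s hs
  · refine eq_of_formInChart_eq (hslit v hv).1 fun X Y ↦ ?_
    rw [formInChart_hilbertTwoForm_apply hU hFs (tchart_mem_slitChart (hslit v hv).1 hv),
      (heq v hv).fderiv.fderiv_eq]
    exact (hFσ _ (hslit v hv).2 X Y).symm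

theorem sameHilbertTwoForm_of_eq {U₁ U₂ : Set M} (hU₁ : IsOpen U₁) (hU₂ : IsOpen U₂)
    {F₁ F₂ : TangentBundle (𝓡 n) M → ℝ}
    (h₁ : ContMDiffOn (𝓡 n).tangent 𝓘(ℝ, ℝ) ∞ F₁ (slit U₁))
    (h₂ : ContMDiffOn (𝓡 n).tangent 𝓘(ℝ, ℝ) ∞ F₂ (slit U₂))
    (h : ∀ v ∈ slit (n := n) (U₁ ∩ U₂), hilbertTwoForm F₁ v = hilbertTwoForm F₂ v) :
    SameHilbertTwoForm (U₁ ∩ U₂) F₁ F₂ := by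
  intro p z hz hzU
  have h3 := tchart_mem_slitChart ((tchart p).map_target hz) hzU
  have h4 : tchart p ((tchart p).symm z) = z := (tchart p).right_inv hz
  rw [h4] at h3
  rw [← formInChart_hilbertTwoForm hU₁ h₁ ⟨h3.1, h3.2.1.1, h3.2.2⟩,
    ← formInChart_hilbertTwoForm hU₂ h₂ ⟨h3.1, h3.2.1.2, h3.2.2⟩]
  exact formInChart_congr (h _ hzU)

end LocalPotential

/-! ### Partitions of unity on paracompact manifolds -/

section PartitionOfUnity

variable {E : Type*} [NormedAddCommGroup E] [NormedSpace ℝ E] [FiniteDimensional ℝ E]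
  {H : Type*} [TopologicalSpace H] {I : ModelWithCorners ℝ E H} [I.Boundaryless]
  {N : Type*} [TopologicalSpace N] [ChartedSpace H N] [IsManifold I ∞ N] [T2Space N]

/-- An open subset of the support of a bump function is itself the support of a smooth function. -/
theorem exists_contMDiff_support_eq_of_subset_support {c : N} (f : SmoothBumpFunction I c)
    {W : Set N} (hW : IsOpen W) (hWf : W ⊆ Function.support f) :
    ∃ g : N → ℝ, ContMDiff I 𝓘(ℝ, ℝ) ∞ g ∧ (∀ x, 0 ≤ g x) ∧ Function.support g = W := by
  have hT : IsOpen ((extChartAt I c).target ∩ (extChartAt I c).symm ⁻¹' W) :=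
    (continuousOn_extChartAt_symm c).isOpen_inter_preimage (isOpen_extChartAt_target c) hW
  obtain ⟨h, hs, hd, hr⟩ := hT.exists_contDiff_support_eq (n := ⊤)
  have hpos : ∀ z, 0 ≤ h z := fun z ↦ (hr (mem_range_self z)).1
  have hsrc : W ⊆ (extChartAt I c).source := fun x hx ↦ by
    rw [extChartAt_source]; exact f.support_subset_source (hWf hx)
  refine ⟨fun x ↦ f x • h (extChartAt I c x), f.contMDiff_smul ?_,
    fun x ↦ mul_nonneg f.nonneg (hpos _), ?_⟩
  · exact hd.contMDiff.comp_contMDiffOn contMDiffOn_extChartAt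
  · ext x
    rw [Function.mem_support, smul_eq_mul, mul_ne_zero_iff, ← Function.mem_support,
      ← Function.mem_support (f := h), hs]
    constructor
    · rintro ⟨hx, h1, h2⟩
      have hxs := f.support_subset_source hx
      rw [← extChartAt_source I] at hxs
      rwa [mem_preimage, (extChartAt I c).left_inv hxs] at h2
    · intro hx
      refine ⟨hWf hx, (extChartAt I c).map_source (hsrc hx), ?_⟩
      rwa [mem_preimage, (extChartAt I c).left_inv (hsrc hx)]

/-- Smooth partitions of unity on paracompact manifolds. There is no countability condition: the
covering by the supports of bump functions is refined to a locally finite one, and each set of the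
refinement is the support of a smooth function. -/
theorem exists_smoothPartitionOfUnity [ParacompactSpace N] {U : N → Set N}
    (hU : ∀ x, U x ∈ nhds x) :
    ∃ ρ : SmoothPartitionOfUnity N I N univ, ρ.IsSubordinate U := by
  have h1 : ∀ x, ∃ f : SmoothBumpFunction I x, tsupport f ⊆ U x := fun x ↦ by
    obtain ⟨f, -, hf⟩ := (SmoothBumpFunction.nhds_basis_tsupport (I := I) x).mem_iff.1 (hU x)
    exact ⟨f, hf⟩
  choose f hf using h1
  obtain ⟨W, hW, hWc, hWf, hWs⟩ := precise_refinement (fun x ↦ Function.support (f x))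
    (fun x ↦ (f x).continuous.isOpen_support)
    (iUnion_eq_univ_iff.2 fun x ↦ ⟨x, mem_of_mem_nhds (f x).support_mem_nhds⟩)
  have h2 := fun x ↦ exists_contMDiff_support_eq_of_subset_support (f x) (hW x) (hWs x)
  choose g hg hg0 hgs using h2
  have hlf : LocallyFinite fun x ↦ Function.support (g x) := by simpa only [hgs] using hWf
  -- normalization of the functions `g` by their sum
  let S : N → ℝ := fun x ↦ ∑ᶠ i, g i x
  have hS : ContMDiff I 𝓘(ℝ, ℝ) ∞ S := contMDiff_finsum hg hlf
  have hSpos : ∀ x, 0 < S x := fun x ↦ by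
    obtain ⟨i, hi⟩ := iUnion_eq_univ_iff.1 hWc x
    rw [← hgs i] at hi
    exact finsum_pos (fun i ↦ hg0 i x) ⟨i, lt_of_le_of_ne (hg0 i x) (Ne.symm hi)⟩
      (hlf.point_finite x)
  have hSinv : ContMDiff I 𝓘(ℝ, ℝ) ∞ fun x ↦ (S x)⁻¹ := hS.inv₀ fun x ↦ (hSpos x).ne'
  have hsum : ∀ x, ∑ᶠ i, (S x)⁻¹ * g i x = 1 := fun x ↦ by
    rw [← mul_finsum]
    exact inv_mul_cancel₀ (hSpos x).ne'
  have hsupp : ∀ i, Function.support (fun x ↦ (S x)⁻¹ * g i x) = Function.support (g i) := by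
    intro i
    ext x
    simp [(hSpos x).ne']
  let ρ : SmoothPartitionOfUnity N I N univ :=
    { toFun := fun i ↦ ⟨fun x ↦ (S x)⁻¹ * g i x, hSinv.mul (hg i)⟩
      locallyFinite' := by
        have h3 : (fun i ↦ Function.support fun x ↦ (S x)⁻¹ * g i x) =
            fun i ↦ Function.support (g i) := funext hsupp
        exact h3 ▸ hlf
      nonneg' := fun i x ↦ mul_nonneg (inv_nonneg.2 (hSpos x).le) (hg0 i x)
      sum_eq_one' := fun x _ ↦ hsum x
      sum_le_one' := fun x ↦ (hsum x).le }
  refine ⟨ρ, fun i ↦ ?_⟩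
  have h4 : Function.support (ρ i) = Function.support (g i) := hsupp i
  rw [tsupport, h4, hgs]
  exact (closure_mono (hWs i)).trans (hf i)

end PartitionOfUnity

/-! ### Gluing of functions on the tangent bundle -/

section Gluing

variable {n : ℕ} {M : Type*} [TopologicalSpace M] [ChartedSpace (EuclideanSpace ℝ (Fin n)) M]
  [IsManifold (𝓡 n) ∞ M]

theorem fderiv_fderiv_sum {E ι : Type*} [NormedAddCommGroup E] [NormedSpace ℝ E] (s : Finset ι)
    (c : ι → ℝ) {f : ι → E → ℝ} {y : E} (hf : ∀ i ∈ s, ContDiffAt ℝ ∞ (f i) y) :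
    fderiv ℝ (fderiv ℝ fun y ↦ ∑ i ∈ s, c i * f i y) y =
      ∑ i ∈ s, c i • fderiv ℝ (fderiv ℝ (f i)) y := by
  have h1 : ∀ᶠ z in nhds y, ∀ i ∈ s, DifferentiableAt ℝ (f i) z :=
    (Finset.eventually_all s).2 fun i hi ↦ by
      filter_upwards [((hf i hi).of_le (show (1 : ℕ∞ω) ≤ ∞ by simp)).eventually (by simp)]
        with z hz
      exact hz.differentiableAt one_ne_zero
  have h2 : (fderiv ℝ fun y ↦ ∑ i ∈ s, c i * f i y) =ᶠ[nhds y]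
      fun z ↦ ∑ i ∈ s, c i • fderiv ℝ (f i) z := by
    filter_upwards [h1] with z hz
    rw [fderiv_fun_sum fun i hi ↦ (hz i hi).const_mul (c i)]
    exact Finset.sum_congr rfl fun i hi ↦ fderiv_const_mul (hz i hi) (c i)
  have h3 : ∀ i ∈ s, DifferentiableAt ℝ (fderiv ℝ (f i)) y := fun i hi ↦
    ((hf i hi).fderiv_right (m := ∞) (by simp)).differentiableAt (by simp)
  rw [h2.fderiv_eq, fderiv_fun_sum fun i hi ↦ (h3 i hi).fun_const_smul (c i)]
  exact Finset.sum_congr rfl fun i hi ↦ fderiv_fun_const_smul (h3 i hi) (c i)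

/-- The restriction to a slit tangent space of a smooth function. -/
theorem contDiffAt_fibre {U : Set M} (hU : IsOpen U) {F : TangentBundle (𝓡 n) M → ℝ}
    (hF : ContMDiffOn (𝓡 n).tangent 𝓘(ℝ, ℝ) ∞ F (slit U)) {v : TangentBundle (𝓡 n) M}
    (hv : v ∈ slit U) : ContDiffAt ℝ ∞ (fun y : Vec n ↦ F ⟨v.1, y⟩) (v.2 : Vec n) := by
  have h1 : (fun y : Vec n ↦ F ⟨v.1, y⟩) =
      fun y ↦ funInChart F v (extChartAt (𝓡 n) v.1 v.1, y) := by
    funext y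
    exact congrArg F (tchart_symm_self v y).symm
  have h2 := contDiffAt_funInChart_self hU hF hv
  rw [h1]
  let y₀ : Vec n := v.2
  have h3 : ContDiffAt ℝ ∞ (fun y : Vec n ↦ (extChartAt (𝓡 n) v.1 v.1, y)) y₀ :=
    contDiffAt_const.prodMk contDiffAt_id
  have h4 : tchart v v = (extChartAt (𝓡 n) v.1 v.1, y₀) := tchart_self v
  rw [h4] at h2
  exact ContDiffAt.comp (g := funInChart F v) y₀ h2 h3

/-- The glued function `∑ ρ_i F_i`. -/
noncomputable def glue {ι : Type*} (ρ : ι → M → ℝ) (F : ι → TangentBundle (𝓡 n) M → ℝ) :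
    TangentBundle (𝓡 n) M → ℝ := fun v ↦ ∑ᶠ i, ρ i v.1 * F i v

variable [T2Space M]

/-- Near each point, the glued function is a finite sum with coefficients that add up to 1. -/
theorem exists_glue_eq {U : M → Set M} (hU : ∀ x, IsOpen (U x))
    (ρ : SmoothPartitionOfUnity M (𝓡 n) M univ) (hρ : ρ.IsSubordinate U)
    (F : M → TangentBundle (𝓡 n) M → ℝ) (x : M) :
    ∃ (s : Finset M) (O : Set M), IsOpen O ∧ x ∈ O ∧ (∀ i ∈ s, O ⊆ U i) ∧
      (∀ y ∈ O, ∑ i ∈ s, ρ i y = 1) ∧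
      ∀ v : TangentBundle (𝓡 n) M, v.1 ∈ O →
        glue (fun i ↦ ρ i) F v = ∑ i ∈ s, ρ i v.1 * F i v := by
  let s := ρ.fintsupport x
  have h1 : ∀ᶠ y in nhds x, ∀ i ∈ s, y ∈ U i := (Finset.eventually_all s).2 fun i hi ↦
    (hU i).eventually_mem (hρ i ((ρ.mem_fintsupport_iff x i).1 hi))
  obtain ⟨O, hO, hOo, hxO⟩ := eventually_nhds_iff.1
    (h1.and (ρ.eventually_finsupport_subset x))
  refine ⟨s, O, hOo, hxO, fun i hi y hy ↦ (hO y hy).1 i hi,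
    fun y hy ↦ ρ.sum_finsupport' y (mem_univ y) (hO y hy).2, fun v hv ↦ ?_⟩
  refine finsum_eq_sum_of_support_subset _ fun i hi ↦ ?_
  exact (hO v.1 hv).2 ((ρ.mem_finsupport v.1).2 (left_ne_zero_of_mul hi))

variable {U : M → Set M} (ρ : SmoothPartitionOfUnity M (𝓡 n) M univ)
  {F : M → TangentBundle (𝓡 n) M → ℝ}

theorem contMDiffOn_glue (hU : ∀ x, IsOpen (U x)) (hρ : ρ.IsSubordinate U)
    (hF : ∀ x, ContMDiffOn (𝓡 n).tangent 𝓘(ℝ, ℝ) ∞ (F x) (slit (U x))) :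
    ContMDiffOn (𝓡 n).tangent 𝓘(ℝ, ℝ) ∞ (glue (fun i ↦ ρ i) F) (slit univ) := by
  intro v hv
  obtain ⟨s, O, hO, hvO, hOU, -, he⟩ := exists_glue_eq hU ρ hρ F v.1
  have h1 : ContMDiffAt (𝓡 n).tangent 𝓘(ℝ, ℝ) ∞ (fun v ↦ ∑ i ∈ s, ρ i v.1 * F i v) v := by
    refine contMDiffAt_finsetSum fun i hi ↦ ContMDiffAt.mul ?_ ?_
    · exact ((ρ i).contMDiff.comp (Bundle.contMDiff_proj (TangentSpace (𝓡 n) (M := M)))) v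
    · exact (hF i).contMDiffAt ((isOpen_slit (hU i)).mem_nhds ⟨hOU i hi hvO, hv.2⟩)
  refine (h1.congr_of_eventuallyEq ?_).contMDiffWithinAt
  filter_upwards [(isOpen_slit hO).mem_nhds ⟨hvO, hv.2⟩] with w hw
  exact he w hw.1

theorem glue_homogeneous (hρ : ρ.IsSubordinate U)
    (hh : ∀ x, ∀ v ∈ slit (n := n) (U x), ∀ s : ℝ, 0 < s → F x ⟨v.1, s • v.2⟩ = s * F x v)
    {v : TangentBundle (𝓡 n) M} (hv : v ∈ slit univ) {s : ℝ} (hs : 0 < s) :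
    glue (fun i ↦ ρ i) F ⟨v.1, s • v.2⟩ = s * glue (fun i ↦ ρ i) F v := by
  simp only [glue]
  rw [mul_finsum]
  refine finsum_congr fun i ↦ ?_
  by_cases hi : v.1 ∈ U i
  · rw [hh i v ⟨hi, hv.2⟩ s hs]; ring
  · have h1 : ρ i v.1 = 0 := by
      by_contra h
      exact hi (hρ i (subset_tsupport _ h))
    rw [h1]; ring

/-- Gluing functions with the same fibre Hessian does not change the fibre Hessian. -/
theorem fibreHessian_glue (hU : ∀ x, IsOpen (U x)) (hρ : ρ.IsSubordinate U)
    (hF : ∀ x, ContMDiffOn (𝓡 n).tangent 𝓘(ℝ, ℝ) ∞ (F x) (slit (U x)))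
    {v : TangentBundle (𝓡 n) M} (hv : v ∈ slit univ) {w w' : Vec n} {r : ℝ}
    (hr : ∀ x, v.1 ∈ U x → fibreHessian (F x) v w w' = r) :
    fibreHessian (glue (fun i ↦ ρ i) F) v w w' = r := by
  obtain ⟨s, O, hO, hvO, hOU, hsum, he⟩ := exists_glue_eq hU ρ hρ F v.1
  have h1 : (fun y : Vec n ↦ glue (fun i ↦ ρ i) F ⟨v.1, y⟩) =
      fun y ↦ ∑ i ∈ s, ρ i v.1 * F i ⟨v.1, y⟩ := funext fun y ↦ he ⟨v.1, y⟩ hvO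
  have h2 := fderiv_fderiv_sum s (fun i ↦ ρ i v.1) (f := fun i (y : Vec n) ↦ F i ⟨v.1, y⟩)
    (y := (v.2 : Vec n)) fun i hi ↦ contDiffAt_fibre (hU i) (hF i) ⟨hOU i hi hvO, hv.2⟩
  have h3 := congrArg (fun L : Vec n →L[ℝ] Vec n →L[ℝ] ℝ ↦ L w w')
    ((congrArg (fun f : Vec n → ℝ ↦ fderiv ℝ (fderiv ℝ f) (v.2 : Vec n)) h1).trans h2)
  refine h3.trans ?_
  simp only [sum_apply, smul_apply, smul_eq_mul]
  rw [← one_mul r, ← hsum v.1 hvO, Finset.sum_mul]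
  exact Finset.sum_congr rfl fun i hi ↦ congrArg (ρ i v.1 * ·) (hr i (hOU i hi hvO))

end Gluing

/-! ### Differences of functions, and functions linear on the fibres -/

section BaseForms

variable {n : ℕ} {M : Type*} [TopologicalSpace M] [ChartedSpace (EuclideanSpace ℝ (Fin n)) M]
  [IsManifold (𝓡 n) ∞ M]

theorem formVal_hilbertTwoForm_sub {U : Set M} (hU : IsOpen U)
    {F₁ F₂ : TangentBundle (𝓡 n) M → ℝ}
    (h₁ : ContMDiffOn (𝓡 n).tangent 𝓘(ℝ, ℝ) ∞ F₁ (slit U))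
    (h₂ : ContMDiffOn (𝓡 n).tangent 𝓘(ℝ, ℝ) ∞ F₂ (slit U)) {v : TangentBundle (𝓡 n) M}
    (hv : v ∈ slit U) (X Y : Vec n × Vec n) :
    formVal (hilbertTwoForm fun v ↦ F₁ v - F₂ v) v ![X, Y] =
      formVal (hilbertTwoForm F₁) v ![X, Y] - formVal (hilbertTwoForm F₂) v ![X, Y] := by
  have hz := tchart_self_mem_slitChart hv
  have hO := isOpen_slitChart hU v
  have hd : ∀ {F : TangentBundle (𝓡 n) M → ℝ},
      ContMDiffOn (𝓡 n).tangent 𝓘(ℝ, ℝ) ∞ F (slit U) → ∀ z ∈ slitChart U v,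
        DifferentiableAt ℝ (funInChart F v) z ∧ DifferentiableAt ℝ (fderiv ℝ (funInChart F v)) z :=
    fun hF z hz ↦ by
      have h := (contDiffOn_funInChart hU hF v).contDiffAt (hO.mem_nhds hz)
      exact ⟨h.differentiableAt (by simp),
        (h.fderiv_right (m := ∞) (by simp)).differentiableAt (by simp)⟩
  have h3 : fderiv ℝ (funInChart (fun v ↦ F₁ v - F₂ v) v) =ᶠ[nhds (tchart v v)]
      fun z ↦ fderiv ℝ (funInChart F₁ v) z - fderiv ℝ (funInChart F₂ v) z := by
    filter_upwards [hO.mem_nhds hz] with z hz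
    exact fderiv_fun_sub (hd h₁ z hz).1 (hd h₂ z hz).1
  rw [formVal_hilbertTwoForm hU (h₁.sub h₂) hv, formVal_hilbertTwoForm hU h₁ hv,
    formVal_hilbertTwoForm hU h₂ hv, h3.fderiv_eq, fderiv_fun_sub (hd h₁ _ hz).2 (hd h₂ _ hz).2]
  simp only [sub_apply]
  ring

/-- The function `(x, y) ↦ α_x(y)` on `TM` of a 1-form `α` on `M`. -/
noncomputable def oneFormFun (α : DForm (𝓡 n) M 1) : TangentBundle (𝓡 n) M → ℝ := fun v ↦
  (α v.1 : Vec n [⋀^Fin 1]→L[ℝ] ℝ) ![v.2]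

theorem contMDiffOn_oneFormFun {α : DForm (𝓡 n) M 1} (hα : IsSmoothForm (𝓡 n) α) :
    ContMDiffOn (𝓡 n).tangent 𝓘(ℝ, ℝ) ∞ (oneFormFun α) (slit univ) := by
  refine contMDiffOn_of_funInChart fun v hv ↦ ⟨v, mem_extChartAt_source v, ?_⟩
  have hz := tchart_self_mem_slitChart hv
  have h1 : ContDiffOn ℝ ∞ (fun z : Vec n × Vec n ↦ formInChart (𝓡 n) α v.1 z.1 ![z.2])
      (slitChart univ v) := by
    refine ContDiffOn.alternating_apply (X := fun z : Vec n × Vec n ↦ ![z.2])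
      ((hα v.1).comp contDiffOn_fst fun z hz ↦ hz.1) ?_
    exact contDiffOn_pi.2 fun i ↦ by fin_cases i; exact contDiffOn_snd
  refine (h1.contDiffAt ((isOpen_slitChart isOpen_univ v).mem_nhds hz)).congr_of_eventuallyEq ?_
  filter_upwards [(isOpen_slitChart isOpen_univ v).mem_nhds hz] with z hz
  simp only [funInChart, Function.comp_apply]
  rw [tchart_symm_apply v hz.1]
  refine Eq.trans ?_ (formInChart_apply α v.1 z.1 ![z.2]).symm
  refine congrArg (α ((extChartAt (𝓡 n) v.1).symm z.1) : Vec n [⋀^Fin 1]→L[ℝ] ℝ) ?_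
  funext i
  fin_cases i
  rfl

theorem oneFormFun_smul (α : DForm (𝓡 n) M 1) (v : TangentBundle (𝓡 n) M) (s : ℝ) :
    oneFormFun α ⟨v.1, s • v.2⟩ = s * oneFormFun α v := by
  have h := (α v.1 : Vec n [⋀^Fin 1]→L[ℝ] ℝ).toMultilinearMap.cons_smul ![] s v.2
  exact h

theorem fderiv_alternating_single {E : Type*} [NormedAddCommGroup E] [NormedSpace ℝ E]
    (η : E [⋀^Fin 1]→L[ℝ] ℝ) (y w : E) : fderiv ℝ (fun y ↦ η ![y]) y w = η ![w] := by
  let L : E →L[ℝ] ℝ := (ContinuousAlternatingMap.ofSubsingleton ℝ E ℝ (0 : Fin 1)).symm η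
  have h1 : ∀ y, L y = η ![y] := fun y ↦ congrArg η (by ext i; fin_cases i; rfl)
  have h2 : (fun y ↦ η ![y]) = L := funext fun y ↦ (h1 y).symm
  rw [h2, L.fderiv, h1]

/-- The Hilbert 1-form of `(x, y) ↦ α_x(y)` is the pullback of `α`. -/
theorem hilbertOneForm_oneFormFun (α : DForm (𝓡 n) M 1) (v : TangentBundle (𝓡 n) M) :
    hilbertOneForm (oneFormFun α) v = pullbackForm (𝓡 n).tangent (𝓡 n)
      (fun w : TangentBundle (𝓡 n) M ↦ w.1) α v := by
  refine alternating_one_ext (E := Vec n × Vec n) fun X ↦ ?_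
  refine Eq.trans ?_ (compContinuousLinearMap_single (E := Vec n × Vec n) (F := Vec n)
    (α v.1) (dproj v) X).symm
  exact fderiv_alternating_single (E := Vec n) (α v.1) v.2 (dproj v X)

theorem contMDiff_tangentProj :
    ContMDiff (𝓡 n).tangent (𝓡 n) ∞ (fun w : TangentBundle (𝓡 n) M ↦ w.1) :=
  Bundle.contMDiff_proj (TangentSpace (𝓡 n) (M := M))

/-- Exact forms on `M` are Hilbert 2-forms of functions that are linear on the fibres. -/
theorem formVal_hilbertTwoForm_oneFormFun {α : DForm (𝓡 n) M 1} {β : DForm (𝓡 n) M 2}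
    (hα : IsSmoothForm (𝓡 n) α) (hαβ : IsExtDeriv (𝓡 n) α β) (v : TangentBundle (𝓡 n) M)
    (X Y : Vec n × Vec n) :
    formVal (hilbertTwoForm (oneFormFun α)) v ![X, Y] =
      (β v.1 : Vec n [⋀^Fin 2]→L[ℝ] ℝ) ![X.1, Y.1] := by
  have h1 := extDeriv_formInChart_of_pullback (p := v) (q := v.1) isOpen_univ
    contMDiff_tangentProj.contMDiffOn
    (fun v _ ↦ hilbertOneForm_oneFormFun α v) (mem_univ v) (mem_extChartAt_source v)
    (mem_extChartAt_source v.1)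
    (((hα v.1).contDiffAt ((isOpen_extChartAt_target v.1).mem_nhds
      (mem_extChartAt_target v.1))).differentiableAt (by simp))
  rw [hαβ v.1 _ (mem_extChartAt_target v.1)] at h1
  have h2 : ∀ X : Vec n × Vec n, (fderiv ℝ (mapInCharts (𝓡 n).tangent (𝓡 n)
      (fun w : TangentBundle (𝓡 n) M ↦ w.1) v v.1) (tchart v v)) X = X.1 := fun X ↦ by
    refine (fderiv_mapInCharts_apply (mdifferentiableAt_proj v) (mem_extChartAt_source v)
      (mem_extChartAt_source v.1) X).trans ?_
    refine (mfderiv_extChartAt_self_apply v.1 _).trans ?_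
    refine (congrArg (dproj v : Vec n × Vec n →L[ℝ] Vec n)
      (mfderiv_extChartAt_symm_self v X)).trans (dproj_apply v X)
  refine (congrArg (fun η : (Vec n × Vec n) [⋀^Fin 2]→L[ℝ] ℝ ↦ η ![X, Y]) h1).trans ?_
  refine (compContinuousLinearMap_pair (E := Vec n × Vec n) (F := Vec n) _ _ X Y).trans ?_
  rw [h2, h2]
  exact formInChart_self β v.1 ![X.1, Y.1]

end BaseForms

/-! ### Global potentials of path forms -/

section Global

variable {E : Type*} [NormedAddCommGroup E] [NormedSpace ℝ E]
  {H : Type*} [TopologicalSpace H] {I : ModelWithCorners ℝ E H} [I.Boundaryless]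
  {N : Type*} [TopologicalSpace N] [ChartedSpace H N] [IsManifold I ∞ N]

theorem formInChart_sub {k : ℕ} (σ τ : DForm I N k) (p : N) (z : E) :
    formInChart I (fun v ↦ σ v - τ v) p z = formInChart I σ p z - formInChart I τ p z := by
  ext m; rfl

theorem SmoothFormOn.sub {k : ℕ} {O : Set N} {σ τ : DForm I N k} (hσ : SmoothFormOn I O σ)
    (hτ : SmoothFormOn I O τ) : SmoothFormOn I O fun v ↦ σ v - τ v := fun p v hv hvO ↦ by
  have h1 : formInChart I (fun v ↦ σ v - τ v) p =
      fun z ↦ formInChart I σ p z - formInChart I τ p z := funext fun z ↦ formInChart_sub σ τ p z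
  rw [h1]
  exact (hσ p v hv hvO).sub (hτ p v hv hvO)

theorem ClosedFormOn.sub {k : ℕ} {O : Set N} {σ τ : DForm I N k} (hσs : SmoothFormOn I O σ)
    (hτs : SmoothFormOn I O τ) (hσ : ClosedFormOn I O σ)
    (hτ : ClosedFormOn I O τ) : ClosedFormOn I O fun v ↦ σ v - τ v := fun p v hv hvO ↦ by
  have h1 : formInChart I (fun v ↦ σ v - τ v) p =
      formInChart I σ p - formInChart I τ p := funext fun z ↦ formInChart_sub σ τ p z
  have h2 : formInChart I σ p = (formInChart I σ p - formInChart I τ p) + formInChart I τ p :=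
    (sub_add_cancel _ _).symm
  have h3 := hσ p v hv hvO
  have hd := (hτs p v hv hvO).differentiableAt (by simp)
  rw [h2, extDeriv_add (((hσs p v hv hvO).differentiableAt (by simp)).sub hd) hd,
    hτ p v hv hvO, add_zero] at h3
  rw [h1, h3]

variable {n : ℕ} {M : Type*} [TopologicalSpace M] [ChartedSpace (EuclideanSpace ℝ (Fin n)) M]
  [IsManifold (𝓡 n) ∞ M]

theorem surjective_dproj (v : TangentBundle (𝓡 n) M) : Function.Surjective (dproj v) := fun w ↦
  ⟨((w, 0) : Vec n × Vec n), dproj_apply v ((w, 0) : Vec n × Vec n)⟩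

theorem image_proj_slit (hn : 1 ≤ n) :
    (fun w : TangentBundle (𝓡 n) M ↦ w.1) '' slit univ = univ := by
  have : Nontrivial (Vec n) :=
    Module.nontrivial_of_finrank_pos (R := ℝ) (by rw [finrank_euclideanSpace_fin]; exact hn)
  obtain ⟨y, hy⟩ := exists_ne (0 : Vec n)
  exact eq_univ_of_forall fun x ↦ ⟨⟨x, y⟩, ⟨mem_univ _, hy⟩, rfl⟩

/-- If `H² = 0`, the local potentials can be corrected to a global one. A partition of unity gives a
function `F'` whose Hilbert 2-form differs from `τ` by the pullback of a closed 2-form `β = dα` on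
`M`, and `F' - α_x(y)` has the Hilbert 2-form `τ`. -/
theorem IsPathForm.exists_isMetrizedBy [T2Space M] [ParacompactSpace M] (hn : 3 ≤ n)
    {Γ : VField n M} (hΓ : IsSpray univ Γ)
    {τ : DForm (𝓡 n).tangent (TangentBundle (𝓡 n) M) 2} (hτ : IsPathForm Γ τ)
    (hH : SecondDeRhamVanishes (𝓡 n) M) : ∃ F, IsMetrizedBy univ Γ F := by
  choose U F hU hxU hF hh hFτ using hτ.exists_local_potential hn hΓ
  obtain ⟨ρ, hρ⟩ := exists_smoothPartitionOfUnity (I := 𝓡 n) fun x ↦ (hU x).mem_nhds (hxU x)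
  let F' := glue (fun i ↦ ρ i) F
  have hF' : ContMDiffOn (𝓡 n).tangent 𝓘(ℝ, ℝ) ∞ F' (slit univ) := contMDiffOn_glue ρ hU hρ hF
  have hO : IsOpen (slit (n := n) (M := M) univ) := isOpen_slit isOpen_univ
  have hθ := smoothFormOn_hilbertOneForm isOpen_univ hF'
  -- the error `μ` kills vertical vectors, since `F'` has the right fibre Hessian
  let μ : DForm (𝓡 n).tangent (TangentBundle (𝓡 n) M) 2 := fun v ↦ hilbertTwoForm F' v - τ v
  have hμval : ∀ v X Y, formVal μ v ![X, Y] =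
      formVal (hilbertTwoForm F') v ![X, Y] - formVal τ v ![X, Y] := fun v X Y ↦ rfl
  have hμker : ∀ v ∈ slit univ, ∀ (w : Vec n) Y, formVal μ v ![(0, w), Y] = 0 := by
    intro v hv w Y
    have h1 : formVal τ v ![(0, w), Y] = formVal τ v ![(0, w), (Y.1, 0)] := by
      have h2 : Y = (Y.1, 0) + (0, Y.2) := by simp
      conv_lhs => rw [h2]
      rw [alternating_add_right, hτ.vertical v hv, add_zero]
    rw [hμval, formVal_hilbertTwoForm_vertical isOpen_univ hF' hv, h1, sub_eq_zero]
    refine fibreHessian_glue ρ hU hρ hF hv fun x hx ↦ ?_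
    refine (formVal_hilbertTwoForm_vertical (hU x) (hF x) ⟨hx, hv.2⟩ w (Y.1, 0)).symm.trans ?_
    exact congrArg (fun η : (Vec n × Vec n) [⋀^Fin 2]→L[ℝ] ℝ ↦ η ![(0, w), (Y.1, 0)])
      (hFτ x v ⟨hx, hv.2⟩)
  obtain ⟨β, hβs, hβc, hβ⟩ := exists_pullback_eq (τ := μ) hO contMDiff_tangentProj.contMDiffOn
    (fun v _ ↦ surjective_dproj v) (image_proj_slit (by omega))
    (fun v hv w hw h ↦ joinedInFibre_proj (by omega) hv hw h)
    ((hθ.extDerivForm hO).sub hτ.smooth)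
    (ClosedFormOn.sub (hθ.extDerivForm hO) hτ.smooth (closedFormOn_extDerivForm hO hθ) hτ.closed)
    (fun v hv X Y hX ↦ by
      have h1 : X = (0, X.2) := Prod.ext ((dproj_apply v X).symm.trans hX) rfl
      have h2 := hμker v hv X.2 Y
      rw [← h1] at h2
      exact h2)
  have hβ' : ∀ v ∈ slit univ, ∀ X Y : Vec n × Vec n, formVal μ v ![X, Y] =
      (β v.1 : Vec n [⋀^Fin 2]→L[ℝ] ℝ) ![X.1, Y.1] := fun v hv X Y ↦ by
    refine (hβ v hv X Y).trans ?_
    have h1 : (dproj v : Vec n × Vec n →L[ℝ] Vec n) X = X.1 := dproj_apply v X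
    have h2 : (dproj v : Vec n × Vec n →L[ℝ] Vec n) Y = Y.1 := dproj_apply v Y
    exact congrArg₂ (fun a b : Vec n ↦ (β v.1 : Vec n [⋀^Fin 2]→L[ℝ] ℝ) ![a, b]) h1 h2
  obtain ⟨α, hα, hαβ⟩ := hH β hβs hβc
  have hG := contMDiffOn_oneFormFun hα
  refine ⟨fun v ↦ F' v - oneFormFun α v, hτ.isMetrizedBy hΓ isOpen_univ (hF'.sub hG)
    (fun v hv s hs ↦ ?_) fun v hv ↦ ?_⟩
  · have h1 : F' ⟨v.1, s • v.2⟩ = s * F' v := glue_homogeneous ρ hρ hh hv hs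
    rw [h1, oneFormFun_smul]
    ring
  · refine alternating_two_ext (E := Vec n × Vec n) fun X Y ↦ ?_
    refine (formVal_hilbertTwoForm_sub isOpen_univ hF' hG hv X Y).trans ?_
    rw [formVal_hilbertTwoForm_oneFormFun hα hαβ, ← hβ' v hv, hμval]
    exact sub_sub_cancel _ _

end Global

end PathGeometry

open PathGeometry in
theorem mainTheorem9 {n : ℕ} (hn : 3 ≤ n)
    {M : Type*} [TopologicalSpace M] [T2Space M] [ParacompactSpace M]
    [ChartedSpace (EuclideanSpace ℝ (Fin n)) M] [IsManifold (𝓡 n) ∞ M]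
    {P : Type*} [TopologicalSpace P]
    [ChartedSpace (EuclideanSpace ℝ (Fin (2 * n - 2))) P] [IsManifold (𝓡 (2 * n - 2)) ∞ P]
    (Γ : VField n M) (hΓ : IsSpray univ Γ)
    (π : TangentBundle (𝓡 n) M → P) (hπ : IsPathSpace Γ π) :
    ((∃ F, IsMetrizedBy univ Γ F) → HasLagrangianSymplecticForm π) ∧
    (SecondDeRhamVanishes (𝓡 n) M →
      ((∃ F, IsMetrizedBy univ Γ F) ↔ HasLagrangianSymplecticForm π)) ∧
    ((∃ (U : M → Set M) (F : M → TangentBundle (𝓡 n) M → ℝ),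
        (∀ x, IsOpen (U x) ∧ x ∈ U x ∧ IsMetrizedBy (U x) Γ (F x)) ∧
        ∀ x x', SameHilbertTwoForm (U x ∩ U x') (F x) (F x')) ↔
      HasLagrangianSymplecticForm π) := by
  have hlocal : (∃ (U : M → Set M) (F : M → TangentBundle (𝓡 n) M → ℝ),
      (∀ x, IsOpen (U x) ∧ x ∈ U x ∧ IsMetrizedBy (U x) Γ (F x)) ∧
      ∀ x x', SameHilbertTwoForm (U x ∩ U x') (F x) (F x')) → HasLagrangianSymplecticForm π := by
    rintro ⟨U, F, h, hs⟩
    obtain ⟨τ, hτ, hmax⟩ := isPathForm_of_sameHilbertTwoForm hΓ h hs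
    exact hπ.hasLagrangianSymplecticForm (by omega) hΓ hτ hmax
  have hglobal : (∃ F, IsMetrizedBy univ Γ F) → HasLagrangianSymplecticForm π := by
    rintro ⟨F, hF⟩
    exact hlocal ⟨fun _ ↦ univ, fun _ ↦ F, fun _ ↦ ⟨isOpen_univ, mem_univ _, hF⟩,
      fun _ _ _ _ _ _ ↦ rfl⟩
  refine ⟨hglobal, fun hH ↦ ⟨hglobal, ?_⟩, hlocal, ?_⟩
  · rintro ⟨Ω, hΩ, hL⟩
    exact (hπ.isPathForm_pullback (by omega) hΓ hΩ hL).exists_isMetrizedBy hn hΓ hH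
  · rintro ⟨Ω, hΩ, hL⟩
    have hτ := hπ.isPathForm_pullback (by omega) hΓ hΩ hL
    choose U F hU hxU hF hh hFτ using hτ.exists_local_potential hn hΓ
    refine ⟨U, F, fun x ↦ ⟨hU x, hxU x, hτ.isMetrizedBy hΓ (hU x) (hF x) (hh x) (hFτ x)⟩,
      fun x x' ↦ sameHilbertTwoForm_of_eq (hU x) (hU x') (hF x) (hF x') fun v hv ↦ ?_⟩
    exact (hFτ x v ⟨hv.1.1, hv.2⟩).trans (hFτ x' v ⟨hv.1.2, hv.2⟩).symm
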